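/- **Setting.** Let $R$ be a commutative ring and $n\in\mathbb N$, and fix $2n$ points $P_n$ on the $y$-axis of $\mathbb R^2$. A planar matching is an isotopy class (rel boundary) of $n$ disjoint properly embedded arcs with ends $P_n$ in one of the half-planes $\overleftarrow{\mathbb H}=(-\infty,0]\times\mathbb R$, $\overrightarrow{\mathbb H}=[0,\infty)\times\mathbb R$. An $n$-cleaved link $L$ is the union of a matching $\overleftarrow L$ in $\overleftarrow{\mathbb H}$ and a matching $\overrightarrow L$ in $\overrightarrow{\mathbb H}$; its components are its circles. A decoration $\sigma$ assigns $+$ or $-$ to each circle; $\sigma_C$ is $\sigma$ with the sign of the $+$ circle $C$ changed to $-$. A bridge $\gamma$ of $L$ is an isotopy class of arcs in the interior of one half-plane, joining two distinct arcs of the matching there (feet slide along these arcs) and otherwise disjoint from it; $L_\gamma$ is the result of surgery on $L$ along $\gamma$, and $\gamma^\dagger$ is the bridge of $L_\gamma$ given by the co-core. A bridge merges two circles of $L$ or divides one circle into two. The support of $\gamma$ consists of these circles of $L$ and the resulting circles of $L_\gamma$. For bridges $\gamma\ne\eta$ of $L$: $\eta\in B_\pitchfork(L,\gamma)$ if all representatives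 of $\eta$ meet $\gamma$; otherwise $\eta$ is parallel to $\gamma$, and then $\eta\in B_d(L,\gamma)$ if it has no end on an arc with $\gamma$, while $\eta\in B_s(L,\gamma)$ (resp. $B_o(L,\gamma)$) if it has one end on an arc with $\gamma$, on the same (resp. opposite) side of that arc as $\gamma$. **The graph $\Gamma_n$.** Its vertices are the decorated $n$-cleaved links $(L,\sigma)$. Its edges are: * bridge edges $e_{(\gamma,\sigma,\sigma')}:(L,\sigma)\to(L_\gamma,\sigma')$, for bridges $\gamma$ of $L$, where $\sigma=\sigma'$ off the support of $\gamma$, and on the support the signs change by $(+,+)\mapsto+$, $(\pm,\mp)\mapsto-$ for merges, and $+\mapsto(+,-)$, $+\mapsto(-,+)$, $-\mapsto(-,-)$ for divisions; * for each $C$ with $\sigma(C)=+$, two decoration edges $\overleftarrow{e_C},\overrightarrow{e_C}:(L,\sigma)\to(L,\sigma_C)$, with support $C$. An edge is located on the left or on the right. The bigrading of left/right bridge edges is $(1,\tfrac12)$, $(0,-\tfrac12)$; that of $\overleftarrow{e_C}$, $\overrightarrow{e_C}$ is $(1,1)$, $(0,-1)$; it is extended additively to paths, and $|\cdot|$ denotes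 its first component. **The cleaver category $\mathcal B\Gamma_n$.** It is the quotient of the $R$-linear path category of $\Gamma_n$ (composition $\alpha\beta$ is: first $\alpha$, then $\beta$) by the two-sided ideal generated by the following relations. Below, every edge is written by its bridge or circle only, and each relation is imposed whenever the edges in it exist and the paths in it have the same source and the same target. 1. *Disjoint supports.* $e_\alpha e_{\beta}=(-1)^{|e_\alpha||e_\beta|}e_\beta e_{\alpha}$ for two edges with the same source and disjoint supports (second edges: same type, location, and bridge or circle). 2. *Right decoration edges.* If $\gamma$ merges $C_1,C_2$ into $C$, all decorated $+$: $\overrightarrow{e_{C_1}}m_\gamma=\overrightarrow{e_{C_2}}m_\gamma=m_\gamma\overrightarrow{e_C}$. If $\gamma$ divides a $+$ circle $C$ into $C_1,C_2$: $\overrightarrow{e_C}f_\gamma=f^1_\gamma\overrightarrow{e_{C_1}}=f^2_\gamma\overrightarrow{e_{C_2}}$, where $f^i_\gamma$ ends at the decoration with $+$ on $C_i$ and $-$ on $C_{3-i}$. 3. *Left decoration edges.* In the same situations, with $\varepsilon=+1$ for left bridges and $\varepsilon=-1$ for right bridges: $\overleftarrow{e_{C_1}}m_\gamma+\overleftarrow{e_{C_2}}m_\gamma+\varepsilon\,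 m_\gamma\overleftarrow{e_C}=0$ and $\overleftarrow{e_C}f_\gamma+\varepsilon\, f^1_\gamma\overleftarrow{e_{C_1}}+\varepsilon\, f^2_\gamma\overleftarrow{e_{C_2}}=0$. 4. *Squares of bridges.* For parallel bridges $\gamma,\gamma'$ of $L$, represented by disjoint arcs, and any decorations for which the square exists, $e_\gamma e_{\gamma'}=(-1)^{|e_\gamma||e_{\gamma'}|}e_{\gamma'}e_\gamma$, if at least one of them is a right bridge, or both are left bridges and $\gamma'\in B_d(L,\gamma)\cup B_o(L,\gamma)$. 5. *Triples.* If $\gamma,\gamma'$ are left bridges with $\gamma'\in B_s(L,\gamma)$, and $\gamma''$ is obtained by sliding an end of $\gamma$ over $\gamma'$, then $e_\gamma e_\delta+e_{\gamma'}e_\zeta+e_{\gamma''}e_\eta=0$, where $\delta,\zeta,\eta$ are the bridges of $L_\gamma,L_{\gamma'},L_{\gamma''}$ represented by the two other bridges of the triple. 6. *Crossing bridges.* $e_\gamma e_\eta=0$ if $\gamma$ is a left bridge of $L$ and $\eta\in B_\pitchfork(L_\gamma,\gamma^\dagger)$. 7. *There and back.* For a right bridge $\gamma$ and a path $(L,\sigma)\to(L_\gamma,\sigma')\to(L,\sigma_C)$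 along $\gamma$ and then $\gamma^\dagger$: $e_\gamma e_{\gamma^\dagger}=\overrightarrow{e_C}$. The relations are homogeneous; the classes of paths of bigrading $(i,j)$ span the homogeneous morphisms of bigrading $(i,j)$ of $\mathcal B\Gamma_n$. **Proposition.** There is a unique family $d=d_{\Gamma_n}$ of $R$-linear endomorphisms of the morphism modules of $\mathcal B\Gamma_n$ such that (a) for every decorated link $(L,\sigma)$ and every circle $C$ of $L$ with $\sigma(C)=+$, $$d(\overleftarrow{e_C})=-\sum e_{(\gamma,\sigma,\sigma')}\,e_{(\gamma^\dagger,\sigma',\sigma_C)},$$ summed over all paths $(L,\sigma)\to(L_\gamma,\sigma')\to(L,\sigma_C)$ of length two along a left bridge $\gamma$ of $L$ and then $\gamma^\dagger$; and $d(e)=0$ for every other edge $e$ (all bridge edges and all $\overrightarrow{e_C}$); (b) $d$ is a right differential of bigrading $(1,0)$: $d(I_v)=0$ for identities; $d(\alpha\beta)=(-1)^{|\beta|}d(\alpha)\beta+\alpha\,d(\beta)$ for composable $\alpha$ and homogeneous $\beta$; $d$ maps morphisms of bigrading $(i,j)$ to morphisms of bigrading $(i+1,j)$; and $d\circ d=0$.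 In particular the extension of $d$ from edges to paths by the Leibniz rule is compatible with all the defining relations of $\mathcal B\Gamma_n$. -/

import Mathlib

open CategoryTheory

namespace CleavedLinks

/-! ### Planar matchings, bridges and surgery

The marked points `p₁ < ⋯ < p₂ₙ` of the `y`-axis are the elements of `Fin (2 * n)`.  Isotopy classes
(rel boundary) of proper embeddings of `n` disjoint arcs in a half-plane, with the marked points as
ends, are the noncrossing perfect matchings of the marked points. -/

/-- The isotopy class of a planar matching of the `2n` marked points in a half-plane: its arcs, each
given by its two ends. -/
@[ext] structure PlanarMatching (n : ℕ) where
  arcs : Finset (Finset (Fin (2 * n)))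
  card_arc : ∀ c ∈ arcs, c.card = 2
  cover : ∀ x, ∃! c, c ∈ arcs ∧ x ∈ c
  noncrossing : ∀ i j k l : Fin (2 * n), i < j → j < k → k < l →
    ¬ (({i, k} : Finset (Fin (2 * n))) ∈ arcs ∧ ({j, l} : Finset (Fin (2 * n))) ∈ arcs)

section Graph

variable {n : ℕ}

/-- The marked point `x` lies strictly between the two ends of the arc `c`. -/
def IsUnder (c : Finset (Fin (2 * n))) (x : Fin (2 * n)) : Prop :=
  ∃ i ∈ c, ∃ j ∈ c, i < x ∧ x < j

/-- The arcs `b` and `d` lie on the same side of the arc `c`. -/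
def SameSideOf (c b d : Finset (Fin (2 * n))) : Prop :=
  ∀ x ∈ b, ∀ y ∈ d, (IsUnder c x ↔ IsUnder c y)

/-- The arcs `b` and `d` lie on opposite sides of the arc `c`. -/
def OppositeSidesOf (c b d : Finset (Fin (2 * n))) : Prop :=
  ∀ x ∈ b, ∀ y ∈ d, ¬ (IsUnder c x ↔ IsUnder c y)

/-- Equivalence classes of bridges for `M`.  The regions of the complement of `M` are discs, and two
arcs of `M` are adjacent to at most one common region, so a class of bridges is an unordered pair
`γ = {a, b}` of distinct arcs that are adjacent to a common region, that is, which are not separated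
by any other arc of `M`. -/
def IsBridge (M : PlanarMatching n) (γ : Finset (Finset (Fin (2 * n)))) : Prop :=
  ∃ a ∈ M.arcs, ∃ b ∈ M.arcs, a ≠ b ∧ γ = {a, b} ∧
    ∀ c ∈ M.arcs, c ≠ a → c ≠ b → SameSideOf c a b

/-- The ends (on the `y`-axis) of the arcs which carry the feet of the bridge `γ`. -/
def ends (γ : Finset (Finset (Fin (2 * n)))) : Set (Fin (2 * n)) :=
  {x | ∃ c ∈ γ, x ∈ c}

/-- `M'` is the result `M_γ` of surgery on `M` along the bridge `γ`: the two arcs of `γ` are replaced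
by two other arcs with the same four ends, and the other arcs are kept.  (The four points have
only one other noncrossing matching, so `M'` is determined by `M` and `γ`.) -/
def IsSurgery (M : PlanarMatching n) (γ : Finset (Finset (Fin (2 * n)))) (M' : PlanarMatching n) :
    Prop :=
  ∃ δ : Finset (Finset (Fin (2 * n))),
    Disjoint δ M.arcs ∧ ends δ = ends γ ∧ M'.arcs = (M.arcs \ γ) ∪ δ

/-- The bridge `γ†` of `M' = M_γ`, the co-core of the surgery: it joins the two new arcs. -/
def dagger (M M' : PlanarMatching n) : Finset (Finset (Fin (2 * n))) :=
  M'.arcs \ M.arcs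

/-- All representatives of the bridges `γ` and `η` of a planar matching intersect: the bridges have
their feet on four distinct arcs, and the two arcs of `γ` separate the two arcs of `η` on the
boundary line. -/
def Crosses (γ η : Finset (Finset (Fin (2 * n)))) : Prop :=
  Disjoint γ η ∧ ∃ a ∈ γ, ∃ b ∈ γ, ∃ c ∈ η, ∃ d ∈ η, a ≠ b ∧ c ≠ d ∧
    ∃ x ∈ a, ∃ y ∈ b, ∃ z ∈ c, ∃ w ∈ d, x < z ∧ z < y ∧ (w < x ∨ y < w)

/-- `η` is distinct from `γ` and has a representative disjoint from `γ`; this is the set `B_∥`. -/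
def Parallel (γ η : Finset (Finset (Fin (2 * n)))) : Prop :=
  γ ≠ η ∧ ¬ Crosses γ η

/-- `η ∈ B_d(γ)`: disjoint from `γ`, and no end of `η` is on an arc with `γ`. -/
def ParallelDisjoint (γ η : Finset (Finset (Fin (2 * n)))) : Prop :=
  Parallel γ η ∧ Disjoint γ η

/-- `η ∈ B_s(γ)`: one end on an arc with `γ`, on the same side of that arc as `γ`. -/
def ParallelSame (γ η : Finset (Finset (Fin (2 * n)))) : Prop :=
  ∃ a b d, a ≠ b ∧ a ≠ d ∧ b ≠ d ∧ γ = {a, b} ∧ η = {a, d} ∧ SameSideOf a b d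

/-- `η ∈ B_o(γ)`: one end on an arc with `γ`, on the opposite side of that arc. -/
def ParallelOpposite (γ η : Finset (Finset (Fin (2 * n)))) : Prop :=
  ∃ a b d, a ≠ b ∧ a ≠ d ∧ b ≠ d ∧ γ = {a, b} ∧ η = {a, d} ∧ OppositeSidesOf a b d

/-- The bridge `μ` of `M' = M_γ` is the class of a representative, disjoint from `γ`, of the bridge
`η` of `M`: feet of `η` on arcs not in `γ` stay on these arcs, and a foot of `η` on an arc of `γ`
is now on one of the two new arcs. -/
def IsImage (M M' : PlanarMatching n) (γ η μ : Finset (Finset (Fin (2 * n)))) : Prop :=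
  μ \ dagger M M' = η \ γ

/-! ### Cleaved links, circles, decorations -/

/-- The two half-planes `(-∞, 0] × ℝ` and `[0, ∞) × ℝ`. -/
inductive Side
  | left
  | right
  deriving DecidableEq

/-- The parity of the elements located on a side. -/
def Side.parity : Side → ℤ
  | .left => 1
  | .right => 0

/-- Equivalence classes of `n`-cleaved links, given by their two constituents. -/
@[ext] structure CleavedLink (n : ℕ) where
  half : Side → PlanarMatching n

/-- The circle of `L` through the marked point `x`, recorded by the marked points on it. -/
def CleavedLink.circleAt (L : CleavedLink n) (x : Fin (2 * n)) : Set (Fin (2 * n)) :=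
  {y | Relation.EqvGen (fun p q => ∃ s, ∃ c ∈ (L.half s).arcs, p ∈ c ∧ q ∈ c) x y}

/-- The set of circles of `L`. -/
def CleavedLink.circles (L : CleavedLink n) : Set (Set (Fin (2 * n))) :=
  Set.range L.circleAt

/-- The circles of `L` that contain the feet of the bridge `γ`. -/
def CleavedLink.footCircles (L : CleavedLink n) (γ : Finset (Finset (Fin (2 * n)))) :
    Set (Set (Fin (2 * n))) :=
  L.circleAt '' ends γ

/-- The marked points on the circles of `L` that contain the feet of `γ`.  (The circles of `L_γ` that
contain the feet of `γ†` contain the same marked points.) -/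
def CleavedLink.support (L : CleavedLink n) (γ : Finset (Finset (Fin (2 * n)))) :
    Set (Fin (2 * n)) :=
  ⋃₀ L.footCircles γ

/-- The feet of `γ` are on two distinct circles of `L`. -/
def CleavedLink.IsMerge (L : CleavedLink n) (γ : Finset (Finset (Fin (2 * n)))) : Prop :=
  ∃ C₁ ∈ L.footCircles γ, ∃ C₂ ∈ L.footCircles γ, C₁ ≠ C₂

/-- Both feet of `γ` are on the same circle of `L`. -/
def CleavedLink.IsFission (L : CleavedLink n) (γ : Finset (Finset (Fin (2 * n)))) : Prop :=
  ∀ C₁ ∈ L.footCircles γ, ∀ C₂ ∈ L.footCircles γ, C₁ = C₂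

inductive Sign
  | plus
  | minus
  deriving DecidableEq

/-- Decorated `n`-cleaved links, the vertices of `Γ_n`. -/
structure DecLink (n : ℕ) where
  link : CleavedLink n
  dec : link.circles → Sign

/-- The decoration of the circle through `x`. -/
def DecLink.sign (v : DecLink n) (x : Fin (2 * n)) : Sign :=
  v.dec ⟨v.link.circleAt x, Set.mem_range_self x⟩

/-- The bridge `γ†` of the target `w` of a bridge edge `v ⟶ w` located at `s`. -/
def DecLink.dagger (s : Side) (v w : DecLink n) : Finset (Finset (Fin (2 * n))) :=
  CleavedLinks.dagger (v.link.half s) (w.link.half s)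

/-! ### The directed graph `Γ_n` -/

/-- Decorations of two circles and of the circle into which they merge. -/
inductive MergeRule : Sign → Sign → Sign → Prop
  | plus_plus : MergeRule .plus .plus .plus
  | minus_plus : MergeRule .minus .plus .minus
  | plus_minus : MergeRule .plus .minus .minus

/-- Decorations of a circle and of the two circles into which it is divided. -/
inductive FissionRule : Sign → Sign → Sign → Prop
  | plus_left : FissionRule .plus .plus .minus
  | plus_right : FissionRule .plus .minus .plus
  | minus : FissionRule .minus .minus .minus

/-- There is a bridge edge `v ⟶ w` for the bridge `γ` located at the side `s`. -/
structure IsBridgeEdge (s : Side) (γ : Finset (Finset (Fin (2 * n)))) (v w : DecLink n) : Prop where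
  bridge : IsBridge (v.link.half s) γ
  surgery : IsSurgery (v.link.half s) γ (w.link.half s)
  other_half : ∀ t, t ≠ s → w.link.half t = v.link.half t
  off_support : ∀ x, x ∉ v.link.support γ → w.sign x = v.sign x
  merge : ∀ x ∈ ends γ, ∀ y ∈ ends γ, v.link.circleAt x ≠ v.link.circleAt y →
    ∀ z ∈ ends (v.dagger s w), MergeRule (v.sign x) (v.sign y) (w.sign z)
  fission : v.link.IsFission γ →
    ∀ x ∈ ends (v.dagger s w), ∀ y ∈ ends (v.dagger s w), w.link.circleAt x ≠ w.link.circleAt y →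
      ∀ z ∈ ends γ, FissionRule (v.sign z) (w.sign x) (w.sign y)

/-- `C` is a `+` circle of `v`, and `w` is `v` with the decoration of `C` changed to `-`. -/
structure IsDecorationEdge (C : Set (Fin (2 * n))) (v w : DecLink n) : Prop where
  circle : C ∈ v.link.circles
  link_eq : w.link = v.link
  source : ∀ x ∈ C, v.sign x = .plus
  target : ∀ x ∈ C, w.sign x = .minus
  off_support : ∀ x, x ∉ C → w.sign x = v.sign x

/-- The edges of `Γ_n`: bridge edges, and for each `+` circle two decoration edges, one for each side.
The first argument of a constructor is the location. -/
inductive Edge (v w : DecLink n) : Type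
  | bridge (s : Side) (γ : Finset (Finset (Fin (2 * n)))) (h : IsBridgeEdge s γ v w)
  | decoration (s : Side) (C : Set (Fin (2 * n))) (h : IsDecorationEdge C v w)

namespace Edge

variable {v w : DecLink n}

def side : Edge v w → Side
  | bridge s _ _ => s
  | decoration s _ _ => s

def support : Edge v w → Set (Fin (2 * n))
  | bridge _ γ _ => v.link.support γ
  | decoration _ C _ => C

/-- The bigrading of an edge. -/
def bidegree : Edge v w → ℤ × ℚ
  | bridge .left _ _ => (1, 1 / 2)
  | bridge .right _ _ => (0, -1 / 2)
  | decoration .left _ _ => (1, 1)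
  | decoration .right _ _ => (0, -1)

/-- Two edges, possibly with different ends, have the same type and location, and belong to the same
bridge or the same circle. -/
def SameLabel {v' w' : DecLink n} : Edge v w → Edge v' w' → Prop
  | bridge s γ _, bridge s' γ' _ => s = s' ∧ γ = γ'
  | decoration s C _, decoration s' C' _ => s = s' ∧ C = C'
  | _, _ => False

end Edge

instance : Quiver (DecLink n) where
  Hom v w := Edge v w

end Graph

/-! ### The quiver category and the cleaver category -/

noncomputable section Categories

variable (R : Type*) [CommRing R] (n : ℕ)

/-- The pre-additive quiver category `𝒬Γ_n` over `R`: morphisms are `R`-linear combinations of directed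
paths in `Γ_n`, and composition (in diagrammatic order) is concatenation. -/
abbrev QuiverCat := Free R (Paths (DecLink n))

variable {n}

/-- A vertex of `Γ_n` as an object of `𝒬Γ_n`. -/
abbrev qObj (v : DecLink n) : QuiverCat R n :=
  (Free.embedding R (Paths (DecLink n))).obj ((Paths.of (DecLink n)).obj v)

/-- A path in `Γ_n` as a morphism of `𝒬Γ_n`. -/
abbrev qPath {v w : DecLink n} (p : Quiver.Path v w) : qObj R v ⟶ qObj R w :=
  (Free.embedding R (Paths (DecLink n))).map
    (X := (Paths.of (DecLink n)).obj v) (Y := (Paths.of (DecLink n)).obj w) p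

/-- An edge of `Γ_n` as a morphism of `𝒬Γ_n`. -/
abbrev qEdge {v w : DecLink n} (e : Edge v w) : qObj R v ⟶ qObj R w :=
  qPath R (Quiver.Hom.toPath (V := DecLink n) (a := v) (b := w) e)

/-- The path consisting of the bridge edge for `γ` at `s`, as a morphism of `𝒬Γ_n`. -/
abbrev qBridge {v w : DecLink n} {s : Side} {γ : Finset (Finset (Fin (2 * n)))}
    (h : IsBridgeEdge s γ v w) : qObj R v ⟶ qObj R w :=
  qEdge R (.bridge s γ h)

/-- The decoration edge for `C` at `s`, as a morphism of `𝒬Γ_n`. -/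
abbrev qDec {v w : DecLink n} (s : Side) {C : Set (Fin (2 * n))}
    (h : IsDecorationEdge C v w) : qObj R v ⟶ qObj R w :=
  qEdge R (.decoration s C h)

/-- The sign `(-1)^{|e||f|}` for elements `e`, `f` located at `s`, `t`. -/
abbrev koszul (s t : Side) : ℤˣ := (s.parity * t.parity).negOnePow

/-- The defining relations of the cleaver category: the morphisms of `𝒬Γ_n` which are set to zero. -/
inductive Relator : ∀ ⦃v w : DecLink n⦄, (qObj R v ⟶ qObj R w) → Prop
  /-- Squares of edges with disjoint supports. -/
  | disjoint {v a b w : DecLink n} (α : Edge v a) (β' : Edge a w) (β : Edge v b) (α' : Edge b w)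
      (disj : Disjoint α.support β.support) (hα : α.SameLabel α') (hβ : β.SameLabel β') :
      Relator (qEdge R α ≫ qEdge R β' - koszul α.side β.side • (qEdge R β ≫ qEdge R α'))
  /-- Right decoration edges and merges. -/
  | right_merge {v a b w : DecLink n} {s : Side} {γ : Finset (Finset (Fin (2 * n)))}
      {C₁ C : Set (Fin (2 * n))}
      (h₁ : IsDecorationEdge C₁ v b) (m₁ : IsBridgeEdge s γ b w)
      (m : IsBridgeEdge s γ v a) (h : IsDecorationEdge C a w)
      (hγ : v.link.IsMerge γ) (hC₁ : C₁ ∈ v.link.footCircles γ)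
      (hC : C ∈ a.link.footCircles (v.dagger s a)) :
      Relator (qDec R .right h₁ ≫ qBridge R m₁ - qBridge R m ≫ qDec R .right h)
  /-- Right decoration edges and divisions. -/
  | right_fission {v a b w : DecLink n} {s : Side} {γ : Finset (Finset (Fin (2 * n)))}
      {C C₁ : Set (Fin (2 * n))}
      (h : IsDecorationEdge C v b) (f : IsBridgeEdge s γ b w)
      (f₁ : IsBridgeEdge s γ v a) (h₁ : IsDecorationEdge C₁ a w)
      (hγ : v.link.IsFission γ) (hC : C ∈ v.link.footCircles γ)
      (hC₁ : C₁ ∈ a.link.footCircles (v.dagger s a)) :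
      Relator (qDec R .right h ≫ qBridge R f - qBridge R f₁ ≫ qDec R .right h₁)
  /-- Left decoration edges and merges; the sign of the last term is `+` for left bridges and `-` for
  right bridges. -/
  | left_merge {v a b₁ b₂ w : DecLink n} {s : Side} {γ : Finset (Finset (Fin (2 * n)))}
      {C₁ C₂ C : Set (Fin (2 * n))}
      (h₁ : IsDecorationEdge C₁ v b₁) (m₁ : IsBridgeEdge s γ b₁ w)
      (h₂ : IsDecorationEdge C₂ v b₂) (m₂ : IsBridgeEdge s γ b₂ w)
      (m : IsBridgeEdge s γ v a) (h : IsDecorationEdge C a w)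
      (hC₁ : C₁ ∈ v.link.footCircles γ) (hC₂ : C₂ ∈ v.link.footCircles γ) (hne : C₁ ≠ C₂)
      (hC : C ∈ a.link.footCircles (v.dagger s a)) :
      Relator (qDec R .left h₁ ≫ qBridge R m₁ + qDec R .left h₂ ≫ qBridge R m₂
        - s.parity.negOnePow • (qBridge R m ≫ qDec R .left h))
  /-- Left decoration edges and divisions; the sign of the last two terms is `+` for left bridges and
  `-` for right bridges. -/
  | left_fission {v a₁ a₂ b w : DecLink n} {s : Side} {γ : Finset (Finset (Fin (2 * n)))}
      {C C₁ C₂ : Set (Fin (2 * n))}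
      (h : IsDecorationEdge C v b) (f : IsBridgeEdge s γ b w)
      (f₁ : IsBridgeEdge s γ v a₁) (h₁ : IsDecorationEdge C₁ a₁ w)
      (f₂ : IsBridgeEdge s γ v a₂) (h₂ : IsDecorationEdge C₂ a₂ w)
      (hγ : v.link.IsFission γ) (hC : C ∈ v.link.footCircles γ)
      (hC₁ : C₁ ∈ a₁.link.footCircles (v.dagger s a₁))
      (hC₂ : C₂ ∈ a₂.link.footCircles (v.dagger s a₂)) (hne : C₁ ≠ C₂) :
      Relator (qDec R .left h ≫ qBridge R f
        - s.parity.negOnePow • (qBridge R f₁ ≫ qDec R .left h₁ + qBridge R f₂ ≫ qDec R .left h₂))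
  /-- Squares of bridges located on different sides. -/
  | bridge_sides {v a b w : DecLink n} {s t : Side} {γ η : Finset (Finset (Fin (2 * n)))}
      (hst : s ≠ t)
      (e₁ : IsBridgeEdge s γ v a) (e₂ : IsBridgeEdge t η a w)
      (e₃ : IsBridgeEdge t η v b) (e₄ : IsBridgeEdge s γ b w) :
      Relator (qBridge R e₁ ≫ qBridge R e₂ - qBridge R e₃ ≫ qBridge R e₄)
  /-- Squares of parallel right bridges. -/
  | bridge_right {v a b w : DecLink n} {γ η μ ν : Finset (Finset (Fin (2 * n)))}
      (e₁ : IsBridgeEdge .right γ v a) (e₂ : IsBridgeEdge .right μ a w)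
      (e₃ : IsBridgeEdge .right η v b) (e₄ : IsBridgeEdge .right ν b w)
      (par : Parallel γ η)
      (hμ : IsImage (v.link.half .right) (a.link.half .right) γ η μ)
      (hν : IsImage (v.link.half .right) (b.link.half .right) η γ ν) :
      Relator (qBridge R e₁ ≫ qBridge R e₂ - qBridge R e₃ ≫ qBridge R e₄)
  /-- Squares of parallel left bridges with no shared arc, or on opposite sides of a shared arc. -/
  | bridge_left {v a b w : DecLink n} {γ η μ ν : Finset (Finset (Fin (2 * n)))}
      (e₁ : IsBridgeEdge .left γ v a) (e₂ : IsBridgeEdge .left μ a w)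
      (e₃ : IsBridgeEdge .left η v b) (e₄ : IsBridgeEdge .left ν b w)
      (par : ParallelDisjoint γ η ∨ ParallelOpposite γ η)
      (hμ : IsImage (v.link.half .left) (a.link.half .left) γ η μ)
      (hν : IsImage (v.link.half .left) (b.link.half .left) η γ ν) :
      Relator (qBridge R e₁ ≫ qBridge R e₂ + qBridge R e₃ ≫ qBridge R e₄)
  /-- Triples of left bridges: `γ₃` is the result of sliding an end of `γ₁` over `γ₂`. -/
  | bridge_triple {v a₁ a₂ a₃ w : DecLink n} {γ₁ γ₂ γ₃ δ ζ η : Finset (Finset (Fin (2 * n)))}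
      (e₁ : IsBridgeEdge .left γ₁ v a₁) (e₁' : IsBridgeEdge .left δ a₁ w)
      (e₂ : IsBridgeEdge .left γ₂ v a₂) (e₂' : IsBridgeEdge .left ζ a₂ w)
      (e₃ : IsBridgeEdge .left γ₃ v a₃) (e₃' : IsBridgeEdge .left η a₃ w)
      (par : ParallelSame γ₁ γ₂) (slide : γ₃ = (γ₁ \ γ₂) ∪ (γ₂ \ γ₁))
      (hδ : IsImage (v.link.half .left) (a₁.link.half .left) γ₁ γ₂ δ)
      (hζ : IsImage (v.link.half .left) (a₂.link.half .left) γ₂ γ₁ ζ)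
      (hη : IsImage (v.link.half .left) (a₃.link.half .left) γ₃ γ₁ η) :
      Relator (qBridge R e₁ ≫ qBridge R e₁' + qBridge R e₂ ≫ qBridge R e₂'
        + qBridge R e₃ ≫ qBridge R e₃')
  /-- A left bridge followed by a bridge which intersects its co-core. -/
  | bridge_crossing {v a w : DecLink n} {γ η : Finset (Finset (Fin (2 * n)))}
      (e₁ : IsBridgeEdge .left γ v a) (e₂ : IsBridgeEdge .left η a w)
      (cross : Crosses (v.dagger .left a) η) :
      Relator (qBridge R e₁ ≫ qBridge R e₂)
  /-- Surgery on a right bridge and back again. -/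
  | there_and_back {v a w : DecLink n} {γ : Finset (Finset (Fin (2 * n)))} {C : Set (Fin (2 * n))}
      (e₁ : IsBridgeEdge .right γ v a) (e₂ : IsBridgeEdge .right (v.dagger .right a) a w)
      (h : IsDecorationEdge C v w) :
      Relator (qBridge R e₁ ≫ qBridge R e₂ - qDec R .right h)

variable (n)

/-- The two-sided ideal of `𝒬Γ_n` generated by the relations. -/
def relIdeal (X Y : QuiverCat R n) : Submodule R (X ⟶ Y) :=
  Submodule.span R {f | ∃ (v w : DecLink n) (r : qObj R v ⟶ qObj R w)
    (p : X ⟶ qObj R v) (q : qObj R w ⟶ Y), Relator R r ∧ f = p ≫ r ≫ q}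

/-- Equality of morphisms of `𝒬Γ_n` modulo the relations. -/
def relHom : HomRel (QuiverCat R n) :=
  fun X Y f g => f - g ∈ relIdeal R n X Y

variable {R n}

theorem comp_mem_relIdeal {X Y Z : QuiverCat R n} (p : X ⟶ Y) {f : Y ⟶ Z}
    (hf : f ∈ relIdeal R n Y Z) : p ≫ f ∈ relIdeal R n X Z := by
  induction hf using Submodule.span_induction with
  | mem f hf =>
    obtain ⟨v, w, r, p', q, hr, rfl⟩ := hf
    exact Submodule.subset_span ⟨v, w, r, p ≫ p', q, hr, by simp only [Category.assoc]⟩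
  | zero => rw [Limits.comp_zero]; exact Submodule.zero_mem _
  | add f g _ _ hf hg => rw [Preadditive.comp_add]; exact Submodule.add_mem _ hf hg
  | smul a f _ hf => rw [Linear.comp_smul]; exact Submodule.smul_mem _ _ hf

theorem mem_relIdeal_comp {X Y Z : QuiverCat R n} {f : X ⟶ Y} (q : Y ⟶ Z)
    (hf : f ∈ relIdeal R n X Y) : f ≫ q ∈ relIdeal R n X Z := by
  induction hf using Submodule.span_induction with
  | mem f hf =>
    obtain ⟨v, w, r, p, q', hr, rfl⟩ := hf
    exact Submodule.subset_span ⟨v, w, r, p, q' ≫ q, hr, by simp only [Category.assoc]⟩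
  | zero => rw [Limits.zero_comp]; exact Submodule.zero_mem _
  | add f g _ _ hf hg => rw [Preadditive.add_comp]; exact Submodule.add_mem _ hf hg
  | smul a f _ hf => rw [Linear.smul_comp]; exact Submodule.smul_mem _ _ hf

variable (R n)

instance : Congruence (relHom R n) where
  equivalence :=
    { refl := fun f => by
        change f - f ∈ _
        rw [sub_self]; exact Submodule.zero_mem _
      symm := fun {f g} h => by
        change g - f ∈ _
        rw [← neg_sub]; exact Submodule.neg_mem _ h
      trans := fun {f g k} h h' => by
        change f - k ∈ _
        rw [← sub_add_sub_cancel f g k]; exact Submodule.add_mem _ h h' }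
  comp_left p _ _ h := by
    change p ≫ _ - p ≫ _ ∈ _
    rw [← Preadditive.comp_sub]; exact comp_mem_relIdeal p h
  comp_right q h := by
    change _ ≫ q - _ ≫ q ∈ _
    rw [← Preadditive.sub_comp]; exact mem_relIdeal_comp q h

/-- The cleaver category `ℬΓ_n` over `R`: the quotient of `𝒬Γ_n` by the relations. -/
abbrev CleaverCat := CategoryTheory.Quotient (relHom R n)

theorem relHom_add ⦃X Y : QuiverCat R n⦄ (f₁ f₂ g₁ g₂ : X ⟶ Y)
    (hf : relHom R n f₁ f₂) (hg : relHom R n g₁ g₂) : relHom R n (f₁ + g₁) (f₂ + g₂) := by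
  change _ - _ ∈ _
  rw [add_sub_add_comm]; exact Submodule.add_mem _ hf hg

theorem relHom_smul (a : R) ⦃X Y : QuiverCat R n⦄ (f₁ f₂ : X ⟶ Y)
    (hf : relHom R n f₁ f₂) : relHom R n (a • f₁) (a • f₂) := by
  change _ - _ ∈ _
  rw [← smul_sub]; exact Submodule.smul_mem _ _ hf

instance : Preadditive (CleaverCat R n) :=
  Quotient.preadditive (relHom R n) (relHom_add R n)

instance : (Quotient.functor (relHom R n)).Additive :=
  Quotient.functor_additive (relHom R n) (relHom_add R n)

instance : Linear R (CleaverCat R n) :=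
  Quotient.linear R (relHom R n) (relHom_smul R n)

instance : (Quotient.functor (relHom R n)).Linear R :=
  Quotient.linear_functor R (relHom R n) (relHom_smul R n)

variable {n}

/-- A vertex of `Γ_n` as an object of `ℬΓ_n`. -/
abbrev bObj (v : DecLink n) : CleaverCat R n :=
  (Quotient.functor (relHom R n)).obj (qObj R v)

/-- The class in `ℬΓ_n` of a path in `Γ_n`. -/
abbrev bPath {v w : DecLink n} (p : Quiver.Path v w) : bObj R v ⟶ bObj R w :=
  (Quotient.functor (relHom R n)).map (qPath R p)

/-- The class in `ℬΓ_n` of an edge of `Γ_n`. -/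
abbrev bEdge {v w : DecLink n} (e : Edge v w) : bObj R v ⟶ bObj R w :=
  (Quotient.functor (relHom R n)).map (qEdge R e)

/-- The bigrading of a path in `Γ_n`: the sum of the bigradings of its edges. -/
def pathBidegree {v w : DecLink n} (p : Quiver.Path v w) : ℤ × ℚ :=
  Quiver.Path.addWeight (V := DecLink n) (fun {_ _} e => Edge.bidegree e) p

/-- The morphisms `v ⟶ w` of `ℬΓ_n` that are homogeneous of bigrading `g`. -/
def homogeneous (v w : DecLink n) (g : ℤ × ℚ) : Submodule R (bObj R v ⟶ bObj R w) :=
  Submodule.span R {f | ∃ p : Quiver.Path v w, pathBidegree p = g ∧ f = bPath R p}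

/-- A right differential on `ℬΓ_n`, of bigrading `(1, 0)`, with the signs in the Leibniz rule given by
the first component of the bigrading. -/
structure IsRightDifferential (d : ∀ v w : DecLink n, (bObj R v ⟶ bObj R w) →ₗ[R]
    (bObj R v ⟶ bObj R w)) : Prop where
  map_id : ∀ v, d v v (𝟙 (bObj R v)) = 0
  leibniz : ∀ (u v w : DecLink n) (α : bObj R u ⟶ bObj R v) (β : bObj R v ⟶ bObj R w) (g : ℤ × ℚ),
    β ∈ homogeneous R v w g →
      d u w (α ≫ β) = g.1.negOnePow • (d u v α ≫ β) + α ≫ d v w β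
  bidegree : ∀ (v w : DecLink n) (g : ℤ × ℚ) (α : bObj R v ⟶ bObj R w),
    α ∈ homogeneous R v w g → d v w α ∈ homogeneous R v w (g + (1, 0))
  sq_zero : ∀ (v w : DecLink n) (α : bObj R v ⟶ bObj R w), d v w (d v w α) = 0

end Categories

section RoundTrips

variable {n : ℕ}

/-! ### The paths in the definition of the differential -/

/-- Directed paths `v ⟶ v_γ ⟶ w` of length two, given by a left bridge `γ` followed by `γ†`. -/
structure LeftRoundTrip (v w : DecLink n) where
  mid : DecLink n
  γ : Finset (Finset (Fin (2 * n)))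
  there : IsBridgeEdge .left γ v mid
  back : IsBridgeEdge .left (v.dagger .left mid) mid w

instance : Finite (PlanarMatching n) :=
  Finite.of_injective PlanarMatching.arcs fun _ _ h => PlanarMatching.ext h

instance : Finite Side :=
  Finite.of_injective (fun s : Side => decide (s = .left)) fun s t h => by
    cases s <;> cases t <;> simp_all

instance : Finite Sign :=
  Finite.of_injective (fun s : Sign => decide (s = .plus)) fun s t h => by
    cases s <;> cases t <;> simp_all

instance : Finite (CleavedLink n) :=
  Finite.of_injective CleavedLink.half fun _ _ h => CleavedLink.ext h

instance : Finite (DecLink n) :=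
  Finite.of_injective (β := Σ L : CleavedLink n, (L.circles → Sign))
    (fun v => ⟨v.link, v.dec⟩) fun v w h => by
      cases v; cases w; simpa using h

/-- The sum in the definition of the differential is finite. -/
instance (v w : DecLink n) : Finite (LeftRoundTrip v w) :=
  Finite.of_injective (fun p => (p.mid, p.γ)) fun p q h => by
    cases p; cases q; simpa using h

end RoundTrips

end CleavedLinks

namespace CleavedLinks

/-! ### Marked points: separation by arcs and parity -/

section Planar

variable {n : ℕ}

/-! Collect the left bridge edges into a matrix B (`bridgeHom R .left`) indexed by pairs of
vertices, whose entry at (v, w) is the class of the left bridge edge from v to w, or zero if there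
is none, and put S = B·B (`leftSquares`). On a given side there is at most one bridge edge between
two vertices, so S(v, w) is the sum of all paths of two left bridges from v to w. The key fact is
`leftSquare_eq_zero`: S(v, w) = 0 unless v and w have the same link. For different links the paths
are grouped by the matching in the middle, of which there are one, two or three. The sum then
vanishes by the relation for crossing bridges, for squares or for triples respectively. If the links
agree, the second bridge is the co-core of the first, so the value prescribed on a left decoration
edge from v to w is exactly -S(v, w) (`finsum_leftRoundTrip`), and S is supported on pairs joined by
a decoration edge.

Compatibility with the relations thus becomes commutation of matrices. S commutes with B by
associativity, and with the right bridges because B does (`homMul_bridgeHom_comm`). It commutes with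
the right decorations at a fixed marked point for the same reason (`homMul_rightHom_bridgeHom`), and
with the left decorations because these anticommute with B (`homMul_leftDec_bridgeHom`). As S has
the support of a decoration matrix, an entry of such an identity consists of the terms of a single
defining relation with the left decoration edges replaced by entries of S, which is what the Leibniz
rule asks for. Relations without left decoration edges are killed term by term. So the Leibniz
extension to paths annihilates the ideal and descends. Its square is zero because S is a sum of
products of bridges, on which d vanishes. It is unique because edges generate.

The combinatorics rests on parity. An arc joins an even point to an odd one (`even_mate`), so an arc
is labelled by its even end, a bridge by two even points, and surgery conjugates the involution of
the matching by the transposition of these points. Two surgeries from M to M' become a factorization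
of a permutation into two transpositions. A product of disjoint transpositions allows two first
factors and a 3-cycle three, and planarity decides which of them occur (`exists_twoSurgeries`).
Likewise circles are the cycles of a permutation of the even points which surgery multiplies by a
transposition, so every surgery merges or divides (`saddle_of_surgery`). The sign rules are the
structure constants of the Frobenius algebra R[X]/(X²), with + for 1 and - for X. The form of its
axioms that is needed is a bijection between the decorations in the middle of the two sides of a
square (`nonempty_isMid_equiv`). -/

theorem isUnder_pair {i j k : Fin (2 * n)} :
    IsUnder {i, j} k ↔ (i < k ∧ k < j) ∨ (j < k ∧ k < i) := by
  simp only [IsUnder, Finset.mem_insert, Finset.mem_singleton]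
  constructor
  · rintro ⟨a, rfl | rfl, b, rfl | rfl, h1, h2⟩ <;> omega
  · rintro (h | h)
    · exact ⟨i, Or.inl rfl, j, Or.inr rfl, h⟩
    · exact ⟨j, Or.inr rfl, i, Or.inl rfl, h⟩

/-- Two arcs with four distinct ends separate each other or do not. -/
theorem separates_symm {i j k l : Fin (2 * n)} (hik : i ≠ k) (hil : i ≠ l) (hjk : j ≠ k)
    (hjl : j ≠ l) :
    (IsUnder {i, j} k ↔ IsUnder {i, j} l) ↔ (IsUnder {k, l} i ↔ IsUnder {k, l} j) := by
  simp only [isUnder_pair]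
  grind

/-- The triangle rule: modulo two, being under `{i, k}` is the sum of being under `{i, j}` and being
under `{j, k}`. -/
theorem isUnder_trans {i j k x : Fin (2 * n)} (hi : x ≠ i) (hj : x ≠ j) (hk : x ≠ k) :
    (IsUnder {i, k} x ↔ (IsUnder {i, j} x ↔ ¬ IsUnder {j, k} x)) := by
  simp only [isUnder_pair]
  grind

/-- Of the three pairings of four points, an odd number is crossing. -/
theorem crossing_of_not_crossing {x y z w : Fin (2 * n)} (hxy : x ≠ y) (hxw : x ≠ w)
    (hyz : y ≠ z) (hyw : y ≠ w) (hzw : z ≠ w)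
    (h₁ : IsUnder {x, y} z ↔ IsUnder {x, y} w) (h₂ : ¬ (IsUnder {x, w} z ↔ IsUnder {x, w} y)) :
    IsUnder {x, z} w ↔ IsUnder {x, z} y := by
  simp only [isUnder_pair] at *
  grind

namespace PlanarMatching

variable (M : PlanarMatching n)

theorem exists_mate (x : Fin (2 * n)) :
    ∃ y, x ≠ y ∧ ({x, y} : Finset (Fin (2 * n))) ∈ M.arcs := by
  obtain ⟨c, ⟨hc, hx⟩, -⟩ := M.cover x
  obtain ⟨a, b, hab, rfl⟩ := Finset.card_eq_two.1 (M.card_arc c hc)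
  rcases Finset.mem_insert.1 hx with rfl | hx
  · exact ⟨b, hab, hc⟩
  · rw [Finset.mem_singleton] at hx
    subst hx
    exact ⟨a, hab.symm, by rwa [Finset.pair_comm]⟩

/-- The other end of the arc at a marked point. -/
noncomputable def mate (x : Fin (2 * n)) : Fin (2 * n) := (M.exists_mate x).choose

theorem ne_mate (x : Fin (2 * n)) : x ≠ M.mate x := (M.exists_mate x).choose_spec.1

theorem mate_ne (x : Fin (2 * n)) : M.mate x ≠ x := (M.ne_mate x).symm

theorem mate_mem (x : Fin (2 * n)) : {x, M.mate x} ∈ M.arcs := (M.exists_mate x).choose_spec.2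

variable {M}

theorem eq_arc {c : Finset (Fin (2 * n))} (hc : c ∈ M.arcs) {x : Fin (2 * n)} (hx : x ∈ c) :
    c = {x, M.mate x} :=
  (M.cover x).unique ⟨hc, hx⟩ ⟨M.mate_mem x, by simp⟩

theorem eq_mate {x y : Fin (2 * n)} (h : {x, y} ∈ M.arcs) : y = M.mate x := by
  have h1 := eq_arc h (Finset.mem_insert_self x _)
  have h2 : y ∈ ({x, M.mate x} : Finset (Fin (2 * n))) := by rw [← h1]; simp
  have h3 := M.card_arc _ h
  rcases Finset.mem_insert.1 h2 with rfl | h2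
  · simp at h3
  · simpa using h2

variable (M)

@[simp] theorem mate_mate (x : Fin (2 * n)) : M.mate (M.mate x) = x := by
  refine (eq_mate ?_).symm
  rw [Finset.pair_comm]; exact M.mate_mem x

theorem mate_injective : Function.Injective M.mate :=
  Function.LeftInverse.injective (g := M.mate) M.mate_mate

variable {M}

theorem mem_arcs {c : Finset (Fin (2 * n))} : c ∈ M.arcs ↔ ∃ x, c = {x, M.mate x} := by
  constructor
  · intro hc
    have h := M.card_arc c hc
    obtain ⟨x, hx⟩ : c.Nonempty := by
      rw [← Finset.card_pos]; omega
    exact ⟨x, eq_arc hc hx⟩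
  · rintro ⟨x, rfl⟩; exact M.mate_mem x

theorem pair_mem_arcs {x y : Fin (2 * n)} : {x, y} ∈ M.arcs ↔ M.mate x = y :=
  ⟨fun h => (eq_mate h).symm, fun h => h ▸ M.mate_mem x⟩

theorem ext_mate {M' : PlanarMatching n} (h : ∀ x, M.mate x = M'.mate x) : M = M' := by
  ext c
  simp only [mem_arcs, h]

/-- This is the noncrossing condition freed from the order of the four ends. -/
theorem not_separates {x y : Fin (2 * n)} (h1 : y ≠ x) (h2 : y ≠ M.mate x) :
    IsUnder {x, M.mate x} y ↔ IsUnder {x, M.mate x} (M.mate y) := by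
  have hx := M.mate_mem x
  have hy := M.mate_mem y
  have hx' : {M.mate x, x} ∈ M.arcs := by rw [Finset.pair_comm]; exact hx
  have hy' : {M.mate y, y} ∈ M.arcs := by rw [Finset.pair_comm]; exact hy
  have h3 : M.mate y ≠ x := fun h => h2 (by rw [← h, mate_mate])
  have h4 : M.mate y ≠ M.mate x := fun h => h1 (M.mate_injective h)
  -- The field `noncrossing` wants increasing points; these are all eight orders in which the ends
  -- of the two arcs alternate.
  have a1 := M.noncrossing x y (M.mate x) (M.mate y)
  have a2 := M.noncrossing y x (M.mate y) (M.mate x)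
  have a3 := M.noncrossing x (M.mate y) (M.mate x) y
  have a4 := M.noncrossing (M.mate y) x y (M.mate x)
  have a5 := M.noncrossing (M.mate x) y x (M.mate y)
  have a6 := M.noncrossing y (M.mate x) (M.mate y) x
  have a7 := M.noncrossing (M.mate x) (M.mate y) x y
  have a8 := M.noncrossing (M.mate y) (M.mate x) y x
  simp only [hx, hy, hx', hy', and_self, not_true_eq_false] at a1 a2 a3 a4 a5 a6 a7 a8
  rw [isUnder_pair, isUnder_pair]
  grind

/-- The arcs of a planar matching join points of opposite parity. -/
theorem even_mate (x : Fin (2 * n)) : Even (M.mate x).val ↔ ¬ Even x.val := by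
  wlog hlt : x < M.mate x generalizing x
  · have := this (M.mate x) (by
      rw [mate_mate]; exact lt_of_le_of_ne (not_lt.1 hlt) (M.mate_ne x))
    rw [mate_mate] at this
    tauto
  -- No arc leaves the interval between the ends of the arc at x, so the involution pairs off the
  -- points inside it and their number is even.
  have h : ((Finset.Ioo x (M.mate x)).card : ZMod 2) = 0 := by
    rw [Finset.cast_card]
    refine Finset.sum_involution (fun y _ => M.mate y) (fun _ _ => by decide)
      (fun y _ _ => M.mate_ne y) (fun y hy => ?_) (fun y _ => M.mate_mate y)
    rw [Finset.mem_Ioo] at hy ⊢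
    have h := not_separates (M := M) (x := x) (y := y) hy.1.ne' hy.2.ne
    rw [isUnder_pair, isUnder_pair] at h
    have := h.1 (Or.inl hy)
    rcases this with h | h
    · exact h
    · exact absurd (h.1.trans h.2) hlt.not_gt
  rw [Fin.card_Ioo, ZMod.natCast_eq_zero_iff_even] at h
  have hlt' : x.val < (M.mate x).val := hlt
  have := (Nat.even_sub (show 1 ≤ (M.mate x).val - x.val by omega)).1 h
  have h2 := (Nat.even_sub hlt'.le)
  simp only [Nat.not_even_one, iff_false] at this
  tauto

end PlanarMatching
end Planar

/-! ### Surgery on matchings as conjugation by a transposition -/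

section PlanarSurgery

variable {n : ℕ}

namespace PlanarMatching

/-- A planar matching from the involution which exchanges the ends of its arcs. -/
def ofMate (f : Fin (2 * n) → Fin (2 * n)) (hf : ∀ x, f (f x) = x) (hne : ∀ x, x ≠ f x)
    (h : ∀ x y, y ≠ x → y ≠ f x → (IsUnder {x, f x} y ↔ IsUnder {x, f x} (f y))) :
    PlanarMatching n where
  arcs := Finset.univ.image fun x => {x, f x}
  card_arc c hc := by
    obtain ⟨x, -, rfl⟩ := Finset.mem_image.1 hc
    exact Finset.card_pair (hne x)
  cover x := by
    refine ⟨{x, f x}, ⟨Finset.mem_image_of_mem _ (Finset.mem_univ x), by simp⟩, ?_⟩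
    rintro c ⟨hc, hx⟩
    obtain ⟨y, -, rfl⟩ := Finset.mem_image.1 hc
    rcases Finset.mem_insert.1 hx with rfl | hx
    · rfl
    · rw [Finset.mem_singleton] at hx
      rw [hx, hf, Finset.pair_comm]
  noncrossing := by
    have key : ∀ i k : Fin (2 * n), {i, k} ∈ Finset.univ.image (fun x => ({x, f x} : Finset _)) →
        i ≠ k → f i = k := by
      intro i k hc hik
      obtain ⟨y, -, hy⟩ := Finset.mem_image.1 hc
      have h1 : i ∈ ({y, f y} : Finset _) := by rw [hy]; simp
      have h2 : k ∈ ({y, f y} : Finset _) := by rw [hy]; simp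
      simp only [Finset.mem_insert, Finset.mem_singleton] at h1 h2
      rcases h1 with rfl | rfl <;> rcases h2 with rfl | rfl
      · exact absurd rfl hik
      · rfl
      · exact hf _
      · exact absurd rfl hik
    rintro i j k l hij hjk hkl ⟨h1, h2⟩
    have h1 := key i k h1 (hij.trans hjk).ne
    have h2 := key j l h2 (hjk.trans hkl).ne
    have h3 := h i j hij.ne' (by rw [h1]; exact hjk.ne)
    rw [h1, h2, isUnder_pair, isUnder_pair] at h3
    grind

@[simp] theorem mate_ofMate (f : Fin (2 * n) → Fin (2 * n)) (hf : ∀ x, f (f x) = x)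
    (hne : ∀ x, x ≠ f x)
    (h : ∀ x y, y ≠ x → y ≠ f x → (IsUnder {x, f x} y ↔ IsUnder {x, f x} (f y)))
    (x : Fin (2 * n)) : (ofMate f hf hne h).mate x = f x :=
  pair_mem_arcs.1 (Finset.mem_image_of_mem _ (Finset.mem_univ x))

variable (M : PlanarMatching n)

/-- No arc but possibly those at `x` and `z` separates `x` from `z`. -/
def Near (x z : Fin (2 * n)) : Prop :=
  ∀ y, y ≠ x → y ≠ M.mate x → y ≠ z → y ≠ M.mate z →
    (IsUnder {y, M.mate y} x ↔ IsUnder {y, M.mate y} z)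

/-- The arcs at `x` and `z` are exchanged for arcs from `x` to the other end of the arc at `z`, and
from `z` to the other end of the arc at `x`. -/
structure IsExchange (M M' : PlanarMatching n) (x z : Fin (2 * n)) : Prop where
  ne : x ≠ z
  ne_mate : z ≠ M.mate x
  mate : ∀ p, M'.mate p = Equiv.swap x z (M.mate (Equiv.swap x z p))

variable {M}

/-- Three kinds of pairs of arcs could cross after the exchange. Two old arcs do not, as in `M`. A
new arc and an old one do not, since by `Near` an old arc has all four points of the exchange on one
side. The two new arcs do not by `hc`. -/
theorem exists_isExchange {x z : Fin (2 * n)} (hxz : x ≠ z) (hzx : z ≠ M.mate x)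
    (hn : M.Near x z)
    (hc : IsUnder {x, M.mate z} z ↔ IsUnder {x, M.mate z} (M.mate x)) :
    ∃ M', IsExchange M M' x z := by
  set f : Fin (2 * n) → Fin (2 * n) := fun p => Equiv.swap x z (M.mate (Equiv.swap x z p)) with hf
  have hxz' : x ≠ M.mate z := fun h => hzx (by rw [h, mate_mate])
  have hmm : M.mate x ≠ M.mate z := fun h => hxz (M.mate_injective h)
  have hx := M.ne_mate x
  have hz := M.ne_mate z
  have f1 : f x = M.mate z := by
    simp only [hf, Equiv.swap_apply_left]
    exact Equiv.swap_apply_of_ne_of_ne hxz'.symm hz.symm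
  have f2 : f z = M.mate x := by
    simp only [hf, Equiv.swap_apply_right]
    exact Equiv.swap_apply_of_ne_of_ne hx.symm hzx.symm
  have f0 : ∀ p, f (f p) = p := by intro p; simp [hf]
  have f3 : f (M.mate x) = z := by rw [← f2, f0]
  have f4 : f (M.mate z) = x := by rw [← f1, f0]
  have f5 : ∀ y, y ≠ x → y ≠ z → y ≠ M.mate x → y ≠ M.mate z → f y = M.mate y := by
    intro y h1 h2 h3 h4
    simp only [hf, Equiv.swap_apply_of_ne_of_ne h1 h2]
    exact Equiv.swap_apply_of_ne_of_ne (fun h => h3 (by rw [← h, mate_mate]))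
      (fun h => h4 (by rw [← h, mate_mate]))
  have f6 : ∀ p, p ≠ f p := by
    intro p
    simp only [hf]
    intro h
    have h2 := congrArg (Equiv.swap x z) h
    rw [Equiv.swap_apply_self] at h2
    exact M.ne_mate _ h2
  -- the arcs away from the exchange do not separate its four points
  have g1 : ∀ y, y ≠ x → y ≠ z → y ≠ M.mate x → y ≠ M.mate z →
      (IsUnder {y, M.mate y} x ↔ IsUnder {y, M.mate y} z) ∧
      (IsUnder {y, M.mate y} x ↔ IsUnder {y, M.mate y} (M.mate x)) ∧
      (IsUnder {y, M.mate y} z ↔ IsUnder {y, M.mate y} (M.mate z)) := by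
    intro y h1 h2 h3 h4
    refine ⟨hn y h1 h3 h2 h4, not_separates h1.symm fun h => h3 ?_,
      not_separates h2.symm fun h => h4 ?_⟩
    · rw [h, mate_mate]
    · rw [h, mate_mate]
  have m1 : ∀ y, y ≠ x → y ≠ z → y ≠ M.mate x → y ≠ M.mate z →
      M.mate y ≠ x ∧ M.mate y ≠ z ∧ M.mate y ≠ M.mate x ∧ M.mate y ≠ M.mate z := by
    intro y h1 h2 h3 h4
    exact ⟨fun h => h3 (by rw [← h, mate_mate]), fun h => h4 (by rw [← h, mate_mate]),
      fun h => h1 (M.mate_injective h), fun h => h2 (M.mate_injective h)⟩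
  refine ⟨ofMate f f0 f6 ?_, hxz, hzx, fun p => mate_ofMate f _ _ _ p⟩
  have hc2 : IsUnder {z, M.mate x} x ↔ IsUnder {z, M.mate x} (M.mate z) :=
    (separates_symm hxz hx hz.symm hmm.symm).1 hc
  have key : ∀ y, y ≠ x → y ≠ z → y ≠ M.mate x → y ≠ M.mate z →
      (IsUnder {x, M.mate z} y ↔ IsUnder {x, M.mate z} (M.mate y)) ∧
      (IsUnder {z, M.mate x} y ↔ IsUnder {z, M.mate x} (M.mate y)) := by
    intro y h1 h2 h3 h4
    obtain ⟨a1, a2, a3⟩ := g1 y h1 h2 h3 h4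
    obtain ⟨b1, b2, b3, b4⟩ := m1 y h1 h2 h3 h4
    exact ⟨(separates_symm h1.symm b1.symm h4.symm b4.symm).2 (a1.trans a3),
      (separates_symm h2.symm b2.symm h3.symm b3.symm).2 (a1.symm.trans a2)⟩
  intro p q hqp hqfp
  by_cases p1 : p = x
  · subst p1
    rw [f1] at hqfp ⊢
    by_cases q2 : q = z
    · subst q2; rw [f2]; exact hc
    by_cases q3 : q = M.mate p
    · subst q3; rw [f3]; exact hc.symm
    rw [f5 q hqp q2 q3 hqfp]; exact (key q hqp q2 q3 hqfp).1
  by_cases p2 : p = z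
  · subst p2
    rw [f2] at hqfp ⊢
    by_cases q1 : q = x
    · subst q1; rw [f1]; exact hc2
    by_cases q3 : q = M.mate p
    · subst q3; rw [f4]; exact hc2.symm
    rw [f5 q q1 hqp hqfp q3]; exact (key q q1 hqp hqfp q3).2
  by_cases p3 : p = M.mate x
  · subst p3
    rw [f3] at hqfp ⊢
    rw [Finset.pair_comm]
    by_cases q1 : q = x
    · subst q1; rw [f1]; exact hc2
    by_cases q3 : q = M.mate z
    · subst q3; rw [f4]; exact hc2.symm
    rw [f5 q q1 hqfp hqp q3]; exact (key q q1 hqfp hqp q3).2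
  by_cases p4 : p = M.mate z
  · subst p4
    rw [f4] at hqfp ⊢
    rw [Finset.pair_comm]
    by_cases q1 : q = z
    · subst q1; rw [f2]; exact hc
    by_cases q3 : q = M.mate x
    · subst q3; rw [f3]; exact hc.symm
    rw [f5 q hqfp q1 q3 hqp]; exact (key q hqfp q1 q3 hqp).1
  rw [f5 p p1 p2 p3 p4] at hqfp ⊢
  obtain ⟨a1, a2, a3⟩ := g1 p p1 p2 p3 p4
  by_cases q1 : q = x
  · subst q1; rw [f1]; exact a1.trans a3
  by_cases q2 : q = z
  · subst q2; rw [f2]; exact a1.symm.trans a2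
  by_cases q3 : q = M.mate x
  · subst q3; rw [f3]; exact a2.symm.trans a1
  by_cases q4 : q = M.mate z
  · subst q4; rw [f4]; exact (a1.trans a3).symm
  rw [f5 q q1 q2 q3 q4]
  exact not_separates hqp hqfp

/-- `M'` is obtained from `M` by surgery on the bridge between the arcs at the even points `x`
and `z`. -/
structure Surgery (M M' : PlanarMatching n) (x z : Fin (2 * n)) : Prop where
  even_left : Even x.val
  even_right : Even z.val
  ne : x ≠ z
  mate : ∀ p, M'.mate p = Equiv.swap x z (M.mate (Equiv.swap x z p))

theorem ne_mate_of_even {x z : Fin (2 * n)} (hx : Even x.val) (hz : Even z.val) :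
    z ≠ M.mate x := fun h => by
  have := M.even_mate x
  rw [← h] at this
  tauto

/-- Of the two ways to reconnect the four ends, at least one is noncrossing. If it were the one that
joins x to z, there would be an arc between two even points. Hence the parity-preserving exchange is
always the planar one. -/
theorem exists_surgery {x z : Fin (2 * n)} (hx : Even x.val) (hz : Even z.val) (hxz : x ≠ z)
    (hn : M.Near x z) : ∃ M', Surgery M M' x z := by
  have hzx := ne_mate_of_even (M := M) hx hz
  have hxz' := ne_mate_of_even (M := M) hz hx
  have hmm : M.mate x ≠ M.mate z := fun h => hxz (M.mate_injective h)
  by_cases hc : IsUnder {x, M.mate z} z ↔ IsUnder {x, M.mate z} (M.mate x)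
  · obtain ⟨M', -, -, h⟩ := exists_isExchange hxz hzx hn hc
    exact ⟨M', hx, hz, hxz, h⟩
  -- The other exchange, at x and the mate of z, would then give a planar matching in which x and z
  -- are mates.
  · exfalso
    have h0 := not_separates (M := M) hxz.symm hzx
    have h1 := crossing_of_not_crossing (M.ne_mate x) hxz' hzx.symm hmm
      (M.ne_mate z) h0 hc
    obtain ⟨M', -, -, h⟩ := exists_isExchange (M := M) (x := x) (z := M.mate z) hxz' hmm.symm
      (fun y h1 h2 h3 h4 => by
        rw [mate_mate] at h4
        rw [hn y h1 h2 h4 h3]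
        exact not_separates h4.symm fun h => h3 (by rw [h, mate_mate]))
      (by rw [mate_mate]; exact h1)
    have h2 := h x
    rw [Equiv.swap_apply_left, mate_mate, Equiv.swap_apply_of_ne_of_ne hxz.symm
      (M.ne_mate z)] at h2
    exact ne_mate_of_even (M := M') hx hz h2.symm

namespace Surgery

variable {M' : PlanarMatching n} {x z : Fin (2 * n)} (h : Surgery M M' x z)

include h

theorem symm : Surgery M' M x z where
  even_left := h.even_left
  even_right := h.even_right
  ne := h.ne
  mate p := by rw [h.mate]; simp

theorem comm : Surgery M M' z x where
  even_left := h.even_right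
  even_right := h.even_left
  ne := h.ne.symm
  mate p := by rw [h.mate, Equiv.swap_comm]

theorem ne_mate_right : x ≠ M.mate z := ne_mate_of_even h.even_right h.even_left

theorem mate_left : M'.mate x = M.mate z := by
  rw [h.mate, Equiv.swap_apply_left,
    Equiv.swap_apply_of_ne_of_ne h.ne_mate_right.symm (M.mate_ne z)]

theorem mate_right : M'.mate z = M.mate x := h.comm.mate_left

theorem mate_mate_left : M'.mate (M.mate x) = z := by rw [← h.mate_right, PlanarMatching.mate_mate]

theorem mate_mate_right : M'.mate (M.mate z) = x := h.comm.mate_mate_left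

theorem mate_of_ne {p : Fin (2 * n)} (h1 : p ≠ x) (h2 : p ≠ M.mate x) (h3 : p ≠ z)
    (h4 : p ≠ M.mate z) : M'.mate p = M.mate p := by
  rw [h.mate, Equiv.swap_apply_of_ne_of_ne h1 h3]
  exact Equiv.swap_apply_of_ne_of_ne (fun h => h2 (by rw [← h, PlanarMatching.mate_mate]))
      (fun h => h4 (by rw [← h, PlanarMatching.mate_mate]))

/-- Converse to `exists_surgery`: an arc kept by the surgery cannot separate x from its new mate,
which is the old mate of z, and so does not separate x from z. -/
theorem near : M.Near x z := fun y h1 h2 h3 h4 => by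
  have e := h.mate_of_ne h1 h2 h3 h4
  have a := not_separates (M := M') (x := y) (y := x) h1.symm
    (by rw [e]; exact fun h => h2 (by rw [h, PlanarMatching.mate_mate]))
  rw [e, h.mate_left] at a
  rw [a]
  exact (not_separates h3.symm fun h => h4 (by rw [h, PlanarMatching.mate_mate])).symm

theorem eq_of_surgery {N : PlanarMatching n} (h' : Surgery M N x z) : M' = N :=
  ext_mate fun p => by rw [h.mate, h'.mate]

end Surgery

end PlanarMatching

/-- The bridge between the arcs of `M` at `x` and `z`. -/
noncomputable def arcPair (M : PlanarMatching n) (x z : Fin (2 * n)) : Finset (Finset (Fin (2 * n))) :=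
  {{x, M.mate x}, {z, M.mate z}}

theorem arcPair_comm (M : PlanarMatching n) (x z : Fin (2 * n)) : arcPair M x z = arcPair M z x :=
  Finset.pair_comm _ _

open PlanarMatching

theorem mem_ends_arcPair {M : PlanarMatching n} {x z p : Fin (2 * n)} :
    p ∈ ends (arcPair M x z) ↔ p = x ∨ p = M.mate x ∨ p = z ∨ p = M.mate z := by
  simp [ends, arcPair, or_assoc]

/-- The even end serves as a canonical label of an arc; by `arc_eq_iff_of_even` it is unique, so
bridges can be handled as pairs of even points. -/
theorem PlanarMatching.exists_even {M : PlanarMatching n} {c : Finset (Fin (2 * n))} (hc : c ∈ M.arcs) :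
    ∃ x, Even x.val ∧ c = {x, M.mate x} := by
  obtain ⟨x, rfl⟩ := mem_arcs.1 hc
  by_cases hx : Even x.val
  · exact ⟨x, hx, rfl⟩
  · exact ⟨M.mate x, (M.even_mate x).2 hx, by rw [mate_mate, Finset.pair_comm]⟩

theorem PlanarMatching.arc_eq_iff {M : PlanarMatching n} {x y : Fin (2 * n)} :
    ({x, M.mate x} : Finset (Fin (2 * n))) = {y, M.mate y} ↔ x = y ∨ x = M.mate y := by
  constructor
  · intro h
    have : x ∈ ({y, M.mate y} : Finset (Fin (2 * n))) := by rw [← h]; simp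
    simpa using this
  · rintro (rfl | rfl)
    · rfl
    · rw [mate_mate, Finset.pair_comm]

theorem PlanarMatching.arc_eq_iff_of_even {M : PlanarMatching n} {x y : Fin (2 * n)}
    (hx : Even x.val) (hy : Even y.val) :
    ({x, M.mate x} : Finset (Fin (2 * n))) = {y, M.mate y} ↔ x = y := by
  rw [arc_eq_iff]
  exact ⟨fun h => h.resolve_right (ne_mate_of_even hy hx), Or.inl⟩

theorem mem_sdiff_arcPair {M : PlanarMatching n} {x z : Fin (2 * n)} {c : Finset (Fin (2 * n))} :
    c ∈ M.arcs \ arcPair M x z ↔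
      ∃ y, c = {y, M.mate y} ∧ y ≠ x ∧ y ≠ M.mate x ∧ y ≠ z ∧ y ≠ M.mate z := by
  rw [Finset.mem_sdiff, mem_arcs]
  constructor
  · rintro ⟨⟨y, rfl⟩, h⟩
    simp only [arcPair, Finset.mem_insert, Finset.mem_singleton, arc_eq_iff, not_or] at h
    exact ⟨y, rfl, h.1.1, h.1.2, h.2.1, h.2.2⟩
  · rintro ⟨y, rfl, h1, h2, h3, h4⟩
    refine ⟨⟨y, rfl⟩, ?_⟩
    simp only [arcPair, Finset.mem_insert, Finset.mem_singleton, arc_eq_iff, not_or]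
    exact ⟨⟨h1, h2⟩, h3, h4⟩

theorem PlanarMatching.Surgery.arcs_eq {M M' : PlanarMatching n} {x z : Fin (2 * n)}
    (h : Surgery M M' x z) : M'.arcs = (M.arcs \ arcPair M x z) ∪ arcPair M' x z := by
  ext c
  rw [Finset.mem_union, mem_sdiff_arcPair]
  constructor
  · intro hc
    by_cases hc' : c ∈ arcPair M' x z
    · exact Or.inr hc'
    · obtain ⟨y, rfl, h1, h2, h3, h4⟩ := mem_sdiff_arcPair.1 (Finset.mem_sdiff.2 ⟨hc, hc'⟩)
      rw [h.mate_left] at h2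
      rw [h.mate_right] at h4
      exact Or.inl ⟨y, by rw [h.mate_of_ne h1 h4 h3 h2], h1, h4, h3, h2⟩
  · rintro (⟨y, rfl, h1, h2, h3, h4⟩ | hc)
    · rw [← h.mate_of_ne h1 h2 h3 h4]; exact M'.mate_mem y
    · simp only [arcPair, Finset.mem_insert, Finset.mem_singleton] at hc
      rcases hc with rfl | rfl <;> exact M'.mate_mem _

theorem PlanarMatching.Surgery.disjoint {M M' : PlanarMatching n} {x z : Fin (2 * n)}
    (h : Surgery M M' x z) : Disjoint (arcPair M' x z) M.arcs := by
  rw [Finset.disjoint_left]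
  intro c hc hc'
  simp only [arcPair, Finset.mem_insert, Finset.mem_singleton] at hc
  rcases hc with rfl | rfl
  · rw [pair_mem_arcs, h.mate_left] at hc'
    exact h.ne (M.mate_injective hc')
  · rw [pair_mem_arcs, h.mate_right] at hc'
    exact h.ne (M.mate_injective hc').symm

theorem PlanarMatching.Surgery.dagger_eq {M M' : PlanarMatching n} {x z : Fin (2 * n)}
    (h : Surgery M M' x z) : dagger M M' = arcPair M' x z := by
  rw [dagger, h.arcs_eq, Finset.union_sdiff_distrib, Finset.sdiff_eq_empty_iff_subset.2
    Finset.sdiff_subset, Finset.empty_union, Finset.sdiff_eq_self_iff_disjoint]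
  exact h.disjoint

theorem PlanarMatching.Surgery.ends_eq {M M' : PlanarMatching n} {x z : Fin (2 * n)}
    (h : Surgery M M' x z) : ends (arcPair M' x z) = ends (arcPair M x z) := by
  ext p
  rw [mem_ends_arcPair, mem_ends_arcPair, h.mate_left, h.mate_right]
  tauto

theorem PlanarMatching.Surgery.isSurgery {M M' : PlanarMatching n} {x z : Fin (2 * n)}
    (h : Surgery M M' x z) : IsSurgery M (arcPair M x z) M' :=
  ⟨arcPair M' x z, h.disjoint, h.ends_eq, h.arcs_eq⟩

theorem PlanarMatching.Near.isBridge {M : PlanarMatching n} {x z : Fin (2 * n)}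
    (hx : Even x.val) (hz : Even z.val) (hxz : x ≠ z) (h : M.Near x z) :
    IsBridge M (arcPair M x z) := by
  refine ⟨_, M.mate_mem x, _, M.mate_mem z, fun e => hxz ((arc_eq_iff_of_even hx hz).1 e), rfl, ?_⟩
  intro c hc h1 h2 p hp q hq
  obtain ⟨y, rfl, h1, h2, h3, h4⟩ := mem_sdiff_arcPair.1
    (Finset.mem_sdiff.2 ⟨hc, show c ∉ arcPair M x z by simp [arcPair, h1, h2]⟩)
  have a := h y h1 h2 h3 h4
  have b := not_separates (M := M) (x := y) (y := x) h1.symm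
    (fun e => h2 (by rw [e, mate_mate]))
  have d := not_separates (M := M) (x := y) (y := z) h3.symm
    (fun e => h4 (by rw [e, mate_mate]))
  simp only [Finset.mem_insert, Finset.mem_singleton] at hp hq
  rcases hp with rfl | rfl <;> rcases hq with rfl | rfl <;> tauto

/-- `IsSurgery` only asks for new arcs with the same four ends. Parity leaves one possibility, so
the description by a transposition of even ends loses nothing. -/
theorem exists_surgery_of_isSurgery {M M' : PlanarMatching n} {γ : Finset (Finset (Fin (2 * n)))}
    (hb : IsBridge M γ) (hs : IsSurgery M γ M') :
    ∃ x z, Surgery M M' x z ∧ γ = arcPair M x z := by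
  obtain ⟨a, ha, b, hb, hab, rfl, -⟩ := hb
  obtain ⟨x, hx, rfl⟩ := exists_even ha
  obtain ⟨z, hz, rfl⟩ := exists_even hb
  have hxz : x ≠ z := by rintro rfl; exact hab rfl
  obtain ⟨δ, hd, he, harcs⟩ := hs
  change M'.arcs = (M.arcs \ arcPair M x z) ∪ δ at harcs
  change ends δ = ends (arcPair M x z) at he
  have h0 : ∀ y, y ≠ x → y ≠ M.mate x → y ≠ z → y ≠ M.mate z → M'.mate y = M.mate y := by
    intro y h1 h2 h3 h4
    rw [← pair_mem_arcs, harcs, Finset.mem_union, mem_sdiff_arcPair]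
    exact Or.inl ⟨y, rfl, h1, h2, h3, h4⟩
  have h1 : ∀ p ∈ ends (arcPair M x z), M'.mate p ∈ ends (arcPair M x z) ∧
      M'.mate p ≠ M.mate p := by
    intro p hp
    have h2 : {p, M'.mate p} ∈ δ := by
      have h3 := M'.mate_mem p
      rw [harcs, Finset.mem_union] at h3
      refine h3.resolve_left fun h3 => ?_
      obtain ⟨y, h4, h5, h6, h7, h8⟩ := mem_sdiff_arcPair.1 h3
      have h9 : p ∈ ({y, M.mate y} : Finset (Fin (2 * n))) := by rw [← h4]; simp
      rw [mem_ends_arcPair] at hp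
      have i1 := M.mate_mate x
      have i2 := M.mate_mate y
      have i3 := M.mate_mate z
      simp only [Finset.mem_insert, Finset.mem_singleton] at h9
      grind
    refine ⟨by rw [← he]; exact ⟨_, h2, by simp⟩, fun h => ?_⟩
    rw [h] at h2
    exact Finset.disjoint_left.1 hd h2 (M.mate_mem p)
  have hzx := ne_mate_of_even (M := M) hx hz
  have hxz' := ne_mate_of_even (M := M) hz hx
  -- Among the four ends, x itself is excluded, the old mate is excluded because the arc is new, and
  -- z is excluded by parity.
  have k1 : M'.mate x = M.mate z := by
    obtain ⟨a, b⟩ := h1 x (mem_ends_arcPair.2 (Or.inl rfl))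
    rw [mem_ends_arcPair] at a
    rcases a with a | a | a | a
    · exact absurd a (M'.mate_ne x)
    · exact absurd a b
    · exact absurd a.symm (ne_mate_of_even hx hz)
    · exact a
  have k2 : M'.mate z = M.mate x := by
    obtain ⟨a, b⟩ := h1 z (mem_ends_arcPair.2 (Or.inr (Or.inr (Or.inl rfl))))
    rw [mem_ends_arcPair] at a
    rcases a with a | a | a | a
    · exact absurd a.symm (ne_mate_of_even hz hx)
    · exact a
    · exact absurd a (M'.mate_ne z)
    · exact absurd a b
  refine ⟨x, z, ⟨hx, hz, hxz, fun p => ?_⟩, rfl⟩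
  by_cases p1 : p = x
  · subst p1
    rw [k1, Equiv.swap_apply_left, Equiv.swap_apply_of_ne_of_ne hxz'.symm (M.mate_ne z)]
  by_cases p2 : p = z
  · subst p2
    rw [k2, Equiv.swap_apply_right, Equiv.swap_apply_of_ne_of_ne (M.mate_ne x) hzx.symm]
  rw [Equiv.swap_apply_of_ne_of_ne p1 p2]
  by_cases p3 : p = M.mate x
  · rw [p3, mate_mate, Equiv.swap_apply_left, ← k2, mate_mate]
  by_cases p4 : p = M.mate z
  · rw [p4, mate_mate, Equiv.swap_apply_right, ← k1, mate_mate]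
  rw [h0 p p1 p3 p2 p4]
  exact (Equiv.swap_apply_of_ne_of_ne (fun h => p3 (by rw [← h, mate_mate]))
      (fun h => p4 (by rw [← h, mate_mate]))).symm

end PlanarSurgery

/-! ### Partitions and signs: one saddle -/

section Saddles

theorem mergeRule_iff {a b c : Sign} : MergeRule a b c ↔
    (a = .plus ∧ b = .plus ∧ c = .plus) ∨ (a = .minus ∧ b = .plus ∧ c = .minus) ∨
      (a = .plus ∧ b = .minus ∧ c = .minus) := by
  constructor
  · rintro (_ | _ | _) <;> simp
  · rintro (⟨rfl, rfl, rfl⟩ | ⟨rfl, rfl, rfl⟩ | ⟨rfl, rfl, rfl⟩) <;> constructor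

theorem fissionRule_iff {a b c : Sign} : FissionRule a b c ↔
    (a = .plus ∧ b = .plus ∧ c = .minus) ∨ (a = .plus ∧ b = .minus ∧ c = .plus) ∨
      (a = .minus ∧ b = .minus ∧ c = .minus) := by
  constructor
  · rintro (_ | _ | _) <;> simp
  · rintro (⟨rfl, rfl, rfl⟩ | ⟨rfl, rfl, rfl⟩ | ⟨rfl, rfl, rfl⟩) <;> constructor

theorem Sign.ne_plus {a : Sign} : a ≠ .plus ↔ a = .minus := by cases a <;> simp

/-- The opposite sign. -/
def Sign.neg : Sign → Sign
  | .plus => .minus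
  | .minus => .plus

@[simp] theorem Sign.neg_neg (a : Sign) : a.neg.neg = a := by cases a <;> rfl

@[simp] theorem Sign.neg_eq_plus {a : Sign} : a.neg = .plus ↔ a = .minus := by
  cases a <;> simp [Sign.neg]

@[simp] theorem Sign.neg_eq_minus {a : Sign} : a.neg = .minus ↔ a = .plus := by
  cases a <;> simp [Sign.neg]

theorem Sign.neg_injective : Function.Injective Sign.neg :=
  Function.LeftInverse.injective Sign.neg_neg

variable {α : Type*}

/-- The relation generated by `r` and the pair `x`, `z`. -/
def Joined (r : Setoid α) (x z p q : α) : Prop :=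
  r p q ∨ (r p x ∧ r z q) ∨ (r p z ∧ r x q)

/-- The partitions `r` and `r'` differ by a saddle with feet at `x` and `z`: either the classes of
`x` and `z` for `r` are merged, or the class of both is divided. -/
structure Saddle (r r' : Setoid α) (x z : α) : Prop where
  merge : ¬ r x z → ∀ p q, r' p q ↔ Joined r x z p q
  fission : r x z → ¬ r' x z ∧ ∀ p q, r p q ↔ Joined r' x z p q

/-- The change of the signs along a saddle. -/
structure Transition (r : Setoid α) (x z : α) (σ σ' : α → Sign) : Prop where
  off : ∀ p, ¬ r p x → ¬ r p z → σ' p = σ p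
  merge : ¬ r x z → MergeRule (σ x) (σ z) (σ' x)
  fission : r x z → FissionRule (σ x) (σ' x) (σ' z)

/-- The function is constant on classes. -/
def Inv (r : Setoid α) (σ : α → Sign) : Prop := ∀ p q, r p q → σ p = σ q

theorem Inv.neg {r : Setoid α} {σ : α → Sign} (h : Inv r σ) : Inv r fun p => (σ p).neg :=
  fun p q hpq => congrArg Sign.neg (h p q hpq)

variable {r r' r₁ r₂ : Setoid α} {x z : α} {σ σ' : α → Sign}

theorem joined_self (r : Setoid α) (x z : α) : Joined r x z x z :=
  Or.inr (Or.inl ⟨r.refl _, r.refl _⟩)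

theorem joined_comm {p q : α} : Joined r x z p q ↔ Joined r z x p q := by
  unfold Joined; tauto

theorem Saddle.rel_merge (h : Saddle r r' x z) (hr : ¬ r x z) : r' x z :=
  (h.merge hr x z).2 (joined_self r x z)

theorem Saddle.symm (h : Saddle r r' x z) : Saddle r' r x z where
  merge hr := (h.fission (by_contra fun h0 => hr (h.rel_merge h0))).2
  fission hr := by
    have h0 : ¬ r x z := fun h0 => (h.fission h0).1 hr
    exact ⟨h0, h.merge h0⟩

theorem Saddle.le (h : Saddle r r' x z) (hr : ¬ r x z) {p q : α} (hpq : r p q) : r' p q :=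
  (h.merge hr p q).2 (Or.inl hpq)

theorem Saddle.comm (h : Saddle r r' x z) : Saddle r r' z x where
  merge hr p q := by rw [h.merge (fun h0 => hr (r.symm h0)), joined_comm]
  fission hr := by
    obtain ⟨h1, h2⟩ := h.fission (r.symm hr)
    exact ⟨fun h0 => h1 (r'.symm h0), fun p q => by rw [h2, joined_comm]⟩

theorem Transition.comm (h : Transition r x z σ σ') (hs : Saddle r r' x z) (hσ : Inv r σ)
    (hσ' : Inv r' σ') : Transition r z x σ σ' where
  off p h1 h2 := h.off p h2 h1
  merge h1 := by
    have h2 : ¬ r x z := fun h0 => h1 (r.symm h0)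
    have h3 := h.merge h2
    have h4 := hσ' x z (hs.rel_merge h2)
    rw [mergeRule_iff] at h3 ⊢
    rw [← h4]; tauto
  fission h1 := by
    have h3 := h.fission (r.symm h1)
    have h4 := hσ x z (r.symm h1)
    rw [fissionRule_iff] at h3 ⊢
    rw [← h4]; tauto

/-- A pair which is joined by a merge can take the place of the feet of the merge. -/
theorem joined_congr {y t : α} (hr : ∀ p q, r' p q ↔ Joined r x z p q) (h1 : ¬ r y t)
    (h2 : r' y t) (p q : α) : r' p q ↔ Joined r y t p q := by
  have s := @r.symm
  have t := @r.trans
  rw [hr] at h2 ⊢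
  unfold Joined at *
  constructor
  · rintro (h | ⟨h, h'⟩ | ⟨h, h'⟩)
    · exact Or.inl h
    · rcases h2 with h2 | ⟨h2, h2'⟩ | ⟨h2, h2'⟩
      · exact absurd h2 h1
      · exact Or.inr (Or.inl ⟨t h (s h2), t (s h2') h'⟩)
      · exact Or.inr (Or.inr ⟨t h h2', t h2 h'⟩)
    · rcases h2 with h2 | ⟨h2, h2'⟩ | ⟨h2, h2'⟩
      · exact absurd h2 h1
      · exact Or.inr (Or.inr ⟨t h h2', t h2 h'⟩)
      · exact Or.inr (Or.inl ⟨t h (s h2), t (s h2') h'⟩)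
  · rintro (h | ⟨h, h'⟩ | ⟨h, h'⟩)
    · exact Or.inl h
    · rcases h2 with h2 | ⟨h2, h2'⟩ | ⟨h2, h2'⟩
      · exact absurd h2 h1
      · exact Or.inr (Or.inl ⟨t h h2, t h2' h'⟩)
      · exact Or.inr (Or.inr ⟨t h h2, t h2' h'⟩)
    · rcases h2 with h2 | ⟨h2, h2'⟩ | ⟨h2, h2'⟩
      · exact absurd h2 h1
      · exact Or.inr (Or.inr ⟨t h (s h2'), t (s h2) h'⟩)
      · exact Or.inr (Or.inl ⟨t h (s h2'), t (s h2) h'⟩)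

theorem Saddle.congr_merge {y t : α} (h : Saddle r r' x z) (h0 : ¬ r x z) (h1 : ¬ r y t)
    (h2 : r' y t) : Saddle r r' y t where
  merge _ := joined_congr (h.merge h0) h1 h2
  fission h3 := absurd h3 h1

theorem Saddle.congr_fission {y t : α} (h : Saddle r r' x z) (h0 : r x z) (h1 : ¬ r' y t)
    (h2 : r y t) : Saddle r r' y t :=
  (h.symm.congr_merge (h.fission h0).1 h1 h2).symm

/-- The change of signs along a sequence of merges from `r` to `r'`. -/
def MergeSigns (r r' : Setoid α) (σ σ' : α → Sign) : Prop :=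
  (∀ p, σ' p = .minus ↔ ∃ q, r' p q ∧ σ q = .minus) ∧
    ∀ p q, r' p q → σ p = .minus → σ q = .minus → r p q

/-- A merge multiplies in the algebra where + is the unit and - squares to zero: a new class is -
when it contains a - class, and it may contain at most one. In this form the positions of the feet
have disappeared, and the condition makes sense for several merges at once. -/
theorem transition_iff_mergeSigns (h : Saddle r r' x z) (h0 : ¬ r x z) (hσ : Inv r σ)
    (hσ' : Inv r' σ') : Transition r x z σ σ' ↔ MergeSigns r r' σ σ' := by
  have s := @r.symm
  have t := @r.trans
  have rf := r.refl
  have hj := h.merge h0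
  constructor
  · rintro ⟨h1, h2, -⟩
    have h2 := mergeRule_iff.1 (h2 h0)
    constructor
    · intro p
      by_cases hp : r p x ∨ r p z
      · have h3 : r' p x := by
          rw [hj]; rcases hp with hp | hp
          · exact Or.inl hp
          · exact Or.inr (Or.inr ⟨hp, rf x⟩)
        rw [hσ' p x h3]
        constructor
        · intro h4
          rcases h2 with h2 | h2 | h2
          · simp [h4] at h2
          · exact ⟨x, h3, h2.1⟩
          · exact ⟨z, r'.trans h3 (h.rel_merge h0), h2.2.1⟩
        · rintro ⟨q, h4, h5⟩
          have h6 : r q x ∨ r q z := by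
            have := (hj q x).1 (r'.trans (r'.symm h4) h3)
            rcases this with h | ⟨h, -⟩ | ⟨h, -⟩
            · exact Or.inl h
            · exact Or.inl h
            · exact Or.inr h
          rcases h6 with h6 | h6
          · rw [hσ q x h6] at h5
            simp only [h5] at h2
            simp only [reduceCtorEq, true_and, false_and, or_false, false_or] at h2
            exact h2.2
          · rw [hσ q z h6] at h5
            simp only [h5] at h2
            simp only [reduceCtorEq, true_and, false_and, and_false, false_or] at h2
            exact h2.2
      · rw [not_or] at hp
        rw [h1 p hp.1 hp.2]
        constructor
        · intro h3; exact ⟨p, r'.refl p, h3⟩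
        · rintro ⟨q, h3, h4⟩
          rcases (hj p q).1 h3 with h | ⟨h, -⟩ | ⟨h, -⟩
          · rw [hσ p q h]; exact h4
          · exact absurd h hp.1
          · exact absurd h hp.2
    · intro p q h3 h4 h5
      rcases (hj p q).1 h3 with h | ⟨h, h'⟩ | ⟨h, h'⟩
      · exact h
      · rw [hσ p x h] at h4
        rw [← hσ z q h'] at h5
        simp [h4, h5] at h2
      · rw [hσ p z h] at h4
        rw [← hσ x q h'] at h5
        simp [h4, h5] at h2
  · rintro ⟨h1, h2⟩
    refine ⟨?_, fun _ => ?_, fun h3 => absurd h3 h0⟩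
    · intro p hp hp'
      have h3 : σ' p = .minus ↔ σ p = .minus := by
        rw [h1]
        constructor
        · rintro ⟨q, h3, h4⟩
          rcases (hj p q).1 h3 with h | ⟨h, -⟩ | ⟨h, -⟩
          · rw [hσ p q h]; exact h4
          · exact absurd h hp
          · exact absurd h hp'
        · intro h3; exact ⟨p, r'.refl p, h3⟩
      cases ha : σ p <;> cases hb : σ' p <;> simp_all
    · have h3 : ¬ (σ x = .minus ∧ σ z = .minus) :=
        fun h3 => h0 (h2 x z (h.rel_merge h0) h3.1 h3.2)
      have h4 : σ' x = .minus ↔ (σ x = .minus ∨ σ z = .minus) := by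
        rw [h1]
        constructor
        · rintro ⟨q, h3, h4⟩
          rcases (hj x q).1 h3 with h | ⟨h, h'⟩ | ⟨h, -⟩
          · rw [hσ x q h]; exact Or.inl h4
          · rw [hσ z q h']; exact Or.inr h4
          · exact absurd h h0
        · rintro (h3 | h3)
          · exact ⟨x, r'.refl x, h3⟩
          · exact ⟨z, h.rel_merge h0, h3⟩
      rw [mergeRule_iff]
      cases ha : σ x <;> cases hb : σ z <;> cases hc : σ' x <;> simp_all

/-- The Frobenius algebra is self-dual: read backwards with all signs reversed, the rule for
divisions is the rule for merges. Statements about divisions are reduced to merges in this way. -/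
theorem Transition.dual (ht : Transition r x z σ σ') (h : Saddle r r' x z) :
    Transition r' x z (fun p => (σ' p).neg) fun p => (σ p).neg where
  off p h1 h2 := by
    by_cases h0 : r x z
    · have h3 : ¬ r p x := by
        rw [(h.fission h0).2]
        rintro (h | ⟨h, -⟩ | ⟨h, -⟩)
        · exact h1 h
        · exact h1 h
        · exact h2 h
      rw [ht.off p h3 fun h4 => h3 (r.trans h4 (r.symm h0))]
    · rw [ht.off p (fun h3 => h1 (h.le h0 h3)) (fun h3 => h2 (h.le h0 h3))]
  merge h1 := by
    have h0 : r x z := by_contra fun h0 => h1 (h.rel_merge h0)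
    have := ht.fission h0
    rw [fissionRule_iff] at this
    rw [mergeRule_iff]
    simp only [Sign.neg_eq_plus, Sign.neg_eq_minus]
    tauto
  fission h1 := by
    have h0 : ¬ r x z := fun h0 => (h.fission h0).1 h1
    have := ht.merge h0
    rw [mergeRule_iff] at this
    rw [fissionRule_iff]
    simp only [Sign.neg_eq_plus, Sign.neg_eq_minus]
    tauto

theorem transition_dual_iff (h : Saddle r r' x z) :
    Transition r x z σ σ' ↔
      Transition r' x z (fun p => (σ' p).neg) fun p => (σ p).neg :=
  ⟨fun ht => ht.dual h, fun ht => by simpa using ht.dual h.symm⟩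

theorem transition_iff_mergeSigns_dual (h : Saddle r r' x z) (h0 : r x z) (hσ : Inv r σ)
    (hσ' : Inv r' σ') : Transition r x z σ σ' ↔
      MergeSigns r' r (fun p => (σ' p).neg) fun p => (σ p).neg := by
  rw [transition_dual_iff h,
    transition_iff_mergeSigns h.symm (h.fission h0).1 hσ'.neg hσ.neg]

/-- Both sides are a `MergeSigns` condition that mentions only the two partitions, so feet can be
moved freely as long as the saddle stays of the same type. -/
theorem transition_congr {y t : α} (h : Saddle r r' x z) (h' : Saddle r r' y t)
    (h0 : r x z ↔ r y t) (hσ : Inv r σ) (hσ' : Inv r' σ') :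
    Transition r x z σ σ' ↔ Transition r y t σ σ' := by
  by_cases h1 : r x z
  · rw [transition_iff_mergeSigns_dual h h1 hσ hσ',
      transition_iff_mergeSigns_dual h' (h0.1 h1) hσ hσ']
  · rw [transition_iff_mergeSigns h h1 hσ hσ',
      transition_iff_mergeSigns h' (fun h2 => h1 (h0.2 h2)) hσ hσ']

theorem MergeSigns.right_unique {τ : α → Sign} (h : MergeSigns r r' σ σ')
    (h' : MergeSigns r r' σ τ) : σ' = τ := by
  funext p
  have h1 := h.1 p
  rw [← h'.1 p] at h1
  cases ha : σ' p <;> cases hb : τ p <;> simp_all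

/-- Signs between two saddles. -/
structure IsMid (r r₁ : Setoid α) (x z y t : α) (σ σ' a : α → Sign) : Prop where
  inv : Inv r₁ a
  fst : Transition r x z σ a
  snd : Transition r₁ y t a σ'

theorem isMid_dual {y t : α} {a : α → Sign} (h₁ : Saddle r r₁ x z) (h₂ : Saddle r₁ r' y t) :
    IsMid r r₁ x z y t σ σ' a ↔ IsMid r' r₁ y t x z (fun p => (σ' p).neg) (fun p => (σ p).neg)
      fun p => (a p).neg := by
  constructor
  · rintro ⟨h, h3, h4⟩
    exact ⟨h.neg, h4.dual h₂, h3.dual h₁⟩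
  · rintro ⟨h, h3, h4⟩
    have h : Inv r₁ a := by simpa using h.neg
    exact ⟨h, (transition_dual_iff h₁).2 h4, (transition_dual_iff h₂).2 h3⟩

theorem IsMid.congr {y t x' z' y' t' : α} {a : α → Sign} (hσ : Inv r σ) (hσ' : Inv r' σ')
    (h₁ : Saddle r r₁ x z) (h₂ : Saddle r₁ r' y t) (h₁' : Saddle r r₁ x' z')
    (h₂' : Saddle r₁ r' y' t') (h3 : r x z ↔ r x' z') (h4 : r₁ y t ↔ r₁ y' t') :
    IsMid r r₁ x z y t σ σ' a ↔ IsMid r r₁ x' z' y' t' σ σ' a := by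
  constructor
  · rintro ⟨h, a, b⟩
    exact ⟨h, (transition_congr h₁ h₁' h3 hσ h).1 a, (transition_congr h₂ h₂' h4 h hσ').1 b⟩
  · rintro ⟨h, a, b⟩
    exact ⟨h, (transition_congr h₁ h₁' h3 hσ h).2 a, (transition_congr h₂ h₂' h4 h hσ').2 b⟩

/-- A merge comes first, so that it determines the signs in the middle. -/
theorem IsMid.unique_of_merge {y t : α} {a b : α → Sign} (hσ : Inv r σ) (h₁ : Saddle r r₁ x z)
    (h0 : ¬ r x z) (ha : IsMid r r₁ x z y t σ σ' a) (hb : IsMid r r₁ x z y t σ σ' b) : a = b :=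
  MergeSigns.right_unique ((transition_iff_mergeSigns h₁ h0 hσ ha.inv).1 ha.fst)
    ((transition_iff_mergeSigns h₁ h0 hσ hb.inv).1 hb.fst)

/-- Associativity: the condition obtained does not mention the partition in the middle, so any two
sequences of two merges with the same ends are equivalent. -/
theorem exists_isMid_iff_of_merge_merge {y t : α} (h₁ : Saddle r r₁ x z) (h0 : ¬ r x z)
    (h₂ : Saddle r₁ r' y t) (h0' : ¬ r₁ y t) (hσ : Inv r σ) (hσ' : Inv r' σ') :
    (∃ a, IsMid r r₁ x z y t σ σ' a) ↔ MergeSigns r r' σ σ' := by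
  constructor
  · rintro ⟨a, h, h1, h2⟩
    rw [transition_iff_mergeSigns h₁ h0 hσ h] at h1
    rw [transition_iff_mergeSigns h₂ h0' h hσ'] at h2
    constructor
    · intro p
      rw [h2.1]
      constructor
      · rintro ⟨q, h3, h4⟩
        obtain ⟨u, h5, h6⟩ := (h1.1 q).1 h4
        exact ⟨u, r'.trans h3 (h₂.le h0' h5), h6⟩
      · rintro ⟨q, h3, h4⟩
        exact ⟨q, h3, (h1.1 q).2 ⟨q, r₁.refl q, h4⟩⟩
    · intro p q h3 h4 h5
      exact h1.2 p q (h2.2 p q h3 ((h1.1 p).2 ⟨p, r₁.refl p, h4⟩)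
        ((h1.1 q).2 ⟨q, r₁.refl q, h5⟩)) h4 h5
  · rintro ⟨h1, h2⟩
    classical
    -- A middle class is - exactly when it contains a point which is - at the source; this is the
    -- only candidate.
    set a : α → Sign := fun p => if ∃ q, r₁ p q ∧ σ q = .minus then .minus else .plus with ha
    have ha' : ∀ p, a p = .minus ↔ ∃ q, r₁ p q ∧ σ q = .minus := by
      intro p; simp only [ha]; split_ifs with h <;> simp [h]
    have hinv : Inv r₁ a := by
      intro p q hpq
      have : a p = .minus ↔ a q = .minus := by
        rw [ha', ha']
        exact ⟨fun ⟨u, h, h'⟩ => ⟨u, r₁.trans (r₁.symm hpq) h, h'⟩,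
          fun ⟨u, h, h'⟩ => ⟨u, r₁.trans hpq h, h'⟩⟩
      cases hb : a p <;> cases hc : a q <;> simp_all
    refine ⟨a, hinv, ?_, ?_⟩
    · rw [transition_iff_mergeSigns h₁ h0 hσ hinv]
      exact ⟨ha', fun p q h3 h4 h5 => h2 p q (h₂.le h0' h3) h4 h5⟩
    · rw [transition_iff_mergeSigns h₂ h0' hinv hσ']
      refine ⟨fun p => ?_, fun p q h3 h4 h5 => ?_⟩
      · rw [h1]
        constructor
        · rintro ⟨q, h3, h4⟩
          exact ⟨q, h3, (ha' q).2 ⟨q, r₁.refl q, h4⟩⟩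
        · rintro ⟨q, h3, h4⟩
          obtain ⟨u, h5, h6⟩ := (ha' q).1 h4
          exact ⟨u, r'.trans h3 (h₂.le h0' h5), h6⟩
      · obtain ⟨u, h6, h7⟩ := (ha' p).1 h4
        obtain ⟨v, h8, h9⟩ := (ha' q).1 h5
        have := h2 u v (r'.trans (r'.symm (h₂.le h0' h6)) (r'.trans h3 (h₂.le h0' h8))) h7 h9
        exact r₁.trans h6 (r₁.trans (h₁.le h0 this) (r₁.symm h8))

end Saddles

/-! ### The Frobenius relation, case by case -/

section Squares

variable {α : Type*} {r r' r₁ r₂ : Setoid α} {c c' d d' : α} {σ σ' : α → Sign}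

theorem Inv.exists_factor {r s : Setoid α} (h : Inv s σ) (hrs : ∀ p q, r p q → s p q) :
    ∃ τ : Quotient r → Sign, ∀ p, σ p = τ (Quotient.mk r p) :=
  ⟨Quotient.lift σ fun p q hpq => h p q (hrs p q hpq), fun _ => rfl⟩

/-- With the labels k, relatedness becomes equality of labels and invariant signs become functions
of labels, so the case analyses below turn into finite problems about a few labels. -/
theorem exists_map_rel (r : Setoid α) : ∃ k : α → Quotient r, (∀ p q, r p q ↔ k p = k q) ∧
    ∀ (s : Setoid α) (σ : α → Sign), Inv s σ → (∀ p q, r p q → s p q) →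
      ∃ τ : Quotient r → Sign, ∀ p, σ p = τ (k p) :=
  ⟨Quotient.mk r, fun _ _ => Quotient.eq.symm, fun _ _ h hrs => h.exists_factor hrs⟩

/-- The Frobenius relation, for feet on three circles of the partition `r₂`. -/
theorem exists_isMid_frobenius_of_rel (h₁ : Saddle r r₁ d d') (h0 : ¬ r d d')
    (h0' : r₁ c c') (h₂ : Saddle r r₂ c c') (h2 : r c c')
    (h₂' : Saddle r₂ r' d d') (h2' : ¬ r₂ d d') (hσ : Inv r σ) (hσ' : Inv r' σ')
    (hcd : r₂ c d) :
    (∃ a, IsMid r r₁ d d' c c' σ σ' a) ↔ ∃ b, IsMid r r₂ c c' d d' σ σ' b := by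
  obtain ⟨k, hk, hf⟩ := exists_map_rel r₂
  obtain ⟨s, hs⟩ := hf r σ hσ fun p q => h₂.symm.le (h₂.fission h2).1
  obtain ⟨s', hs'⟩ := hf r' σ' hσ' fun p q => h₂'.le h2'
  have hr := (h₂.fission h2).2
  have hr' := h₂'.merge h2'
  have hr₁ := h₁.merge h0
  have hcc := (h₂.fission h2).1
  have n0 := h0
  have n0' := h0'
  have n2' := h2'
  simp only [Joined, hr] at hr₁
  simp only [Joined] at hr hr'
  simp only [hr, hr₁, hk] at hcd hcc n0 n0' n2'
  simp only [Inv, hr, hk, hs] at hσ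
  simp only [Inv, hr', hk, hs'] at hσ'
  classical
  constructor
  · rintro ⟨a, hi, ⟨a1, a2, -⟩, ⟨b1, -, b2⟩⟩
    have a2 := a2 h0
    have b2 := b2 h0'
    simp only [Inv, hr₁, hk] at hi
    simp only [hr, hk, hs] at a1
    simp only [hr₁, hk, hs'] at b1
    simp only [mergeRule_iff, hs] at a2
    simp only [fissionRule_iff, hs'] at b2
    -- Along the path through `r₂` the circle of c' is untouched by the second saddle, so its sign
    -- is that of the target. The rule for dividing the source circle then forces the sign X of the
    -- circle shared by c and d.
    set X : Sign := if s (k c) = .minus then .minus else (s' (k c')).neg with hX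
    have e1 := Sign.ne_plus (a := s' (k c'))
    have e2 := Sign.ne_plus (a := s (k c))
    have e3 := @Sign.neg_eq_plus (s' (k c'))
    have e4 := @Sign.neg_eq_minus (s' (k c'))
    refine ⟨fun p => if k p = k c' then s' (k c') else if k p = k c then X else s (k p), ?_, ?_, ?_⟩
    · intro p q hpq
      rw [hk] at hpq
      simp only [hpq]
    · refine ⟨?_, fun h => absurd h2 h, fun _ => ?_⟩
      · intro p
        simp only [hr, hk, hs]
        grind
      · simp only [fissionRule_iff, hs]
        grind
    · refine ⟨?_, fun _ => ?_, fun h => absurd h h2'⟩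
      · intro p
        simp only [hk, hs']
        grind
      · simp only [mergeRule_iff, hs']
        grind
  · rintro ⟨b, hi, ⟨a1, -, a2⟩, ⟨b1, b2, -⟩⟩
    have a2 := a2 h2
    have b2 := b2 h2'
    simp only [Inv, hk] at hi
    simp only [hr, hk, hs] at a1
    simp only [hk, hs'] at b1
    simp only [fissionRule_iff, hs] at a2
    simp only [mergeRule_iff, hs'] at b2
    -- X is the product of the source signs at d and d', as the merge requires.
    set X : Sign := if s (k d) = .minus then .minus else s (k d') with hX
    have e2 := Sign.ne_plus (a := s (k d))
    have e3 := Sign.ne_plus (a := s (k d'))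
    refine ⟨fun p => if k p = k c ∨ k p = k c' ∨ k p = k d' then X else s (k p), ?_, ?_, ?_⟩
    · intro p q hpq
      rw [hr₁] at hpq
      simp only [hk] at hpq
      grind
    · refine ⟨?_, fun _ => ?_, fun h => absurd h h0⟩
      · intro p
        simp only [hr, hk, hs]
        grind
      · simp only [mergeRule_iff, hs]
        grind
    · refine ⟨?_, fun h => absurd h0' h, fun _ => ?_⟩
      · intro p
        simp only [hr₁, hk, hs']
        grind
      · simp only [fissionRule_iff, hs']
        grind

/-- The Frobenius relation, for feet on four circles of the partition `r₂`. -/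
theorem exists_isMid_frobenius_of_not_rel (h₁ : Saddle r r₁ d d') (h0 : ¬ r d d')
    (h0' : r₁ c c') (h₂ : Saddle r r₂ c c') (h2 : r c c')
    (h₂' : Saddle r₂ r' d d') (h2' : ¬ r₂ d d') (hσ : Inv r σ) (hσ' : Inv r' σ')
    (hcd : ¬ r₂ c d) (hcd' : ¬ r₂ c d') (hc'd : ¬ r₂ c' d) (hc'd' : ¬ r₂ c' d') :
    (∃ a, IsMid r r₁ d d' c c' σ σ' a) ↔ ∃ b, IsMid r r₂ c c' d d' σ σ' b := by
  obtain ⟨k, hk, hf⟩ := exists_map_rel r₂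
  obtain ⟨s, hs⟩ := hf r σ hσ fun p q => h₂.symm.le (h₂.fission h2).1
  obtain ⟨s', hs'⟩ := hf r' σ' hσ' fun p q => h₂'.le h2'
  have hr := (h₂.fission h2).2
  have hr' := h₂'.merge h2'
  have hr₁ := h₁.merge h0
  have hcc := (h₂.fission h2).1
  have n2' := h2'
  simp only [Joined, hr] at hr₁
  simp only [Joined] at hr hr'
  simp only [hk] at hcd hcc n2' hcd' hc'd hc'd'
  simp only [Inv, hr, hk, hs] at hσ
  simp only [Inv, hr', hk, hs'] at hσ'
  classical
  constructor
  · rintro ⟨a, hi, ⟨a1, a2, -⟩, ⟨b1, -, b2⟩⟩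
    have a2 := a2 h0
    have b2 := b2 h0'
    simp only [Inv, hr₁, hk] at hi
    simp only [hr, hk, hs] at a1
    simp only [hr₁, hk, hs'] at b1
    simp only [mergeRule_iff, hs] at a2
    simp only [fissionRule_iff, hs'] at b2
    -- The supports are disjoint: after the division alone, the signs at its feet are already final
    -- and the others are still initial. The converse uses the same recipe for the merge.
    refine ⟨fun p => if k p = k c ∨ k p = k c' then s' (k p) else s (k p), ?_, ?_, ?_⟩
    · intro p q hpq
      rw [hk] at hpq
      simp only [hpq]
    · refine ⟨?_, fun h => absurd h2 h, fun _ => ?_⟩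
      · intro p
        simp only [hr, hk, hs]
        grind
      · simp only [fissionRule_iff, hs]
        grind
    · refine ⟨?_, fun _ => ?_, fun h => absurd h h2'⟩
      · intro p
        simp only [hk, hs']
        grind
      · simp only [mergeRule_iff, hs']
        grind
  · rintro ⟨b, hi, ⟨a1, -, a2⟩, ⟨b1, b2, -⟩⟩
    have a2 := a2 h2
    have b2 := b2 h2'
    simp only [Inv, hk] at hi
    simp only [hr, hk, hs] at a1
    simp only [hk, hs'] at b1
    simp only [fissionRule_iff, hs] at a2
    simp only [mergeRule_iff, hs'] at b2
    refine ⟨fun p => if k p = k d ∨ k p = k d' then s' (k p) else s (k p), ?_, ?_, ?_⟩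
    · intro p q hpq
      rw [hr₁] at hpq
      simp only [hk] at hpq
      grind
    · refine ⟨?_, fun _ => ?_, fun h => absurd h h0⟩
      · intro p
        simp only [hr, hk, hs]
        grind
      · simp only [mergeRule_iff, hs]
        grind
    · refine ⟨?_, fun h => absurd h0' h, fun _ => ?_⟩
      · intro p
        simp only [hr₁, hk, hs']
        grind
      · simp only [fissionRule_iff, hs']
        grind

end Squares

/-! ### Counting the signs in the middle of a square of saddles -/

section Squares

variable {α : Type*} {r r' r₁ r₂ : Setoid α} {c c' d d' x z : α} {σ σ' : α → Sign}

/-- Exchanging c with c' or d with d' reduces every coincidence between circles of `r₂` to one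
between c and d. If there is none, the supports are disjoint. -/
theorem exists_isMid_frobenius (h₁ : Saddle r r₁ d d') (h0 : ¬ r d d')
    (h₁' : Saddle r₁ r' c c') (h0' : r₁ c c') (h₂ : Saddle r r₂ c c') (h2 : r c c')
    (h₂' : Saddle r₂ r' d d') (h2' : ¬ r₂ d d') (hσ : Inv r σ) (hσ' : Inv r' σ') :
    (∃ a, IsMid r r₁ d d' c c' σ σ' a) ↔ ∃ b, IsMid r r₂ c c' d d' σ σ' b := by
  have n1 : ¬ r d' d := fun h => h0 (r.symm h)
  have n2 : ¬ r₂ d' d := fun h => h2' (r₂.symm h)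
  have n3 : r c' c := r.symm h2
  have n4 : r₁ c' c := r₁.symm h0'
  have i1 : r c c' ↔ r c' c := ⟨r.symm, r.symm⟩
  have i2 : r d d' ↔ r d' d := ⟨r.symm, r.symm⟩
  have i3 : r₁ c c' ↔ r₁ c' c := ⟨r₁.symm, r₁.symm⟩
  have i4 : r₂ d d' ↔ r₂ d' d := ⟨r₂.symm, r₂.symm⟩
  by_cases k1 : r₂ c d
  · exact exists_isMid_frobenius_of_rel h₁ h0 h0' h₂ h2 h₂' h2' hσ hσ' k1
  by_cases k2 : r₂ c d'
  · rw [exists_congr fun a => IsMid.congr hσ hσ' h₁ h₁' h₁.comm h₁' i2 Iff.rfl,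
      exists_congr fun a => IsMid.congr hσ hσ' h₂ h₂' h₂ h₂'.comm Iff.rfl i4]
    exact exists_isMid_frobenius_of_rel h₁.comm n1 h0' h₂ h2 h₂'.comm n2 hσ hσ' k2
  by_cases k3 : r₂ c' d
  · rw [exists_congr fun a => IsMid.congr hσ hσ' h₁ h₁' h₁ h₁'.comm Iff.rfl i3,
      exists_congr fun a => IsMid.congr hσ hσ' h₂ h₂' h₂.comm h₂' i1 Iff.rfl]
    exact exists_isMid_frobenius_of_rel h₁ h0 n4 h₂.comm n3 h₂' h2' hσ hσ' k3
  by_cases k4 : r₂ c' d'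
  · rw [exists_congr fun a => IsMid.congr hσ hσ' h₁ h₁' h₁.comm h₁'.comm i2 i3,
      exists_congr fun a => IsMid.congr hσ hσ' h₂ h₂' h₂.comm h₂'.comm i1 i4]
    exact exists_isMid_frobenius_of_rel h₁.comm n1 n4 h₂.comm n3 h₂'.comm n2 hσ hσ' k4
  exact exists_isMid_frobenius_of_not_rel h₁ h0 h0' h₂ h2 h₂' h2' hσ hσ' k1 k2 k3 k4

/-- A circle is divided and merged again: there are two choices for the signs in the middle. -/
theorem nonempty_isMid_equiv_of_genus (h₁ : Saddle r r₁ x z) (h0 : r x z) (hσ : Inv r σ)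
    (hσ' : Inv r σ') :
    Nonempty ({a // IsMid r r₁ x z x z σ σ' a} ≃
      {_e : Sign // σ x = .plus ∧ σ' x = .minus ∧ ∀ p, ¬ r p x → σ' p = σ p}) := by
  have hr := (h₁.fission h0).2
  have hn := (h₁.fission h0).1
  obtain ⟨k, hk, hf⟩ := exists_map_rel r₁
  obtain ⟨s, hs⟩ := hf r σ hσ fun p q => h₁.symm.le hn
  obtain ⟨s', hs'⟩ := hf r σ' hσ' fun p q => h₁.symm.le hn
  have n1 := hn
  simp only [Joined] at hr
  simp only [hk] at n1
  simp only [Inv, hr, hk, hs] at hσ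
  simp only [Inv, hr, hk, hs'] at hσ'
  classical
  -- Dividing + gives opposite signs at x and z, which merge to -. So the sign at x is a free
  -- parameter, and this accounts for the factor 2 of a handle.
  refine ⟨⟨fun a => ⟨a.1 x, ?_⟩, fun e => ⟨fun p => if k p = k x then e.1 else
    if k p = k z then e.1.neg else s (k p), ?_⟩, ?_, ?_⟩⟩
  · obtain ⟨a, hi, ⟨a1, -, a2⟩, ⟨b1, b2, -⟩⟩ := a
    have a2 := a2 h0
    have b2 := b2 hn
    simp only [Inv, hk] at hi
    simp only [hr, hk, hs] at a1
    simp only [hk, hs'] at b1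
    simp only [fissionRule_iff, hs] at a2
    simp only [mergeRule_iff, hs'] at b2
    simp only [hs, hs', hr, hk]
    refine ⟨by grind, by grind, fun p hp => ?_⟩
    grind
  · obtain ⟨e, h1, h2, h3⟩ := e
    simp only [hs, hs', hr, hk] at h1 h2 h3
    have e1 := Sign.ne_plus (a := e)
    have e3 := @Sign.neg_eq_plus e
    have e4 := @Sign.neg_eq_minus e
    refine ⟨?_, ?_, ?_⟩
    · intro p q hpq
      rw [hk] at hpq
      simp only [hpq]
    · refine ⟨?_, fun h => absurd h0 h, fun _ => ?_⟩
      · intro p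
        simp only [hr, hk, hs]
        grind
      · simp only [fissionRule_iff, hs]
        grind
    · refine ⟨?_, fun _ => ?_, fun h => absurd h hn⟩
      · intro p
        simp only [hk, hs']
        grind
      · simp only [mergeRule_iff, hs']
        grind
  · rintro ⟨a, hi, ⟨a1, -, a2⟩, ⟨-, b2, -⟩⟩
    have a2 := a2 h0
    have b2 := b2 hn
    simp only [Inv, hk] at hi
    simp only [mergeRule_iff] at b2
    simp only [hr, hk, hs] at a1
    simp only [fissionRule_iff, hs] at a2
    have e1 := Sign.ne_plus (a := a x)
    have e3 := @Sign.neg_eq_plus (a x)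
    have e4 := @Sign.neg_eq_minus (a x)
    ext p
    simp only
    have := a1 p
    have := hi p x
    have := hi p z
    by_cases p1 : k p = k x
    · grind
    by_cases p2 : k p = k z
    · grind
    grind
  · rintro ⟨e, -⟩
    simp

theorem nonempty_equiv_of_subsingleton {β : Type*} {P Q : β → Prop}
    (hP : ∀ a b, P a → P b → a = b) (hQ : ∀ a b, Q a → Q b → a = b)
    (h : (∃ a, P a) ↔ ∃ b, Q b) : Nonempty ({a // P a} ≃ {b // Q b}) := by
  have h1 : ∀ a : {a // P a}, ∃ b, Q b := fun a => h.1 ⟨a.1, a.2⟩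
  have h2 : ∀ b : {b // Q b}, ∃ a, P a := fun b => h.2 ⟨b.1, b.2⟩
  choose f hf using h1
  choose g hg using h2
  exact ⟨⟨fun a => ⟨f a, hf a⟩, fun b => ⟨g b, hg b⟩, fun a => Subtype.ext (hP _ _ (hg _) a.2),
    fun b => Subtype.ext (hQ _ _ (hf _) b.2)⟩⟩

/-- The feet of two paths of saddles around a square: along the path `x z`, `y t` and along the path
`x' z'`, `y' t'`. -/
structure SquareFeet (x z y t x' z' y' t' : α) : Prop where
  fst : ∀ R : Setoid α, R x z → (R y t ↔ R x' z')
  snd : ∀ R : Setoid α, R x' z' → (R y' t' ↔ R x z)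
  thd : ∀ R : Setoid α, R y t → (R x z ↔ R y' t')
  fth : ∀ R : Setoid α, R y' t' → (R x' z' ↔ R y t)

variable {y t x' z' y' t' : α}

theorem SquareFeet.symm (h : SquareFeet x z y t x' z' y' t') :
    SquareFeet x' z' y' t' x z y t := ⟨h.2, h.1, h.4, h.3⟩

theorem SquareFeet.reverse (h : SquareFeet x z y t x' z' y' t') :
    SquareFeet y t x z y' t' x' z' := ⟨h.3, h.4, h.1, h.2⟩

/-- After two merges all the feet are joined in `r'`. If the other path began with a division, its
feet would be related in `r`, hence in `r₁`, and then the second merge would have nothing to merge.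
If it ended with a division, `r'` would separate feet which it joins. -/
theorem SquareFeet.merge_merge (hf : SquareFeet x z y t x' z' y' t') (h₁ : Saddle r r₁ x z)
    (h₁' : Saddle r₁ r' y t) (h₂ : Saddle r r₂ x' z') (h₂' : Saddle r₂ r' y' t')
    (h0 : ¬ r x z) (h0' : ¬ r₁ y t) : ¬ r x' z' ∧ ¬ r₂ y' t' := by
  have a : ¬ r x' z' := fun h => h0' ((hf.fst r₁ (h₁.rel_merge h0)).2 (h₁.le h0 h))
  refine ⟨a, fun h => ?_⟩
  have b := (hf.snd r₂ (h₂.rel_merge a)).1 h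
  refine (h₂'.fission h).1 ?_
  have e1 : r' x z := h₁'.le h0' (h₁.rel_merge h0)
  have e2 : r' y t := h₁'.rel_merge h0'
  exact (hf.snd r' ((hf.fst r' e1).1 e2)).2 e1

/-- Both paths are reversed, which turns divisions into merges. -/
theorem SquareFeet.fission_fission (hf : SquareFeet x z y t x' z' y' t') (h₁ : Saddle r r₁ x z)
    (h₁' : Saddle r₁ r' y t) (h₂ : Saddle r r₂ x' z') (h₂' : Saddle r₂ r' y' t')
    (h0 : r x z) (h0' : r₁ y t) : r x' z' ∧ r₂ y' t' := by
  have := hf.reverse.merge_merge h₁'.symm h₁.symm h₂'.symm h₂.symm (h₁'.fission h0').1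
    (h₁.fission h0).1
  exact ⟨by_contra fun h => this.2 (h₂.rel_merge h), by_contra fun h => this.1 (h₂'.rel_merge h)⟩

theorem setoid_eq_of_merge (hr : ∀ p q, r₁ p q ↔ Joined r x z p q) (hle : ∀ p q, r p q → r₂ p q)
    (h : r₂ x z) (hle' : ∀ p q, r₂ p q → r₁ p q) : r₁ = r₂ := by
  ext p q
  refine ⟨fun h1 => ?_, hle' p q⟩
  rcases (hr p q).1 h1 with h2 | ⟨h2, h3⟩ | ⟨h2, h3⟩
  · exact hle _ _ h2
  · exact r₂.trans (hle _ _ h2) (r₂.trans h (hle _ _ h3))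
  · exact r₂.trans (hle _ _ h2) (r₂.trans (r₂.symm h) (hle _ _ h3))

theorem Joined.le {R : Setoid α} (hle : ∀ p q, r p q → R p q) (h : R x z) {p q : α}
    (hj : Joined r x z p q) : R p q := by
  rcases hj with h2 | ⟨h2, h3⟩ | ⟨h2, h3⟩
  · exact hle _ _ h2
  · exact R.trans (hle _ _ h2) (R.trans h (hle _ _ h3))
  · exact R.trans (hle _ _ h2) (R.trans (R.symm h) (hle _ _ h3))

/-- A merge followed by a division, against a division followed by a merge. -/
theorem nonempty_isMid_equiv_frobenius (hf : SquareFeet x z y t x' z' y' t')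
    (h₁ : Saddle r r₁ x z) (h₁' : Saddle r₁ r' y t) (h₂ : Saddle r r₂ x' z')
    (h₂' : Saddle r₂ r' y' t') (hσ : Inv r σ) (hσ' : Inv r' σ')
    (h0 : ¬ r x z) (h0' : r₁ y t) (k0 : r x' z') (k0' : ¬ r₂ y' t') :
    Nonempty ({a // IsMid r r₁ x z y t σ σ' a} ≃ {b // IsMid r r₂ x' z' y' t' σ σ' b}) := by
  have e1 : r₁ x' z' := h₁.le h0 k0
  have e2 : r₁ x z := h₁.rel_merge h0
  have e3 : ¬ r y' t' := fun h => h0 ((hf.snd r k0).1 h)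
  have e4 : r₁ y' t' := (hf.snd r₁ e1).2 e2
  have e5 : r' y' t' := h₂'.rel_merge k0'
  have e6 : ¬ r' x' z' := fun h => (h₁'.fission h0').1
    ((hf.fth r' e5).1 h)
  -- On the first path the merge can be carried out at y', t' and the division at x', z', which
  -- brings the square into the form of `exists_isMid_frobenius`.
  have g1 : Saddle r r₁ y' t' := h₁.congr_merge h0 e3 e4
  have g2 : Saddle r₁ r' x' z' := h₁'.congr_fission h0' e6 e1
  have key := exists_isMid_frobenius g1 e3 g2 e1 h₂ k0 h₂' k0' hσ hσ'
  rw [← exists_congr fun a => IsMid.congr (a := a) hσ hσ' h₁ h₁' g1 g2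
    (iff_of_false h0 e3) (iff_of_true h0' e1)] at key
  refine nonempty_equiv_of_subsingleton (fun a b => IsMid.unique_of_merge hσ h₁ h0) ?_ key
  intro a b ha hb
  -- the signs are determined off the feet of the division by the source, at the feet by the target
  obtain ⟨a0, a1, a2⟩ := ha
  obtain ⟨b0, b1, b2⟩ := hb
  obtain ⟨k, hk, hfac⟩ := exists_map_rel r₂
  have hr := (h₂.fission k0).2
  have hn := (h₂.fission k0).1
  have hr' := h₂'.merge k0'
  obtain ⟨s, hs⟩ := hfac r σ hσ fun p q => h₂.symm.le hn
  obtain ⟨s', hs'⟩ := hfac r' σ' hσ' fun p q => h₂'.le k0'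
  obtain ⟨α, hα⟩ := hfac r₂ a a0 fun p q => id
  obtain ⟨β, hβ⟩ := hfac r₂ b b0 fun p q => id
  have a3 := a1.fission k0
  have b3 := b1.fission k0
  have a4 := a2.merge k0'
  have b4 := b2.merge k0'
  have a1 := a1.off
  have a2 := a2.off
  have b1 := b1.off
  have b2 := b2.off
  simp only [Joined] at hr hr'
  simp only [hr, hk] at e3
  simp only [hk] at hn k0'
  simp only [hr, hk, hs, hα] at a1
  simp only [hr, hk, hs, hβ] at b1
  simp only [hk, hs', hα] at a2
  simp only [hk, hs', hβ] at b2
  simp only [fissionRule_iff, hs, hα] at a3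
  simp only [fissionRule_iff, hs, hβ] at b3
  simp only [mergeRule_iff, hs', hα] at a4
  simp only [mergeRule_iff, hs', hβ] at b4
  funext p
  rw [hα, hβ]
  have i1 := a1 p
  have i2 := b1 p
  have i3 := a2 x'
  have i4 := a2 z'
  have i5 := b2 x'
  have i6 := b2 z'
  have i7 := a1 y'
  have i8 := a1 t'
  have i9 := b1 y'
  have i10 := b1 t'
  clear a1 a2 b1 b2 key hfac hf h₁ h₁' h₂ h₂' g1 g2 a0 b0 hσ hσ' hr hr' e1 e2 e4 e5 e6
  clear h0 h0' k0 hk hs hs' hα hβ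
  simp only [and_true, not_or, and_imp] at i1 i2 i7 i8 i9 i10 e3
  have hn' : ¬ k z' = k x' := fun h => hn h.symm
  simp only [hn, hn', and_false, not_false_eq_true, forall_true_left] at i1 i2 i7 i8 i9 i10
  have : α (k x') = β (k x') ∧ α (k z') = β (k z') := by
    generalize k x' = X at *
    generalize k z' = Z at *
    generalize k y' = Y at *
    generalize k t' = T at *
    clear i1 i2
    by_cases c1 : Y = X
    · subst c1; grind
    · by_cases c2 : T = X
      · subst c2; grind
      · have i3 := i3 (Ne.symm c1) (Ne.symm c2)
        have i5 := i5 (Ne.symm c1) (Ne.symm c2)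
        clear i7 i8 i9 i10 a4 b4
        grind
  by_cases p1 : k p = k x'
  · rw [p1]; exact this.1
  by_cases p2 : k p = k z'
  · rw [p2]; exact this.2
  grind

/-- The cases are the axioms of the Frobenius algebra. Two merges give associativity, two divisions
give its dual, and one of each gives either the Frobenius relation, or the same middle partition
twice, or a handle. A handle has two choices of middle signs or none, on either side; in the other
cases the proof compares unique choices or identical sets of choices. A bijection, rather than a
statement of existence, is needed because the signs index sums over a general ring. -/
theorem nonempty_isMid_equiv (hf : SquareFeet x z y t x' z' y' t')
    (h₁ : Saddle r r₁ x z) (h₁' : Saddle r₁ r' y t) (h₂ : Saddle r r₂ x' z')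
    (h₂' : Saddle r₂ r' y' t') (hσ : Inv r σ) (hσ' : Inv r' σ') :
    Nonempty ({a // IsMid r r₁ x z y t σ σ' a} ≃ {b // IsMid r r₂ x' z' y' t' σ σ' b}) := by
  by_cases h0 : r x z <;> by_cases h0' : r₁ y t
  · -- two divisions
    obtain ⟨k0, k0'⟩ := hf.fission_fission h₁ h₁' h₂ h₂' h0 h0'
    refine nonempty_equiv_of_subsingleton ?_ ?_ ?_
    · intro a b ha hb
      rw [isMid_dual h₁ h₁'] at ha hb
      have := IsMid.unique_of_merge hσ'.neg h₁'.symm (h₁'.fission h0').1 ha hb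
      funext p; exact Sign.neg_injective (congrFun this p)
    · intro a b ha hb
      rw [isMid_dual h₂ h₂'] at ha hb
      have := IsMid.unique_of_merge hσ'.neg h₂'.symm (h₂'.fission k0').1 ha hb
      funext p; exact Sign.neg_injective (congrFun this p)
    · have key : ∀ {s : Setoid α} {x z y t : α}, Saddle r s x z → Saddle s r' y t → r x z →
          s y t → ((∃ a, IsMid r s x z y t σ σ' a) ↔
            MergeSigns r' r (fun p => (σ' p).neg) fun p => (σ p).neg) := by
        intro s x z y t g g' e e'
        rw [← exists_isMid_iff_of_merge_merge g'.symm (g'.fission e').1 g.symm (g.fission e).1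
          hσ'.neg hσ.neg]
        constructor
        · rintro ⟨a, ha⟩; exact ⟨_, (isMid_dual g g').1 ha⟩
        · rintro ⟨a, ha⟩
          refine ⟨fun p => (a p).neg, (isMid_dual g g').2 ?_⟩
          simpa using ha
      rw [key h₁ h₁' h0 h0', key h₂ h₂' k0 k0']
  · by_cases k0 : r x' z'
    · -- a handle
      have k0' : ¬ r₂ y' t' := fun h =>
        h0' (hf.symm.fission_fission h₂ h₂' h₁ h₁' k0 h).2
      have e1 : r y t := (hf.fst r h0).2 k0
      have e2 : r y' t' := (hf.snd r k0).2 h0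
      have f1 := (h₁.symm.congr_merge (h₁.fission h0).1 h0' e1)
      have f2 := (h₂.symm.congr_merge (h₂.fission k0).1 k0' e2)
      -- Both partitions are obtained from `r₁` by joining y and t, so dividing and merging restores
      -- the source.
      have g1 : r = r' := by
        ext p q
        rw [f1.merge h0', h₁'.merge h0']
      subst g1
      obtain ⟨q1⟩ := nonempty_isMid_equiv_of_genus h₁ h0 hσ hσ'
      obtain ⟨q2⟩ := nonempty_isMid_equiv_of_genus h₂ k0 hσ hσ'
      have i1 : ∀ a, IsMid r r₁ x z y t σ σ' a ↔ IsMid r r₁ x z x z σ σ' a := fun a =>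
        IsMid.congr hσ hσ' h₁ h₁' h₁ h₁.symm Iff.rfl (iff_of_false h0' (h₁.fission h0).1)
      have i2 : ∀ a, IsMid r r₂ x' z' y' t' σ σ' a ↔ IsMid r r₂ x' z' x' z' σ σ' a := fun a =>
        IsMid.congr hσ hσ' h₂ h₂' h₂ h₂.symm Iff.rfl (iff_of_false k0' (h₂.fission k0).1)
      have hx : r x x' := by
        -- The condition on feet is tested on the relation whose only nontrivial class is the
        -- `r`-class of x. It contains y and t, so x' and z' are related by it, and being distinct
        -- they lie in that class: both paths add their handle to the same circle.
        let R : Setoid α := ⟨fun p q => p = q ∨ (r p x ∧ r q x), fun p => Or.inl rfl,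
          fun {p q} h => h.elim (fun h => Or.inl h.symm) fun h => Or.inr h.symm,
          fun {p q u} h h' => by
            rcases h with rfl | h
            · exact h'
            · rcases h' with rfl | h'
              · exact Or.inr h
              · exact Or.inr ⟨h.1, h'.2⟩⟩
        have hle : ∀ {p q : α}, r₁ p q → r p q := h₁.symm.le (h₁.fission h0).1
        have j1 : r y x ∧ r t x := by
          rcases ((h₁.fission h0).2 y t).1 e1 with j | ⟨j, j'⟩ | ⟨j, j'⟩
          · exact absurd j h0'
          · exact ⟨hle j, r.trans (r.symm (hle j')) (r.symm h0)⟩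
          · exact ⟨r.trans (hle j) (r.symm h0), r.symm (hle j')⟩
        rcases (hf.fst R (Or.inr ⟨r.refl x, r.symm h0⟩)).1 (Or.inr j1) with j | j
        · exact absurd (j ▸ r₂.refl x') (h₂.fission k0).1
        · exact r.symm j.1
      · have i3 : (σ x = .plus ∧ σ' x = .minus ∧ ∀ p, ¬ r p x → σ' p = σ p) ↔
            (σ x' = .plus ∧ σ' x' = .minus ∧ ∀ p, ¬ r p x' → σ' p = σ p) := by
          rw [hσ x x' hx, hσ' x x' hx]
          have : ∀ p, r p x ↔ r p x' := fun p =>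
            ⟨fun h => r.trans h hx, fun h => r.trans h (r.symm hx)⟩
          simp only [this]
        exact ⟨(Equiv.subtypeEquivRight i1).trans (q1.trans ((Equiv.subtypeEquivRight
          fun _ => i3).trans (q2.symm.trans (Equiv.subtypeEquivRight i2).symm)))⟩
    · -- a division and a merge
      have k0' : r₂ y' t' := by_contra fun h =>
        (hf.symm.merge_merge h₂ h₂' h₁ h₁' k0 h).1 h0
      obtain ⟨e⟩ := nonempty_isMid_equiv_frobenius hf.symm h₂ h₂' h₁ h₁' hσ hσ' k0 k0' h0 h0'
      exact ⟨e.symm⟩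
  · by_cases k0 : r x' z'
    · have k0' : ¬ r₂ y' t' := fun h =>
        h0 (hf.symm.fission_fission h₂ h₂' h₁ h₁' k0 h).1
      exact nonempty_isMid_equiv_frobenius hf h₁ h₁' h₂ h₂' hσ hσ' h0 h0' k0 k0'
    · -- a merge and a division, with the same partition in the middle
      have k0' : r₂ y' t' := by_contra fun h =>
        (hf.symm.merge_merge h₂ h₂' h₁ h₁' k0 h).2 h0'
      have e2 : r₁ x z := h₁.rel_merge h0
      have e1 : r₁ x' z' := (hf.fst r₁ e2).1 h0'
      have e3 : r₂ x' z' := h₂.rel_merge k0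
      have e4 : r₂ x z := (hf.snd r₂ e3).1 k0'
      have : r₁ = r₂ := setoid_eq_of_merge (h₁.merge h0) (fun p q => h₂.le k0) e4
        fun p q h => ((h₂.merge k0 p q).1 h).le (fun p q => h₁.le h0) e1
      subst this
      exact ⟨Equiv.subtypeEquivRight fun a => IsMid.congr hσ hσ' h₁ h₁' h₂ h₂'
        (iff_of_false h0 k0) (iff_of_true h0' k0')⟩
  · obtain ⟨k0, k0'⟩ := hf.merge_merge h₁ h₁' h₂ h₂' h0 h0'
    refine nonempty_equiv_of_subsingleton (fun a b => IsMid.unique_of_merge hσ h₁ h0)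
      (fun a b => IsMid.unique_of_merge hσ h₂ k0) ?_
    rw [exists_isMid_iff_of_merge_merge h₁ h0 h₁' h0' hσ hσ',
      exists_isMid_iff_of_merge_merge h₂ k0 h₂' k0' hσ hσ']

end Squares

/-! ### Classification of two successive surgeries -/

section TwoSurgeries

variable {n : ℕ} {M M₁ M₂ M' : PlanarMatching n} {x z y u p q r s : Fin (2 * n)}

namespace PlanarMatching

/-- Seen from an even point only the inner transposition acts, because the mate is odd and the outer
one moves even points only. Hence successive surgeries multiply transpositions. -/
theorem Surgery.mate_of_even (h : Surgery M M₁ x z) (hp : Even p.val) :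
    M₁.mate p = M.mate (Equiv.swap x z p) := by
  have h1 : Even (Equiv.swap x z p).val := by
    rw [Equiv.swap_apply_def]; split_ifs
    exacts [h.even_right, h.even_left, hp]
  rw [h.mate]
  exact Equiv.swap_apply_of_ne_of_ne (ne_mate_of_even h1 h.even_left).symm
    (ne_mate_of_even h1 h.even_right).symm

theorem Surgery.even_swap (h : Surgery M M₁ x z) (hp : Even p.val) :
    Even (Equiv.swap x z p).val := by
  rw [Equiv.swap_apply_def]; split_ifs
  exacts [h.even_right, h.even_left, hp]

theorem Surgery.swap_of_odd (h : Surgery M M₁ x z) (hp : ¬ Even p.val) :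
    Equiv.swap x z p = p :=
  Equiv.swap_apply_of_ne_of_ne (by rintro rfl; exact hp h.even_left)
    (by rintro rfl; exact hp h.even_right)

theorem Surgery.feet_unique (h : Surgery M M₁ x z) (h' : Surgery M M₁ p q) :
    (p = x ∧ q = z) ∨ (p = z ∧ q = x) := by
  have h1 := h.mate_left
  rw [h'.mate_of_even h.even_left] at h1
  have h2 := M.mate_injective h1
  have := h.ne
  rw [Equiv.swap_apply_def] at h2
  grind

/-- Both products describe, relative to the injective involution of `M`, the involution of the same
`M'` on even points, and both are trivial on odd points. -/
theorem Surgery.swap_swap_eq (h₁ : Surgery M M₁ x z) (h₁' : Surgery M₁ M' y u)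
    (h₂ : Surgery M M₂ p q) (h₂' : Surgery M₂ M' r s) (a : Fin (2 * n)) :
    Equiv.swap x z (Equiv.swap y u a) = Equiv.swap p q (Equiv.swap r s a) := by
  by_cases ha : Even a.val
  · apply M.mate_injective
    rw [← h₁.mate_of_even (h₁'.even_swap ha), ← h₁'.mate_of_even ha,
      ← h₂.mate_of_even (h₂'.even_swap ha), ← h₂'.mate_of_even ha]
  · rw [h₁'.swap_of_odd ha, h₁.swap_of_odd ha, h₂'.swap_of_odd ha, h₂.swap_of_odd ha]

/-- A product of two disjoint transpositions has only its two factors as possible first factors, so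
there are at most two middle matchings. -/
theorem swap_swap_disjoint {α : Type*} [DecidableEq α] {x z y u p q r s : α} (h1 : x ≠ z)
    (h2 : x ≠ y) (h3 : x ≠ u) (h4 : z ≠ y) (h5 : z ≠ u) (h6 : y ≠ u) (hpq : p ≠ q)
    (h : ∀ a, Equiv.swap x z (Equiv.swap y u a) = Equiv.swap p q (Equiv.swap r s a)) :
    (p = x ∧ q = z ∨ p = z ∧ q = x) ∨ (p = y ∧ q = u ∨ p = u ∧ q = y) := by
  have a1 := h x
  have a2 := h y
  have a3 := h z
  have a4 := h u
  simp only [Equiv.swap_apply_def] at a1 a2 a3 a4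
  grind

/-- A 3-cycle is a product of two transpositions in three ways; this is the source of the triples.
-/
theorem swap_swap_three {α : Type*} [DecidableEq α] {x z u p q r s : α} (h1 : x ≠ z)
    (h3 : x ≠ u) (h5 : z ≠ u) (hpq : p ≠ q)
    (h : ∀ a, Equiv.swap x z (Equiv.swap x u a) = Equiv.swap p q (Equiv.swap r s a)) :
    (p = x ∧ q = z ∨ p = z ∧ q = x) ∨ (p = x ∧ q = u ∨ p = u ∧ q = x) ∨
      (p = z ∧ q = u ∨ p = u ∧ q = z) := by
  have a1 := h x
  have a2 := h z
  have a4 := h u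
  simp only [Equiv.swap_apply_def] at a1 a2 a4
  grind

theorem Surgery.eq_of_feet (h : Surgery M M₁ x z) (h' : Surgery M M₂ p q)
    (hpq : p = x ∧ q = z ∨ p = z ∧ q = x) : M₂ = M₁ := by
  rcases hpq with ⟨rfl, rfl⟩ | ⟨rfl, rfl⟩
  · exact h'.eq_of_surgery h
  · exact h'.comm.eq_of_surgery h

end PlanarMatching

open PlanarMatching

theorem crosses_of_separates {γ η : Finset (Finset (Fin (2 * n)))} {a b c d : Finset (Fin (2 * n))}
    (h : Disjoint γ η) (ha : a ∈ γ) (hb : b ∈ γ) (hc : c ∈ η) (hd : d ∈ η) (hab : a ≠ b)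
    (hcd : c ≠ d) (hp : p ∈ a) (hq : q ∈ b) (hr : r ∈ c) (hs : s ∈ d) (hrp : r ≠ p) (hrq : r ≠ q)
    (hsp : s ≠ p) (hsq : s ≠ q) (hsep : ¬ (IsUnder {p, q} r ↔ IsUnder {p, q} s)) :
    Crosses γ η := by
  refine ⟨h, ?_⟩
  rw [isUnder_pair, isUnder_pair] at hsep
  have key : (p < r ∧ r < q ∧ (s < p ∨ q < s)) ∨ (q < r ∧ r < p ∧ (s < q ∨ p < s)) ∨
      (p < s ∧ s < q ∧ (r < p ∨ q < r)) ∨ (q < s ∧ s < p ∧ (r < q ∨ p < r)) := by grind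
  rcases key with k | k | k | k
  · exact ⟨a, ha, b, hb, c, hc, d, hd, hab, hcd, p, hp, q, hq, r, hr, s, hs, k⟩
  · exact ⟨b, hb, a, ha, c, hc, d, hd, hab.symm, hcd, q, hq, p, hp, r, hr, s, hs, k⟩
  · exact ⟨a, ha, b, hb, d, hd, c, hc, hab, hcd.symm, p, hp, q, hq, s, hs, r, hr, k⟩
  · exact ⟨b, hb, a, ha, d, hd, c, hc, hab.symm, hcd.symm, q, hq, p, hp, s, hs, r, hr, k⟩

theorem Crosses.exists_separates {γ η : Finset (Finset (Fin (2 * n)))} (h : Crosses γ η) :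
    ∃ a ∈ γ, ∃ b ∈ γ, ∃ c ∈ η, ∃ d ∈ η, a ≠ b ∧ c ≠ d ∧ ∃ p ∈ a, ∃ q ∈ b, ∃ r ∈ c, ∃ s ∈ d,
      ¬ (IsUnder {p, q} r ↔ IsUnder {p, q} s) := by
  obtain ⟨-, a, ha, b, hb, c, hc, d, hd, hab, hcd, p, hp, q, hq, r, hr, s, hs, k⟩ := h
  refine ⟨a, ha, b, hb, c, hc, d, hd, hab, hcd, p, hp, q, hq, r, hr, s, hs, ?_⟩
  rw [isUnder_pair, isUnder_pair]
  grind

/-- `Crosses` allows any ends of the arcs. The triangle rule carries the information from the two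
diagonals, which are the arcs after surgery, to the two other chords. Moving from y to y' and from u
to u' is harmless because these arcs do not separate the ends of the chords. -/
theorem not_separates_of_diagonals {x x' z z' y y' u u' : Fin (2 * n)}
    (hd : ([x, x', z, z', y, y', u, u'] : List (Fin (2 * n))).Nodup)
    (hx : ∀ p ∈ [y, y', u, u'], IsUnder {x, x'} p ↔ IsUnder {x, x'} y)
    (hz : ∀ p ∈ [y, y', u, u'], IsUnder {z, z'} p ↔ IsUnder {z, z'} y)
    (hxz : IsUnder {x, z'} y ↔ IsUnder {x, z'} u) (hzx : IsUnder {z, x'} y ↔ IsUnder {z, x'} u)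
    (hy : ∀ p ∈ [x, x', z, z'], IsUnder {y, y'} p ↔ IsUnder {y, y'} x)
    (hu : ∀ p ∈ [x, x', z, z'], IsUnder {u, u'} p ↔ IsUnder {u, u'} x) :
    ∀ p ∈ [x, x'], ∀ q ∈ [z, z'], ∀ r ∈ [y, y'], ∀ s ∈ [u, u'],
      (IsUnder {p, q} r ↔ IsUnder {p, q} s) := by
  simp only [List.nodup_cons, List.mem_cons, List.not_mem_nil, or_false, not_or] at hd
  obtain ⟨⟨d1, d2, d3, d4, d5, d6, d7⟩, ⟨d8, d9, d10, d11, d12, d13⟩, ⟨d14, d15, d16, d17, d18⟩,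
    ⟨d19, d20, d21, d22⟩, ⟨d23, d24, d25⟩, ⟨d26, d27⟩, d28, -⟩ := hd
  have hyu := hx u (by simp)
  have hyu' := hz u (by simp)
  have t1 : ∀ p ∈ [x, x'], ∀ q ∈ [z, z'], (IsUnder {p, q} y ↔ IsUnder {p, q} u) := by
    have a1 : IsUnder {x, z} y ↔ IsUnder {x, z} u := by
      rw [isUnder_trans (i := x) (j := x') (k := z) (Ne.symm d4) (Ne.symm d10) (Ne.symm d15),
        isUnder_trans (i := x) (j := x') (k := z) (Ne.symm d6) (Ne.symm d12) (Ne.symm d17)]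
      rw [Finset.pair_comm x' z, hzx, hyu]
    have a2 : IsUnder {x', z'} y ↔ IsUnder {x', z'} u := by
      rw [isUnder_trans (i := x') (j := x) (k := z') (Ne.symm d10) (Ne.symm d4) (Ne.symm d19),
        isUnder_trans (i := x') (j := x) (k := z') (Ne.symm d12) (Ne.symm d6) (Ne.symm d21)]
      rw [Finset.pair_comm x' x, hxz, hyu]
    intro p hp q hq
    simp only [List.mem_cons, List.not_mem_nil, or_false] at hp hq
    rcases hp with rfl | rfl <;> rcases hq with rfl | rfl
    · exact a1
    · exact hxz
    · rw [Finset.pair_comm]; exact hzx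
    · exact a2
  intro p hp q hq
  have t2 := t1 p hp q hq
  have hp' : p ∈ [x, x', z, z'] := List.mem_append_left [z, z'] hp
  have hq' : q ∈ [x, x', z, z'] := List.mem_append_right [x, x'] hq
  have k1 := (hy p hp').trans (hy q hq').symm
  have k2 := (hu p hp').trans (hu q hq').symm
  clear hx hz hy hu t1 hp' hq'
  have n1 : p ≠ y ∧ p ≠ y' ∧ p ≠ u ∧ p ≠ u' := by
    rcases List.mem_pair.1 hp with h | h <;> rw [h]
    · exact ⟨d4, d5, d6, d7⟩
    · exact ⟨d10, d11, d12, d13⟩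
  have n2 : q ≠ y ∧ q ≠ y' ∧ q ≠ u ∧ q ≠ u' := by
    rcases List.mem_pair.1 hq with h | h <;> rw [h]
    · exact ⟨d15, d16, d17, d18⟩
    · exact ⟨d19, d20, d21, d22⟩
  have s1 := (separates_symm n1.1.symm n2.1.symm n1.2.1.symm n2.2.1.symm).1 k1
  have s2 := (separates_symm n1.2.2.1.symm n2.2.2.1.symm n1.2.2.2.symm n2.2.2.2.symm).1 k2
  intro r hr s hs
  simp only [List.mem_cons, List.not_mem_nil, or_false] at hr hs
  rcases hr with rfl | rfl <;> rcases hs with rfl | rfl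
  · exact t2
  · exact t2.trans s2
  · exact s1.symm.trans t2
  · exact s1.symm.trans (t2.trans s2)

theorem mem_arcPair_sdiff {c : Finset (Fin (2 * n))} (hx : Even x.val) (hz : Even z.val)
    (hy : Even y.val) (hu : Even u.val) : c ∈ arcPair M y u \ arcPair M x z ↔
      ∃ p, c = {p, M.mate p} ∧ p ≠ x ∧ p ≠ z ∧ (p = y ∨ p = u) := by
  simp only [arcPair, Finset.mem_sdiff, Finset.mem_insert, Finset.mem_singleton]
  constructor
  · rintro ⟨rfl | rfl, h⟩
    · rw [arc_eq_iff_of_even hy hx, arc_eq_iff_of_even hy hz] at h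
      exact ⟨y, rfl, by tauto, by tauto, by tauto⟩
    · rw [arc_eq_iff_of_even hu hx, arc_eq_iff_of_even hu hz] at h
      exact ⟨u, rfl, by tauto, by tauto, by tauto⟩
  · rintro ⟨p, rfl, h1, h2, rfl | rfl⟩
    · rw [arc_eq_iff_of_even hy hx, arc_eq_iff_of_even hy hz]; tauto
    · rw [arc_eq_iff_of_even hu hx, arc_eq_iff_of_even hu hz]; tauto

theorem isImage_arcPair (h : Surgery M M₁ x z) (hy : Even y.val) (hu : Even u.val)
    (hr : Even r.val) (hs : Even s.val)
    (hyu : ∀ p, p ≠ x → p ≠ z → ((p = y ∨ p = u) ↔ (p = r ∨ p = s))) :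
    IsImage M M₁ (arcPair M x z) (arcPair M y u) (arcPair M₁ r s) := by
  rw [IsImage, h.dagger_eq]
  ext c
  rw [mem_arcPair_sdiff h.even_left h.even_right hy hu,
    mem_arcPair_sdiff h.even_left h.even_right hr hs]
  have key : ∀ p, Even p.val → p ≠ x → p ≠ z → M₁.mate p = M.mate p := fun p hp h1 h2 =>
    h.mate_of_ne h1 (ne_mate_of_even h.even_left hp) h2 (ne_mate_of_even h.even_right hp)
  constructor
  · rintro ⟨p, rfl, h1, h2, h3⟩
    have hp : Even p.val := by rcases h3 with rfl | rfl <;> assumption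
    exact ⟨p, by rw [key p hp h1 h2], h1, h2, (hyu p h1 h2).2 h3⟩
  · rintro ⟨p, rfl, h1, h2, h3⟩
    have hp : Even p.val := by rcases h3 with rfl | rfl <;> assumption
    exact ⟨p, by rw [key p hp h1 h2], h1, h2, (hyu p h1 h2).1 h3⟩

/-- The matching `N` lies between two surgeries from `M` to `M'`. -/
def IsMidMatching (M M' N : PlanarMatching n) : Prop :=
  ∃ x z y u, Surgery M N x z ∧ Surgery N M' y u

/-- Data for two different sequences of two surgeries from `M` to `M'`. -/
structure SurgerySquare (M M₁ M₂ M' : PlanarMatching n) (x z y u p q r s : Fin (2 * n)) :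
    Prop where
  fst : Surgery M M₁ x z
  snd : Surgery M₁ M' y u
  fst' : Surgery M M₂ p q
  snd' : Surgery M₂ M' r s
  ne : M₁ ≠ M₂
  feet : SquareFeet x z y u p q r s
  image : IsImage M M₁ (arcPair M x z) (arcPair M p q) (arcPair M₁ y u)
  image' : IsImage M M₂ (arcPair M p q) (arcPair M x z) (arcPair M₂ r s)

theorem squareFeet_disjoint {α : Type*} (x z y u : α) : SquareFeet x z y u y u x z := by
  constructor <;> intro R h <;> simp_all

theorem squareFeet_three {α : Type*} (x z u : α) : SquareFeet x z x u z u x z where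
  fst R h := ⟨fun h' => R.trans (R.symm h) h', fun h' => R.trans h h'⟩
  snd _ _ := Iff.rfl
  thd _ _ := Iff.rfl
  fth R h := ⟨fun h' => R.trans h h', fun h' => R.trans (R.symm h) h'⟩

/-- A sequence of two surgeries in which the second bridge crosses the co-core of the first, or is
disjoint from it. -/
theorem crosses_or_square_of_disjoint (h₁ : Surgery M M₁ x z) (h₂ : Surgery M₁ M' y u)
    (hxy : x ≠ y) (hxu : x ≠ u) (hzy : z ≠ y) (hzu : z ≠ u) :
    (Crosses (arcPair M₁ x z) (arcPair M₁ y u) ∧ ∀ N, IsMidMatching M M' N → N = M₁) ∨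
    ∃ M₂, SurgerySquare M M₁ M₂ M' x z y u y u x z ∧
      ParallelDisjoint (arcPair M x z) (arcPair M y u) ∧
      ∀ N, IsMidMatching M M' N → N = M₁ ∨ N = M₂ := by
  have hx := h₁.even_left
  have hz := h₁.even_right
  have hy := h₂.even_left
  have hu := h₂.even_right
  have hyu := h₂.ne
  have hxz := h₁.ne
  have e1 : M₁.mate y = M.mate y := h₁.mate_of_ne hxy.symm (ne_mate_of_even hx hy) hzy.symm
    (ne_mate_of_even hz hy)
  have e2 : M₁.mate u = M.mate u := h₁.mate_of_ne hxu.symm (ne_mate_of_even hx hu) hzu.symm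
    (ne_mate_of_even hz hu)
  have hd : ∀ {N : PlanarMatching n}, Disjoint (arcPair N x z) (arcPair N y u) := by
    intro N
    rw [Finset.disjoint_left]
    intro c hc hc'
    simp only [arcPair, Finset.mem_insert, Finset.mem_singleton] at hc hc'
    rcases hc with rfl | rfl <;> rcases hc' with hc' | hc' <;>
      rw [arc_eq_iff_of_even (by assumption) (by assumption)] at hc' <;> tauto
  have mids : ∀ N, IsMidMatching M M' N → ∃ p q, Surgery M N p q ∧
      ((p = x ∧ q = z ∨ p = z ∧ q = x) ∨ (p = y ∧ q = u ∨ p = u ∧ q = y)) := by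
    rintro N ⟨p, q, r, s, g1, g2⟩
    exact ⟨p, q, g1, swap_swap_disjoint hxz hxy hxu hzy hzu hyu g1.ne
      (h₁.swap_swap_eq h₂ g1 g2)⟩
  -- The question is whether the second bridge exists already before the first surgery. If so, the
  -- two surgeries can be exchanged.
  by_cases hn : M.Near y u
  · right
    obtain ⟨M₂, g1⟩ := exists_surgery hy hu hyu hn
    have g2 : Surgery M₂ M' x z := by
      refine ⟨hx, hz, hxz, fun a => ?_⟩
      have c : ∀ b, Equiv.swap x z (Equiv.swap y u b) = Equiv.swap y u (Equiv.swap x z b) := by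
        intro b
        simp only [Equiv.swap_apply_def]
        grind
      rw [h₂.mate, h₁.mate, g1.mate, c, c]
    refine ⟨M₂, ⟨h₁, h₂, g1, g2, ?_, squareFeet_disjoint _ _ _ _, ?_, ?_⟩, ?_, ?_⟩
    · rintro rfl
      have := h₁.feet_unique g1
      grind
    · exact isImage_arcPair h₁ hy hu hy hu (by simp)
    · exact isImage_arcPair g1 hx hz hx hz (by simp)
    · refine ⟨⟨fun h => ?_, ?_⟩, hd⟩
      · have h3 : {x, M.mate x} ∈ arcPair M x z := by simp [arcPair]
        rw [h] at h3
        simp only [arcPair, Finset.mem_insert, Finset.mem_singleton,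
          arc_eq_iff_of_even hx hy, arc_eq_iff_of_even hx hu] at h3
        tauto
      · have hz' : ∀ p, p = y ∨ p = M.mate y ∨ p = u ∨ p = M.mate u →
            (p ≠ x ∧ p ≠ M.mate x) ∧ (p ≠ z ∧ p ≠ M.mate z) := by
          have i1 := M.mate_mate x
          have i2 := M.mate_mate y
          have i3 := M.mate_mate z
          have i4 := M.mate_mate u
          have j1 := ne_mate_of_even (M := M) hx hy
          have j2 := ne_mate_of_even (M := M) hx hu
          have j3 := ne_mate_of_even (M := M) hz hy
          have j4 := ne_mate_of_even (M := M) hz hu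
          grind
        have k1 : ∀ w t, w ≠ t → t ≠ M.mate w →
            (IsUnder {w, M.mate w} (M.mate t) ↔ IsUnder {w, M.mate w} t) := fun w t g g' =>
          (not_separates g.symm g').symm
        have l1 : ∀ w, (∀ p, p = y ∨ p = M.mate y ∨ p = u ∨ p = M.mate u → p ≠ w ∧ p ≠ M.mate w) →
            ∀ p ∈ [y, M.mate y, u, M.mate u],
              (IsUnder {w, M.mate w} p ↔ IsUnder {w, M.mate w} y) := by
          intro w hw p hp
          have a1 := k1 w y (hw y (by simp)).1.symm (hw y (by simp)).2
          have a2 := k1 w u (hw u (by simp)).1.symm (hw u (by simp)).2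
          have a3 := hn w (hw y (by simp)).1.symm
            (fun h => (hw (M.mate y) (by simp)).1 h.symm) (hw u (by simp)).1.symm
            (fun h => (hw (M.mate u) (by simp)).1 h.symm)
          simp only [List.mem_cons, List.not_mem_nil, or_false] at hp
          rcases hp with rfl | rfl | rfl | rfl
          exacts [Iff.rfl, a1, a3.symm, a2.trans a3.symm]
        have l2 : ∀ w, w = y ∨ w = u → ∀ p ∈ [x, M.mate x, z, M.mate z],
              (IsUnder {w, M.mate w} p ↔ IsUnder {w, M.mate w} x) := by
          intro w hw p hp
          obtain ⟨⟨b1, b2⟩, b3, b4⟩ := hz' w (by tauto)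
          obtain ⟨⟨b5, -⟩, b6, -⟩ := hz' (M.mate w) (by rcases hw with rfl | rfl <;> simp)
          have a1 := k1 w x b1 b5.symm
          have a2 := k1 w z b3 b6.symm
          have a3 := h₁.near w b1 b2 b3 b4
          simp only [List.mem_cons, List.not_mem_nil, or_false] at hp
          rcases hp with rfl | rfl | rfl | rfl
          exacts [Iff.rfl, a1, a3.symm, a2.trans a3.symm]
        -- In `M₁` the arcs at x and z are the two diagonals, and they do not separate y from u
        -- because the second bridge exists in `M₁`.
        have o1 := h₂.near x hxy (by rw [e1]; exact fun h => (hz' (M.mate y) (by simp)).1.1 h.symm)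
          hxu (by rw [e2]; exact fun h => (hz' (M.mate u) (by simp)).1.1 h.symm)
        have o2 := h₂.near z hzy (by rw [e1]; exact fun h => (hz' (M.mate y) (by simp)).2.1 h.symm)
          hzu (by rw [e2]; exact fun h => (hz' (M.mate u) (by simp)).2.1 h.symm)
        rw [h₁.mate_left] at o1
        rw [h₁.mate_right] at o2
        have key := not_separates_of_diagonals (x := x) (x' := M.mate x) (z := z)
          (z' := M.mate z) (y := y) (y' := M.mate y) (u := u) (u' := M.mate u) ?_
          (l1 x fun p hp => (hz' p hp).1) (l1 z fun p hp => (hz' p hp).2) o1 o2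
          (l2 y (Or.inl rfl)) (l2 u (Or.inr rfl))
        · intro hc
          obtain ⟨a, ha, b, hb, c, hc, d, hd, hab, hcd, p, hp, q, hq, r, hr, s, hs, k⟩ :=
            hc.exists_separates
          apply k
          simp only [List.mem_cons, List.not_mem_nil, or_false] at key
          simp only [arcPair, Finset.mem_insert, Finset.mem_singleton] at ha hb hc hd
          rcases ha with rfl | rfl <;> rcases hb with rfl | rfl <;> rcases hc with rfl | rfl <;>
            rcases hd with rfl | rfl <;>
            simp only [ne_eq, not_true_eq_false, Finset.mem_insert, Finset.mem_singleton]
              at hab hcd hp hq hr hs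
          · exact key p hp q hq r hr s hs
          · exact (key p hp q hq s hs r hr).symm
          · rw [Finset.pair_comm]; exact key q hq p hp r hr s hs
          · rw [Finset.pair_comm]; exact (key q hq p hp s hs r hr).symm
        · have j0 := M.ne_mate
          have j1 := ne_mate_of_even (M := M) hx hz
          have j2 := ne_mate_of_even (M := M) hz hx
          have j3 := ne_mate_of_even (M := M) hy hu
          have j4 := ne_mate_of_even (M := M) hu hy
          have j5 : M.mate x ≠ M.mate z := fun h => hxz (M.mate_injective h)
          have j6 : M.mate y ≠ M.mate u := fun h => hyu (M.mate_injective h)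
          have q1 := hz' y (by simp)
          have q2 := hz' u (by simp)
          have q3 := hz' (M.mate y) (by simp)
          have q4 := hz' (M.mate u) (by simp)
          have j1 := j0 x
          have j2 := j0 y
          have j3 := j0 z
          have j4 := j0 u
          clear j0
          simp only [List.nodup_cons, List.mem_cons, List.not_mem_nil, or_false, not_or]
          grind
    · intro N hN
      obtain ⟨p, q, k1, k2⟩ := mids N hN
      rcases k2 with k2 | k2
      · exact Or.inl (h₁.eq_of_feet k1 k2)
      · exact Or.inr (g1.eq_of_feet k1 k2)
  -- Some arc of `M` separates y from u. All arcs except those at x and z survive in `M₁`, so it is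
  -- one of these two. Its ends lie on the two arcs of the co-core, whence the crossing. The
  -- opposite order of surgeries is impossible, since it would need `M.Near y u`.
  · left
    refine ⟨?_, fun N hN => ?_⟩
    · have hne : ({x, M₁.mate x} : Finset (Fin (2 * n))) ≠ {z, M₁.mate z} :=
        fun h => hxz ((arc_eq_iff_of_even hx hz).1 h)
      have hne' : ({y, M₁.mate y} : Finset (Fin (2 * n))) ≠ {u, M₁.mate u} :=
        fun h => hyu ((arc_eq_iff_of_even hy hu).1 h)
      have key : ∀ w, w = x ∨ w = z → ¬ (IsUnder {w, M.mate w} y ↔ IsUnder {w, M.mate w} u) →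
          Crosses (arcPair M₁ x z) (arcPair M₁ y u) := by
        intro w hw hsep
        have j1 := ne_mate_of_even (M := M) hx hy
        have j2 := ne_mate_of_even (M := M) hx hu
        have j3 := ne_mate_of_even (M := M) hz hy
        have j4 := ne_mate_of_even (M := M) hz hu
        rcases hw with rfl | rfl
        · exact crosses_of_separates hd (Finset.mem_insert_self _ _)
            (Finset.mem_insert_of_mem (Finset.mem_singleton_self _)) (Finset.mem_insert_self _ _)
            (Finset.mem_insert_of_mem (Finset.mem_singleton_self _)) hne hne' (by simp)
            (by rw [h₁.mate_right]; simp) (by simp) (by simp) hxy.symm j1 hxu.symm j2 hsep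
        · exact crosses_of_separates hd (Finset.mem_insert_of_mem (Finset.mem_singleton_self _))
            (Finset.mem_insert_self _ _) (Finset.mem_insert_self _ _)
            (Finset.mem_insert_of_mem (Finset.mem_singleton_self _)) hne.symm hne' (by simp)
            (by rw [h₁.mate_left]; simp) (by simp) (by simp) hzy.symm j3 hzu.symm j4 hsep
      by_contra hcr
      apply hn
      intro w w1 w2 w3 w4
      by_contra hsep
      by_cases c1 : w = x
      · subst c1; exact hcr (key w (Or.inl rfl) hsep)
      by_cases c2 : w = z
      · subst c2; exact hcr (key w (Or.inr rfl) hsep)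
      by_cases c3 : w = M.mate x
      · subst c3
        rw [mate_mate, Finset.pair_comm] at hsep
        exact hcr (key x (Or.inl rfl) hsep)
      by_cases c4 : w = M.mate z
      · subst c4
        rw [mate_mate, Finset.pair_comm] at hsep
        exact hcr (key z (Or.inr rfl) hsep)
      have := h₂.near w w1 (by rwa [e1]) w3 (by rwa [e2])
      rw [h₁.mate_of_ne c1 c3 c2 c4] at this
      exact hsep this
    · obtain ⟨p, q, k1, k2⟩ := mids N hN
      rcases k2 with k2 | k2
      · exact h₁.eq_of_feet k1 k2
      · exfalso
        rcases k2 with ⟨rfl, rfl⟩ | ⟨rfl, rfl⟩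
        · exact hn k1.near
        · exact hn k1.comm.near

/-- Of three disjoint arcs at most one can lie between the other two. -/
theorem separates_of_separates {x x' y y' z z' : Fin (2 * n)}
    (d : ([x, x', y, y', z, z'] : List (Fin (2 * n))).Nodup)
    (h1 : IsUnder {x, x'} y ↔ IsUnder {x, x'} y')
    (h3 : IsUnder {y, y'} z ↔ IsUnder {y, y'} z') (k1 : ¬ (IsUnder {x, x'} y ↔ IsUnder {x, x'} z)) :
    IsUnder {y, y'} x ↔ IsUnder {y, y'} z := by
  by_contra k2
  rw [isUnder_pair, isUnder_pair] at h1 h3 k1 k2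
  simp only [List.nodup_cons, List.mem_cons, List.not_mem_nil, or_false, not_or] at d
  grind

theorem under_arc_iff (hx : Even x.val) (hz : Even z.val) (hxz : x ≠ z) (hp : p ∈ ({z, M.mate z} : Finset _)) :
    IsUnder {x, M.mate x} p ↔ IsUnder {x, M.mate x} z := by
  simp only [Finset.mem_insert, Finset.mem_singleton] at hp
  rcases hp with rfl | rfl
  · rfl
  · exact (not_separates hxz.symm (ne_mate_of_even hx hz)).symm

theorem sameSideOf_or_oppositeSidesOf (hx : Even x.val) (hz : Even z.val) (hu : Even u.val)
    (hxz : x ≠ z) (hxu : x ≠ u) :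
    ((IsUnder {x, M.mate x} z ↔ IsUnder {x, M.mate x} u) →
      SameSideOf {x, M.mate x} {z, M.mate z} {u, M.mate u}) ∧
    (¬ (IsUnder {x, M.mate x} z ↔ IsUnder {x, M.mate x} u) →
      OppositeSidesOf {x, M.mate x} {z, M.mate z} {u, M.mate u}) := by
  constructor <;> intro h p hp q hq <;> rwa [under_arc_iff hx hz hxz hp, under_arc_iff hx hu hxu hq]

/-- A sequence of two surgeries whose bridges share a foot. -/
theorem square_or_triple (h₁ : Surgery M M₁ x z) (h₂ : Surgery M₁ M' x u) (hzu : z ≠ u) :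
    (∃ M₂ p q r s, SurgerySquare M M₁ M₂ M' x z x u p q r s ∧
      ParallelOpposite (arcPair M x z) (arcPair M p q) ∧
      ∀ N, IsMidMatching M M' N → N = M₁ ∨ N = M₂) ∨
    ∃ M₂ M₃, SurgerySquare M M₁ M₂ M' x z x u z u x z ∧
      SurgerySquare M M₁ M₃ M' x z x u x u z u ∧ M₂ ≠ M₃ ∧
      ParallelSame (arcPair M x z) (arcPair M z u) ∧
      arcPair M x u = (arcPair M x z \ arcPair M z u) ∪ (arcPair M z u \ arcPair M x z) ∧
      ∀ N, IsMidMatching M M' N → N = M₁ ∨ N = M₂ ∨ N = M₃ := by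
  have hx := h₁.even_left
  have hz := h₁.even_right
  have hu := h₂.even_right
  have hxz := h₁.ne
  have hxu := h₂.ne
  have mids : ∀ N, IsMidMatching M M' N → ∃ p q, Surgery M N p q ∧
      ((p = x ∧ q = z ∨ p = z ∧ q = x) ∨ (p = x ∧ q = u ∨ p = u ∧ q = x) ∨
      (p = z ∧ q = u ∨ p = u ∧ q = z)) := by
    rintro N ⟨p, q, r, s, g1, g2⟩
    exact ⟨p, q, g1, swap_swap_three hxz hxu hzu g1.ne (h₁.swap_swap_eq h₂ g1 g2)⟩
  -- An arc away from x, z and u survives the first surgery, and separates none of these points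
  -- because both bridges exist. So the existence of a bridge between z and u in `M` is decided by
  -- the arc at x alone, and that of a bridge between x and u by the arc at z alone.
  have rest : ∀ w, w ≠ x → w ≠ z → w ≠ u → w ≠ M.mate x → w ≠ M.mate z → w ≠ M.mate u →
      (IsUnder {w, M.mate w} x ↔ IsUnder {w, M.mate w} z) ∧
      (IsUnder {w, M.mate w} x ↔ IsUnder {w, M.mate w} u) := by
    intro w w1 w2 w3 w4 w5 w6
    refine ⟨h₁.near w w1 w4 w2 w5, ?_⟩
    have := h₂.near w w1 (by rwa [h₁.mate_left]) w3
      (by rwa [h₁.mate_of_ne hxu.symm (ne_mate_of_even hx hu) hzu.symm (ne_mate_of_even hz hu)])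
    rwa [h₁.mate_of_ne w1 w4 w2 w5] at this
  have near₂ : (IsUnder {x, M.mate x} z ↔ IsUnder {x, M.mate x} u) → M.Near z u := by
    intro h w w1 w2 w3 w4
    by_cases c1 : w = x
    · rwa [c1]
    by_cases c2 : w = M.mate x
    · rwa [c2, mate_mate, Finset.pair_comm]
    · obtain ⟨a, b⟩ := rest w c1 w1 w3 c2 w2 w4
      exact a.symm.trans b
  have near₃ : (IsUnder {z, M.mate z} x ↔ IsUnder {z, M.mate z} u) → M.Near x u := by
    intro h w w1 w2 w3 w4
    by_cases c1 : w = z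
    · rwa [c1]
    by_cases c2 : w = M.mate z
    · rwa [c2, mate_mate, Finset.pair_comm]
    · exact (rest w w1 c1 w3 w2 c2 w4).2
  have not_near₂ : M.Near z u → (IsUnder {x, M.mate x} z ↔ IsUnder {x, M.mate x} u) := fun h =>
    h x hxz (ne_mate_of_even hz hx) hxu (ne_mate_of_even hu hx)
  have not_near₃ : M.Near x u → (IsUnder {z, M.mate z} x ↔ IsUnder {z, M.mate z} u) := fun h =>
    h z hxz.symm (ne_mate_of_even hx hz) hzu (ne_mate_of_even hu hz)
  have sq₂ : (IsUnder {x, M.mate x} z ↔ IsUnder {x, M.mate x} u) →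
      ∃ M₂, SurgerySquare M M₁ M₂ M' x z x u z u x z := by
    intro h
    obtain ⟨M₂, g1⟩ := exists_surgery hz hu hzu (near₂ h)
    have g2 : Surgery M₂ M' x z := by
      refine ⟨hx, hz, hxz, fun a => ?_⟩
      have c : ∀ b, Equiv.swap x u (Equiv.swap x z b) = Equiv.swap x z (Equiv.swap z u b) := by
        intro b
        simp only [Equiv.swap_apply_def]
        grind
      have c' : ∀ b, Equiv.swap x z (Equiv.swap x u b) = Equiv.swap z u (Equiv.swap x z b) := by
        intro b
        simp only [Equiv.swap_apply_def]
        grind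
      rw [h₂.mate, h₁.mate, g1.mate, c, c']
    refine ⟨M₂, h₁, h₂, g1, g2, ?_, squareFeet_three _ _ _, ?_, ?_⟩
    · rintro rfl
      have := h₁.feet_unique g1
      grind
    · exact isImage_arcPair h₁ hz hu hx hu (by grind)
    · exact isImage_arcPair g1 hx hz hx hz (by grind)
  have sq₃ : (IsUnder {z, M.mate z} x ↔ IsUnder {z, M.mate z} u) →
      ∃ M₃, SurgerySquare M M₁ M₃ M' x z x u x u z u := by
    intro h
    obtain ⟨M₃, g1⟩ := exists_surgery hx hu hxu (near₃ h)
    have g2 : Surgery M₃ M' z u := by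
      refine ⟨hz, hu, hzu, fun a => ?_⟩
      have c : ∀ b, Equiv.swap x u (Equiv.swap x z b) = Equiv.swap z u (Equiv.swap x u b) := by
        intro b
        simp only [Equiv.swap_apply_def]
        grind
      have c' : ∀ b, Equiv.swap x z (Equiv.swap x u b) = Equiv.swap x u (Equiv.swap z u b) := by
        intro b
        simp only [Equiv.swap_apply_def]
        grind
      rw [h₂.mate, h₁.mate, g1.mate, c, c']
    refine ⟨M₃, h₁, h₂, g1, g2, ?_, ?_, ?_, ?_⟩
    · rintro rfl
      have := h₁.feet_unique g1
      grind
    · exact ⟨fun _ _ => Iff.rfl, fun R h => ⟨fun h' => R.trans h (R.symm h'),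
        fun h' => R.trans (R.symm h') h⟩, fun R h => ⟨fun h' => R.trans (R.symm h') h,
        fun h' => R.trans h (R.symm h')⟩, fun _ _ => Iff.rfl⟩
    · exact isImage_arcPair h₁ hx hu hx hu (by grind)
    · exact isImage_arcPair g1 hx hz hz hu (by grind)
  have nex : ({x, M.mate x} : Finset (Fin (2 * n))) ≠ {z, M.mate z} :=
    fun h => hxz ((arc_eq_iff_of_even hx hz).1 h)
  have neu : ({x, M.mate x} : Finset (Fin (2 * n))) ≠ {u, M.mate u} :=
    fun h => hxu ((arc_eq_iff_of_even hx hu).1 h)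
  have nez : ({z, M.mate z} : Finset (Fin (2 * n))) ≠ {u, M.mate u} :=
    fun h => hzu ((arc_eq_iff_of_even hz hu).1 h)
  -- If neither the arc at x nor that at z lies between the two others, all three bridges exist and
  -- form a triple. If one of them does, it is the only one, and the two remaining bridges lie on
  -- opposite sides of it.
  by_cases c₂ : IsUnder {x, M.mate x} z ↔ IsUnder {x, M.mate x} u
  · obtain ⟨M₂, g₂⟩ := sq₂ c₂
    by_cases c₃ : IsUnder {z, M.mate z} x ↔ IsUnder {z, M.mate z} u
    · obtain ⟨M₃, g₃⟩ := sq₃ c₃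
      right
      refine ⟨M₂, M₃, g₂, g₃, ?_, ?_, ?_, ?_⟩
      · rintro rfl
        have := g₂.fst'.feet_unique g₃.fst'
        grind
      · exact ⟨_, _, _, nex.symm, nez, neu, arcPair_comm _ _ _, rfl,
          (sameSideOf_or_oppositeSidesOf hz hx hu hxz.symm hzu).1 c₃⟩
      · simp only [arcPair]
        ext c
        simp only [Finset.mem_insert, Finset.mem_singleton, Finset.mem_union, Finset.mem_sdiff]
        clear * - nex neu nez
        grind
      · intro N hN
        obtain ⟨p, q, k1, k2⟩ := mids N hN
        rcases k2 with k2 | k2 | k2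
        · exact Or.inl (h₁.eq_of_feet k1 k2)
        · exact Or.inr (Or.inr (g₃.fst'.eq_of_feet k1 k2))
        · exact Or.inr (Or.inl (g₂.fst'.eq_of_feet k1 k2))
    · left
      refine ⟨M₂, z, u, x, z, g₂, ?_, ?_⟩
      · exact ⟨_, _, _, nex.symm, nez, neu, arcPair_comm _ _ _, rfl,
          (sameSideOf_or_oppositeSidesOf hz hx hu hxz.symm hzu).2 c₃⟩
      · intro N hN
        obtain ⟨p, q, k1, k2⟩ := mids N hN
        rcases k2 with k2 | k2 | k2
        · exact Or.inl (h₁.eq_of_feet k1 k2)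
        · exfalso
          rcases k2 with ⟨rfl, rfl⟩ | ⟨rfl, rfl⟩
          exacts [c₃ (not_near₃ k1.near), c₃ (not_near₃ k1.comm.near)]
        · exact Or.inr (g₂.fst'.eq_of_feet k1 k2)
  · have c₃ : IsUnder {z, M.mate z} x ↔ IsUnder {z, M.mate z} u := by
      refine separates_of_separates ?_ (not_separates hxz.symm (ne_mate_of_even hx hz))
        (not_separates hzu.symm (ne_mate_of_even hz hu)) c₂
      have j1 := ne_mate_of_even (M := M) hx hz
      have j2 := ne_mate_of_even (M := M) hz hx
      have j3 := ne_mate_of_even (M := M) hx hu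
      have j4 := ne_mate_of_even (M := M) hu hx
      have j5 := ne_mate_of_even (M := M) hz hu
      have j6 := ne_mate_of_even (M := M) hu hz
      have i1 := M.ne_mate x
      have i2 := M.ne_mate z
      have i3 := M.ne_mate u
      have i4 : M.mate x ≠ M.mate z := fun h => hxz (M.mate_injective h)
      have i5 : M.mate x ≠ M.mate u := fun h => hxu (M.mate_injective h)
      have i6 : M.mate z ≠ M.mate u := fun h => hzu (M.mate_injective h)
      clear * - hxz hxu hzu j1 j2 j3 j4 j5 j6 i1 i2 i3 i4 i5 i6
      simp only [List.nodup_cons, List.mem_cons, List.not_mem_nil, or_false, not_or]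
      grind
    obtain ⟨M₃, g₃⟩ := sq₃ c₃
    left
    refine ⟨M₃, x, u, z, u, g₃, ?_, ?_⟩
    · exact ⟨_, _, _, nex, neu, nez, rfl, rfl,
        (sameSideOf_or_oppositeSidesOf hx hz hu hxz hxu).2 c₂⟩
    · intro N hN
      obtain ⟨p, q, k1, k2⟩ := mids N hN
      rcases k2 with k2 | k2 | k2
      · exact Or.inl (h₁.eq_of_feet k1 k2)
      · exact Or.inr (g₃.fst'.eq_of_feet k1 k2)
      · exfalso
        rcases k2 with ⟨rfl, rfl⟩ | ⟨rfl, rfl⟩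
        exacts [c₂ (not_near₂ k1.near), c₂ (not_near₂ k1.comm.near)]

/-- Two surgeries between different matchings. -/
inductive TwoSurgeries (M M₁ M' : PlanarMatching n) (x z y u : Fin (2 * n)) : Prop
  | crossing (cross : Crosses (dagger M M₁) (arcPair M₁ y u))
      (mids : ∀ N, IsMidMatching M M' N → N = M₁)
  | square (M₂ : PlanarMatching n) (p q r s : Fin (2 * n))
      (square : SurgerySquare M M₁ M₂ M' x z y u p q r s)
      (par : ParallelDisjoint (arcPair M x z) (arcPair M p q) ∨
        ParallelOpposite (arcPair M x z) (arcPair M p q))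
      (mids : ∀ N, IsMidMatching M M' N → N = M₁ ∨ N = M₂)
  | triple (M₂ M₃ : PlanarMatching n) (p q r s p' q' r' s' : Fin (2 * n))
      (square : SurgerySquare M M₁ M₂ M' x z y u p q r s)
      (square' : SurgerySquare M M₁ M₃ M' x z y u p' q' r' s')
      (ne : M₂ ≠ M₃)
      (par : ParallelSame (arcPair M x z) (arcPair M p q))
      (slide : arcPair M p' q' =
        (arcPair M x z \ arcPair M p q) ∪ (arcPair M p q \ arcPair M x z))
      (mids : ∀ N, IsMidMatching M M' N → N = M₁ ∨ N = M₂ ∨ N = M₃)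

theorem exists_twoSurgeries (h : IsMidMatching M M' M₁) (hne : M ≠ M') :
    ∃ x z y u, Surgery M M₁ x z ∧ Surgery M₁ M' y u ∧ TwoSurgeries M M₁ M' x z y u := by
  obtain ⟨x, z, y, u, h₁, h₂⟩ := h
  have key : ∀ {x z u : Fin (2 * n)}, Surgery M M₁ x z → Surgery M₁ M' x u →
      ∃ x z y u, Surgery M M₁ x z ∧ Surgery M₁ M' y u ∧ TwoSurgeries M M₁ M' x z y u := by
    intro x z u h₁ h₂
    -- Sharing both feet would make the second surgery undo the first.
    have hzu : z ≠ u := by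
      rintro rfl
      exact hne (h₁.symm.eq_of_surgery h₂)
    refine ⟨x, z, x, u, h₁, h₂, ?_⟩
    rcases square_or_triple h₁ h₂ hzu with ⟨M₂, p, q, r, s, h, h', h''⟩ |
      ⟨M₂, M₃, h, h', a, b, c, d⟩
    · exact .square M₂ p q r s h (Or.inr h') h''
    · exact .triple M₂ M₃ _ _ _ _ _ _ _ _ h h' a b c d
  by_cases hxy : x = y
  · subst hxy; exact key h₁ h₂
  by_cases hxu : x = u
  · subst hxu; exact key h₁ h₂.comm
  by_cases hzy : z = y
  · subst hzy; exact key h₁.comm h₂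
  by_cases hzu : z = u
  · subst hzu; exact key h₁.comm h₂.comm
  refine ⟨x, z, y, u, h₁, h₂, ?_⟩
  rcases crosses_or_square_of_disjoint h₁ h₂ hxy hxu hzy hzu with ⟨h, h'⟩ | ⟨M₂, h, h', h''⟩
  · exact .crossing (by rwa [h₁.dagger_eq]) h'
  · exact .square M₂ y u x z h (Or.inl h') h''

end TwoSurgeries

/-! ### Circles as cycles of a permutation -/

section Circles

/-- Multiplication by a transposition merges two cycles of a permutation. -/
theorem sameCycle_mul_swap_of_not {α : Type*} [DecidableEq α] [Finite α] {π : Equiv.Perm α}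
    {x z : α} (h : ¬ π.SameCycle x z) : (π * Equiv.swap x z).SameCycle x z := by
  -- Under the product the orbit of z follows the orbit of x under `π`, which never meets z, until
  -- it comes back to x.
  have key : ∀ i : ℕ, ((π * Equiv.swap x z) ^ (i + 1)) z = (π ^ (i + 1)) x ∨
      (π * Equiv.swap x z).SameCycle x z := by
    intro i
    induction i with
    | zero => left; simp
    | succ i ih =>
      rcases ih with ih | ih
      · by_cases h1 : (π ^ (i + 1)) x = x
        · right
          exact Equiv.Perm.SameCycle.symm ⟨(i + 1 : ℕ), by rw [zpow_natCast, ih, h1]⟩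
        · left
          have h2 : (π ^ (i + 1)) x ≠ z := fun h2 => h ⟨(i + 1 : ℕ), by rw [zpow_natCast, h2]⟩
          rw [pow_succ', Equiv.Perm.mul_apply, ih, Equiv.Perm.mul_apply,
            Equiv.swap_apply_of_ne_of_ne h1 h2, pow_succ' π (i + 1), Equiv.Perm.mul_apply]
      · exact Or.inr ih
  have h0 := orderOf_pos π
  rcases key (orderOf π - 1) with h1 | h1
  · rw [Nat.sub_add_cancel h0, pow_orderOf_eq_one, Equiv.Perm.one_apply] at h1
    exact Equiv.Perm.SameCycle.symm ⟨(orderOf π : ℕ), by rw [zpow_natCast, h1]⟩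
  · exact h1

/-- Multiplication by a transposition divides a cycle of a permutation. -/
theorem not_sameCycle_mul_swap {α : Type*} [DecidableEq α] [Finite α] {π : Equiv.Perm α}
    {x z : α} (hxz : x ≠ z) (h : π.SameCycle x z) : ¬ (π * Equiv.swap x z).SameCycle x z := by
  have hex : ∃ m : ℕ, 0 < m ∧ (π ^ m) x = z := by
    obtain ⟨m, -, h'⟩ := h.exists_pow_eq'
    exact ⟨m, Nat.pos_of_ne_zero fun h0 => hxz (by rw [← h', h0]; rfl), h'⟩
  classical
  obtain ⟨hm, hmz⟩ := Nat.find_spec hex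
  -- The first time at which the orbit of x reaches z. Under the product z runs through the first m
  -- iterates of x under `π` and closes up at z, and x is not among them.
  set m := Nat.find hex with hdef
  have hmin : ∀ i, 0 < i → i < m → (π ^ i) x ≠ z := fun i h1 h2 h3 =>
    Nat.find_min hex h2 ⟨h1, h3⟩
  have hx : ∀ i, 0 < i → i ≤ m → (π ^ i) x ≠ x := by
    intro i h1 h2 h3
    rcases h2.eq_or_lt with rfl | h2
    · exact hxz (h3.symm.trans hmz)
    · refine hmin (m - i) (by omega) (by omega) ?_
      have : (π ^ (m - i)) ((π ^ i) x) = z := by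
        rw [← Equiv.Perm.mul_apply, ← pow_add, Nat.sub_add_cancel h2.le, hmz]
      rwa [h3] at this
  have key : ∀ i, i < m → ((π * Equiv.swap x z) ^ (i + 1)) z = (π ^ (i + 1)) x := by
    intro i
    induction i with
    | zero => intro _; simp
    | succ i ih =>
      intro hi
      rw [pow_succ', Equiv.Perm.mul_apply, ih (by omega), Equiv.Perm.mul_apply,
        Equiv.swap_apply_of_ne_of_ne (hx _ (by omega) (by omega)) (hmin _ (by omega) hi),
        pow_succ' π (i + 1), Equiv.Perm.mul_apply]
  have hper : ((π * Equiv.swap x z) ^ m) z = z := by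
    have := key (m - 1) (by omega)
    rwa [Nat.sub_add_cancel hm, hmz] at this
  intro hs
  obtain ⟨j, -, hj'⟩ := hs.symm.exists_pow_eq'
  have h1 : ((π * Equiv.swap x z) ^ (j % m)) z = x := by
    have hc : ∀ c : ℕ, (((π * Equiv.swap x z) ^ m) ^ c) z = z := by
      intro c
      induction c with
      | zero => simp
      | succ c ih => rw [pow_succ, Equiv.Perm.mul_apply, hper, ih]
    rwa [← Nat.mod_add_div j m, pow_add, pow_mul, Equiv.Perm.mul_apply, hc] at hj'
  rcases Nat.eq_zero_or_pos (j % m) with h2 | h2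
  · rw [h2, pow_zero, Equiv.Perm.one_apply] at h1
    exact hxz h1.symm
  · have h3 := Nat.mod_lt j hm
    have h4 := key (j % m - 1) (by omega)
    rw [Nat.sub_add_cancel h2, h1] at h4
    exact hx _ h2 h3.le h4.symm

variable {n : ℕ}

namespace CleavedLink

/-- Two marked points are related if they are on the same circle. -/
def setoid (L : CleavedLink n) : Setoid (Fin (2 * n)) :=
  Relation.EqvGen.setoid fun p q => ∃ s, ∃ c ∈ (L.half s).arcs, p ∈ c ∧ q ∈ c

theorem mem_circleAt {L : CleavedLink n} {x y : Fin (2 * n)} :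
    y ∈ L.circleAt x ↔ L.setoid x y := Iff.rfl

theorem circleAt_eq_iff {L : CleavedLink n} {x y : Fin (2 * n)} :
    L.circleAt x = L.circleAt y ↔ L.setoid x y := by
  constructor
  · intro h
    rw [← mem_circleAt, h]
    exact L.setoid.refl y
  · intro h
    ext p
    exact ⟨fun h' => L.setoid.trans (L.setoid.symm h) h', fun h' => L.setoid.trans h h'⟩

theorem setoid_mate (L : CleavedLink n) (s : Side) (x : Fin (2 * n)) :
    L.setoid x ((L.half s).mate x) :=
  Relation.EqvGen.rel _ _ ⟨s, _, (L.half s).mate_mem x, by simp, by simp⟩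

theorem setoid_le {L : CleavedLink n} {R : Setoid (Fin (2 * n))}
    (h : ∀ s x, R x ((L.half s).mate x)) {p q : Fin (2 * n)} (hpq : L.setoid p q) : R p q := by
  refine (Setoid.eqvGen_le (s := R) ?_) hpq
  rintro a b ⟨s, c, hc, ha, hb⟩
  rw [PlanarMatching.eq_arc hc ha, Finset.mem_insert, Finset.mem_singleton] at hb
  rcases hb with rfl | rfl
  · exact R.refl _
  · exact h s a

/-- The other side. -/
def _root_.CleavedLinks.Side.other : Side → Side
  | .left => .right
  | .right => .left

theorem _root_.CleavedLinks.Side.eq_or_eq_other (s t : Side) : t = s ∨ t = s.other := by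
  cases s <;> cases t <;> simp [Side.other]

theorem _root_.CleavedLinks.Side.other_ne (s : Side) : s.other ≠ s := by
  cases s <;> simp [Side.other]

/-- The permutation which follows the circles along an arc at `s` and an arc on the other side. -/
noncomputable def walk (L : CleavedLink n) (s : Side) : Equiv.Perm (Fin (2 * n)) :=
  Function.Involutive.toPerm _ (L.half s.other).mate_mate *
    Function.Involutive.toPerm _ (L.half s).mate_mate

theorem walk_apply (L : CleavedLink n) (s : Side) (x : Fin (2 * n)) :
    L.walk s x = (L.half s.other).mate ((L.half s).mate x) := rfl

theorem even_walk {L : CleavedLink n} {s : Side} {x : Fin (2 * n)} :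
    Even (L.walk s x).val ↔ Even x.val := by
  rw [walk_apply, PlanarMatching.even_mate, PlanarMatching.even_mate, not_not]

/-- Following a circle along one arc on each side preserves parity, so the even points of a circle
form one cycle and its odd points another; only the even one is used. -/
theorem setoid_iff_sameCycle {L : CleavedLink n} (s : Side) {x z : Fin (2 * n)} (hx : Even x.val)
    (hz : Even z.val) : L.setoid x z ↔ (L.walk s).SameCycle x z := by
  constructor
  · intro h
    -- Each point is moved to an even one along its arc at s; the relation pulled back along this
    -- map contains all arcs of both sides.
    let e : Fin (2 * n) → Fin (2 * n) := fun p => if Even p.val then p else (L.half s).mate p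
    let R : Setoid (Fin (2 * n)) := Setoid.comap e (Equiv.Perm.SameCycle.setoid (L.walk s))
    have hR : ∀ t p, R p ((L.half t).mate p) := by
      intro t p
      change (L.walk s).SameCycle (e p) (e _)
      rcases Side.eq_or_eq_other s t with rfl | rfl
      · have := (L.half t).even_mate p
        by_cases hp : Even p.val
        · simp only [e, hp, if_true, this, not_true, if_false, PlanarMatching.mate_mate]
          exact Equiv.Perm.SameCycle.refl _ _
        · simp only [e, hp, if_false, this, not_false_eq_true, if_true]
          exact Equiv.Perm.SameCycle.refl _ _
      · have := (L.half s.other).even_mate p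
        by_cases hp : Even p.val
        · simp only [e, hp, if_true, this, not_true, if_false]
          refine Equiv.Perm.SameCycle.symm ⟨1, ?_⟩
          rw [zpow_one, walk_apply, PlanarMatching.mate_mate, PlanarMatching.mate_mate]
        · simp only [e, hp, if_false, this, not_false_eq_true, if_true]
          refine ⟨1, ?_⟩
          rw [zpow_one, walk_apply, PlanarMatching.mate_mate]
    have : (L.walk s).SameCycle (e x) (e z) := setoid_le hR h
    simpa only [e, hx, hz, if_true] using this
  · intro h
    have key : ∀ (i : ℕ) (p), L.setoid p ((L.walk s ^ i) p) := by
      intro i p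
      induction i with
      | zero => exact L.setoid.refl _
      | succ i ih =>
        rw [pow_succ', Equiv.Perm.mul_apply, walk_apply]
        exact L.setoid.trans ih (L.setoid.trans (L.setoid_mate s _) (L.setoid_mate s.other _))
    obtain ⟨i, -, hi⟩ := h.exists_pow_eq'
    rw [← hi]
    exact key i x

end CleavedLink

theorem sameCycle_congr {α : Type*} [Finite α] {π π' : Equiv.Perm α} {P : α → Prop}
    (h : ∀ p, P p → π p = π' p) (hP : ∀ p, P p → P (π p)) {x z : α} (hx : P x)
    (hs : π.SameCycle x z) : π'.SameCycle x z := by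
  have key : ∀ i : ℕ, (π ^ i) x = (π' ^ i) x ∧ P ((π ^ i) x) := by
    intro i
    induction i with
    | zero => exact ⟨rfl, hx⟩
    | succ i ih =>
      rw [pow_succ', pow_succ', Equiv.Perm.mul_apply, Equiv.Perm.mul_apply, ← ih.1, h _ ih.2,
        ← h _ ih.2]
      exact ⟨rfl, hP _ ih.2⟩
  obtain ⟨i, -, hi⟩ := hs.exists_pow_eq'
  exact ⟨i, by rw [zpow_natCast, ← (key i).1, hi]⟩

variable {L L' : CleavedLink n} {s : Side} {x z : Fin (2 * n)}

open PlanarMatching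

/-- On even points surgery multiplies the walk by the transposition of the feet, which changes
whether the feet are in one cycle. This excludes a surgery from one circle to one circle. -/
theorem setoid_iff_not (h : Surgery (L.half s) (L'.half s) x z)
    (ho : L'.half s.other = L.half s.other) : L'.setoid x z ↔ ¬ L.setoid x z := by
  rw [CleavedLink.setoid_iff_sameCycle s h.even_left h.even_right,
    CleavedLink.setoid_iff_sameCycle s h.even_left h.even_right]
  have e : ∀ p, Even p.val → L'.walk s p = (L.walk s * Equiv.swap x z) p := by
    intro p hp
    rw [Equiv.Perm.mul_apply, CleavedLink.walk_apply, CleavedLink.walk_apply, ho,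
      h.mate_of_even hp]
  have : (L'.walk s).SameCycle x z ↔ (L.walk s * Equiv.swap x z).SameCycle x z :=
    ⟨sameCycle_congr e (fun p => CleavedLink.even_walk.2) h.even_left,
      sameCycle_congr (fun p hp => (e p hp).symm)
        (fun p hp => by rw [← e p hp]; exact CleavedLink.even_walk.2 hp) h.even_left⟩
  rw [this]
  exact ⟨fun h1 h2 => not_sameCycle_mul_swap h.ne h2 h1, sameCycle_mul_swap_of_not⟩

/-- The equivalence relation generated by `r` and the pair `x`, `z`. -/
def joinedSetoid {α : Type*} (r : Setoid α) (x z : α) : Setoid α where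
  r := Joined r x z
  iseqv := by
    have s := @r.symm
    have t := @r.trans
    refine ⟨fun p => Or.inl (r.refl p), ?_, ?_⟩
    · rintro p q (h | ⟨h, h'⟩ | ⟨h, h'⟩)
      · exact Or.inl (s h)
      · exact Or.inr (Or.inr ⟨s h', s h⟩)
      · exact Or.inr (Or.inl ⟨s h', s h⟩)
    · rintro p q u (h | ⟨h, h'⟩ | ⟨h, h'⟩) (k | ⟨k, k'⟩ | ⟨k, k'⟩)
      · exact Or.inl (t h k)
      · exact Or.inr (Or.inl ⟨t h k, k'⟩)
      · exact Or.inr (Or.inr ⟨t h k, k'⟩)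
      · exact Or.inr (Or.inl ⟨h, t h' k⟩)
      · exact Or.inr (Or.inl ⟨h, k'⟩)
      · exact Or.inl (t h k')
      · exact Or.inr (Or.inr ⟨h, t h' k⟩)
      · exact Or.inl (t h k')
      · exact Or.inr (Or.inr ⟨h, k'⟩)

theorem joined_of_surgery (h : Surgery (L.half s) (L'.half s) x z)
    (ho : L'.half s.other = L.half s.other) {p q : Fin (2 * n)} (hpq : L'.setoid p q) :
    Joined L.setoid x z p q := by
  refine CleavedLink.setoid_le (R := joinedSetoid L.setoid x z) (fun t p => ?_) hpq
  rcases Side.eq_or_eq_other s t with rfl | rfl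
  · by_cases h1 : p = x
    · subst h1
      rw [h.mate_left]
      exact Or.inr (Or.inl ⟨L.setoid.refl _, L.setoid_mate _ _⟩)
    by_cases h2 : p = z
    · subst h2
      rw [h.mate_right]
      exact Or.inr (Or.inr ⟨L.setoid.refl _, L.setoid_mate _ _⟩)
    by_cases h3 : p = (L.half t).mate x
    · subst h3
      rw [h.mate_mate_left]
      exact Or.inr (Or.inl ⟨L.setoid.symm (L.setoid_mate _ _), L.setoid.refl _⟩)
    by_cases h4 : p = (L.half t).mate z
    · subst h4
      rw [h.mate_mate_right]
      exact Or.inr (Or.inr ⟨L.setoid.symm (L.setoid_mate _ _), L.setoid.refl _⟩)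
    rw [h.mate_of_ne h1 h3 h2 h4]
    exact Or.inl (L.setoid_mate _ _)
  · rw [ho]; exact Or.inl (L.setoid_mate _ _)

/-- Surgery can only join the two circles at the feet. If it does relate the feet, the same bound
for the reversed surgery shows that nothing else changes. A division is a merge read backwards. -/
theorem saddle_of_surgery (h : Surgery (L.half s) (L'.half s) x z)
    (ho : L'.half s.other = L.half s.other) : Saddle L.setoid L'.setoid x z := by
  have key : ∀ {L L' : CleavedLink n}, Surgery (L.half s) (L'.half s) x z →
      L'.half s.other = L.half s.other → ¬ L.setoid x z →
      ∀ p q, L'.setoid p q ↔ Joined L.setoid x z p q := by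
    intro L L' h ho hr p q
    have h1 := (setoid_iff_not h ho).2 hr
    refine ⟨joined_of_surgery h ho, fun h2 => h2.le (fun a b h3 => ?_) h1⟩
    exact (joined_of_surgery h.symm ho.symm h3).le (fun _ _ => id) h1
  refine ⟨key h ho, fun hr => ?_⟩
  have h1 : ¬ L'.setoid x z := fun h2 => (setoid_iff_not h ho).1 h2 hr
  exact ⟨h1, key h.symm ho.symm h1⟩

end Circles

/-! ### Edges of the graph in terms of feet and signs -/

section Edges

variable {n : ℕ}

namespace DecLink

theorem inv_sign (v : DecLink n) : Inv v.link.setoid v.sign := by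
  intro p q h
  have := CleavedLink.circleAt_eq_iff.2 h
  simp only [sign, this]

theorem ext_sign {v w : DecLink n} (h : v.link = w.link) (h' : ∀ p, v.sign p = w.sign p) :
    v = w := by
  obtain ⟨L, d⟩ := v
  obtain ⟨L', d'⟩ := w
  obtain rfl : L = L' := h
  congr 1
  funext ⟨C, x, hx⟩
  subst hx
  exact h' x

/-- The decorated link with given signs at the marked points. -/
noncomputable def ofSign (L : CleavedLink n) (σ : Fin (2 * n) → Sign) : DecLink n :=
  ⟨L, fun C => σ C.2.choose⟩

theorem sign_ofSign {L : CleavedLink n} {σ : Fin (2 * n) → Sign} (h : Inv L.setoid σ) :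
    (ofSign L σ).sign = σ := by
  funext x
  have h1 : L.circleAt x ∈ L.circles := ⟨x, rfl⟩
  exact h _ _ (CleavedLink.circleAt_eq_iff.1 h1.choose_spec)

end DecLink

open PlanarMatching

variable {L : CleavedLink n} {s : Side} {v w : DecLink n} {x z p q : Fin (2 * n)}
  {γ : Finset (Finset (Fin (2 * n)))}

theorem rel_of_mem_ends (h : p ∈ ends (arcPair (L.half s) x z)) :
    L.setoid x p ∨ L.setoid z p := by
  rw [mem_ends_arcPair] at h
  rcases h with rfl | rfl | rfl | rfl
  exacts [Or.inl (L.setoid.refl _), Or.inl (L.setoid_mate _ _), Or.inr (L.setoid.refl _),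
    Or.inr (L.setoid_mate _ _)]

theorem left_mem_ends {M : PlanarMatching n} : x ∈ ends (arcPair M x z) :=
  mem_ends_arcPair.2 (by simp)

theorem right_mem_ends {M : PlanarMatching n} : z ∈ ends (arcPair M x z) :=
  mem_ends_arcPair.2 (by simp)

theorem mem_footCircles {C : Set (Fin (2 * n))} :
    C ∈ L.footCircles (arcPair (L.half s) x z) ↔ C = L.circleAt x ∨ C = L.circleAt z := by
  constructor
  · rintro ⟨p, hp, rfl⟩
    exact (rel_of_mem_ends hp).imp (fun h => (CleavedLink.circleAt_eq_iff.2 h).symm)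
      fun h => (CleavedLink.circleAt_eq_iff.2 h).symm
  · rintro (rfl | rfl)
    · exact ⟨x, left_mem_ends, rfl⟩
    · exact ⟨z, right_mem_ends, rfl⟩

theorem mem_support : p ∈ L.support (arcPair (L.half s) x z) ↔ L.setoid x p ∨ L.setoid z p := by
  constructor
  · rintro ⟨C, hC, hp⟩
    rcases mem_footCircles.1 hC with rfl | rfl
    exacts [Or.inl hp, Or.inr hp]
  · rintro (h | h)
    · exact ⟨_, mem_footCircles.2 (Or.inl rfl), h⟩
    · exact ⟨_, mem_footCircles.2 (Or.inr rfl), h⟩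

theorem isMerge_iff : L.IsMerge (arcPair (L.half s) x z) ↔ ¬ L.setoid x z := by
  constructor
  · rintro ⟨C₁, h₁, C₂, h₂, hne⟩ h
    rw [mem_footCircles, CleavedLink.circleAt_eq_iff.2 h] at h₁ h₂
    rw [or_self] at h₁ h₂
    exact hne (h₁.trans h₂.symm)
  · intro h
    exact ⟨_, mem_footCircles.2 (Or.inl rfl), _, mem_footCircles.2 (Or.inr rfl),
      fun h' => h (CleavedLink.circleAt_eq_iff.1 h')⟩

theorem isFission_iff : L.IsFission (arcPair (L.half s) x z) ↔ L.setoid x z := by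
  constructor
  · intro h
    exact CleavedLink.circleAt_eq_iff.1
      (h _ (mem_footCircles.2 (Or.inl rfl)) _ (mem_footCircles.2 (Or.inr rfl)))
  · intro h C₁ h₁ C₂ h₂
    rw [mem_footCircles, CleavedLink.circleAt_eq_iff.2 h, or_self] at h₁ h₂
    exact h₁.trans h₂.symm

/-- The two vertices are the ends of a bridge edge at `s` with feet at `x` and `z`. -/
structure BridgeStep (s : Side) (x z : Fin (2 * n)) (v w : DecLink n) : Prop where
  surgery : Surgery (v.link.half s) (w.link.half s) x z
  other : w.link.half s.other = v.link.half s.other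
  transition : Transition v.link.setoid x z v.sign w.sign

theorem BridgeStep.saddle (h : BridgeStep s x z v w) : Saddle v.link.setoid w.link.setoid x z :=
  saddle_of_surgery h.surgery h.other

/-- The conditions on an edge range over all ends of the arcs involved; each such end is on the
circle of x or of z, so the signs at these two points suffice. -/
theorem BridgeStep.isBridgeEdge (h : BridgeStep s x z v w) :
    IsBridgeEdge s (arcPair (v.link.half s) x z) v w := by
  have hs := h.saddle
  have hv := v.inv_sign
  have hw := w.inv_sign
  refine ⟨h.surgery.near.isBridge h.surgery.even_left h.surgery.even_right h.surgery.ne,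
    h.surgery.isSurgery, fun t ht => ?_, fun p hp => ?_, ?_, ?_⟩
  · rw [(Side.eq_or_eq_other s t).resolve_left ht, h.other]
  · rw [mem_support, not_or] at hp
    exact h.transition.off p (fun k => hp.1 (v.link.setoid.symm k))
      fun k => hp.2 (v.link.setoid.symm k)
  · intro p hp q hq hpq r hr
    rw [DecLink.dagger, h.surgery.dagger_eq] at hr
    rw [ne_eq, CleavedLink.circleAt_eq_iff] at hpq
    have h0 : ¬ v.link.setoid x z := by
      intro h0
      have k : ∀ {p}, p ∈ ends (arcPair (v.link.half s) x z) → v.link.setoid x p := fun hp =>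
        (rel_of_mem_ends hp).elim id fun h => v.link.setoid.trans h0 h
      exact hpq (v.link.setoid.trans (v.link.setoid.symm (k hp)) (k hq))
    have h1 : w.sign x = w.sign r := (rel_of_mem_ends hr).elim (hw _ _)
      fun k => hw _ _ (w.link.setoid.trans (hs.rel_merge h0) k)
    have h2 := mergeRule_iff.1 (h.transition.merge h0)
    rw [h1] at h2
    rw [mergeRule_iff]
    rcases rel_of_mem_ends hp with hp | hp <;> rcases rel_of_mem_ends hq with hq | hq
    · exact absurd (v.link.setoid.trans (v.link.setoid.symm hp) hq) hpq
    · rwa [← hv _ _ hp, ← hv _ _ hq]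
    · rw [← hv _ _ hp, ← hv _ _ hq]; tauto
    · exact absurd (v.link.setoid.trans (v.link.setoid.symm hp) hq) hpq
  · intro hf p hp q hq hpq r hr
    rw [isFission_iff] at hf
    rw [DecLink.dagger, h.surgery.dagger_eq] at hp hq
    rw [ne_eq, CleavedLink.circleAt_eq_iff] at hpq
    have h1 : v.sign x = v.sign r := (rel_of_mem_ends hr).elim (hv _ _)
      fun k => hv _ _ (v.link.setoid.trans hf k)
    have h2 := fissionRule_iff.1 (h.transition.fission hf)
    rw [h1] at h2
    rw [fissionRule_iff]
    rcases rel_of_mem_ends hp with hp | hp <;> rcases rel_of_mem_ends hq with hq | hq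
    · exact absurd (w.link.setoid.trans (w.link.setoid.symm hp) hq) hpq
    · rwa [← hw _ _ hp, ← hw _ _ hq]
    · rw [← hw _ _ hp, ← hw _ _ hq]; tauto
    · exact absurd (w.link.setoid.trans (w.link.setoid.symm hp) hq) hpq

theorem IsBridgeEdge.exists_bridgeStep (h : IsBridgeEdge s γ v w) :
    ∃ x z, BridgeStep s x z v w ∧ γ = arcPair (v.link.half s) x z := by
  obtain ⟨x, z, hs, rfl⟩ := exists_surgery_of_isSurgery h.bridge h.surgery
  have ho := h.other_half s.other s.other_ne
  have hsad := saddle_of_surgery hs ho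
  refine ⟨x, z, ⟨hs, ho, ?_, ?_, ?_⟩, rfl⟩
  · intro p h1 h2
    refine h.off_support p ?_
    rw [mem_support, not_or]
    exact ⟨fun k => h1 (v.link.setoid.symm k), fun k => h2 (v.link.setoid.symm k)⟩
  · intro h0
    refine h.merge x left_mem_ends z right_mem_ends
      (fun k => h0 (CleavedLink.circleAt_eq_iff.1 k)) x ?_
    rw [DecLink.dagger, hs.dagger_eq]
    exact left_mem_ends
  · intro h0
    refine h.fission (isFission_iff.2 h0) x ?_ z ?_
      (fun k => (hsad.fission h0).1 (CleavedLink.circleAt_eq_iff.1 k)) x left_mem_ends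
    · rw [DecLink.dagger, hs.dagger_eq]
      exact left_mem_ends
    · rw [DecLink.dagger, hs.dagger_eq]
      exact right_mem_ends

theorem BridgeStep.comm (h : BridgeStep s x z v w) : BridgeStep s z x v w :=
  ⟨h.surgery.comm, h.other, h.transition.comm h.saddle v.inv_sign w.inv_sign⟩

theorem IsBridgeEdge.bridgeStep (h : IsBridgeEdge s γ v w)
    (hs : Surgery (v.link.half s) (w.link.half s) x z) : BridgeStep s x z v w := by
  obtain ⟨p, q, h', -⟩ := h.exists_bridgeStep
  rcases h'.surgery.feet_unique hs with ⟨rfl, rfl⟩ | ⟨rfl, rfl⟩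
  exacts [h', h'.comm]

theorem IsBridgeEdge.eq_arcPair (h : IsBridgeEdge s γ v w)
    (hs : Surgery (v.link.half s) (w.link.half s) x z) : γ = arcPair (v.link.half s) x z := by
  obtain ⟨p, q, h', h''⟩ := h.exists_bridgeStep
  rcases h'.surgery.feet_unique hs with ⟨rfl, rfl⟩ | ⟨rfl, rfl⟩
  · exact h''
  · rw [h'', arcPair_comm]

/-- The circle through `x` is a `+` circle of `v`, and `w` is `v` with its sign changed. -/
structure DecStep (x : Fin (2 * n)) (v w : DecLink n) : Prop where
  link_eq : w.link = v.link
  source : v.sign x = .plus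
  target : w.sign x = .minus
  off : ∀ p, ¬ v.link.setoid x p → w.sign p = v.sign p

theorem isDecorationEdge_circleAt : IsDecorationEdge (v.link.circleAt x) v w ↔ DecStep x v w := by
  constructor
  · intro h
    exact ⟨h.link_eq, h.source x (v.link.setoid.refl x), h.target x (v.link.setoid.refl x),
      fun p hp => h.off_support p hp⟩
  · intro h
    refine ⟨⟨x, rfl⟩, h.link_eq, fun p hp => ?_, fun p hp => ?_, fun p hp => h.off p hp⟩
    · rw [← v.inv_sign x p hp, h.source]
    · rw [← w.inv_sign x p (by rw [h.link_eq]; exact hp), h.target]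

theorem IsDecorationEdge.exists_decStep {C : Set (Fin (2 * n))} (h : IsDecorationEdge C v w) :
    ∃ x, DecStep x v w ∧ C = v.link.circleAt x := by
  obtain ⟨x, rfl⟩ := h.circle
  exact ⟨x, isDecorationEdge_circleAt.1 h, rfl⟩

theorem DecStep.congr (h : DecStep x v w) (hp : v.link.setoid x p) : DecStep p v w := by
  rw [← isDecorationEdge_circleAt] at h ⊢
  rwa [← CleavedLink.circleAt_eq_iff.2 hp]

/-- The changed circle is determined by the ends of the edge. -/
theorem DecStep.rel (h : DecStep x v w) (h' : DecStep p v w) : v.link.setoid x p := by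
  by_contra h0
  have := h.off p h0
  rw [h'.source, h'.target] at this
  cases this

theorem IsDecorationEdge.unique {C C' : Set (Fin (2 * n))} (h : IsDecorationEdge C v w)
    (h' : IsDecorationEdge C' v w) : C = C' := by
  obtain ⟨x, hx, rfl⟩ := h.exists_decStep
  obtain ⟨p, hp, rfl⟩ := h'.exists_decStep
  exact CleavedLink.circleAt_eq_iff.2 (hx.rel hp)

/-- With this, a matrix entry does not depend on the choice of a bridge, and sums over paths of
length two can be indexed by the middle vertex. -/
theorem IsBridgeEdge.unique {γ' : Finset (Finset (Fin (2 * n)))} (h : IsBridgeEdge s γ v w)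
    (h' : IsBridgeEdge s γ' v w) : γ = γ' := by
  obtain ⟨x, z, hx, rfl⟩ := h.exists_bridgeStep
  exact (h'.eq_arcPair hx.surgery).symm

end Edges

/-! ### Comparing finite sums along a bijection of supports -/

section Sums

theorem sum_eq_sum_subtype {ι M : Type*} [Fintype ι] [AddCommMonoid M] (P : ι → Prop)
    [DecidablePred P] (f : ι → M) (hf : ∀ a, ¬ P a → f a = 0) :
    ∑ a, f a = ∑ a : {a // P a}, f a := by
  rw [← Fintype.sum_subtype_add_sum_subtype P f,
    Finset.sum_eq_zero (f := fun a : {a // ¬ P a} => f a) fun a _ => hf a a.2, add_zero]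

/-- The equality is required for every pair from the two supports, so an arbitrary bijection will do
and the middle decorations need not be matched canonically. -/
theorem sum_eq_sum_of_equiv {ι M : Type*} [Fintype ι] [AddCommMonoid M] {P Q : ι → Prop}
    [DecidablePred P] (h : Nonempty ({a // P a} ≃ {b // Q b})) (f g : ι → M)
    (hf : ∀ a, ¬ P a → f a = 0) (hg : ∀ b, ¬ Q b → g b = 0)
    (hfg : ∀ a b, P a → Q b → f a = g b) : ∑ a, f a = ∑ b, g b := by
  classical
  obtain ⟨e⟩ := h
  rw [sum_eq_sum_subtype P f hf, sum_eq_sum_subtype Q g hg]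
  exact Fintype.sum_equiv e _ _ fun a => hfg _ _ a.2 (e a).2

theorem sum_add_sum_of_equiv {ι M : Type*} [Fintype ι] [AddCommGroup M] {P Q : ι → Prop}
    [DecidablePred P] (h : Nonempty ({a // P a} ≃ {b // Q b})) (f g : ι → M)
    (hf : ∀ a, ¬ P a → f a = 0) (hg : ∀ b, ¬ Q b → g b = 0)
    (hfg : ∀ a b, P a → Q b → f a + g b = 0) : ∑ a, f a + ∑ b, g b = 0 := by
  rw [add_eq_zero_iff_eq_neg, ← Finset.sum_neg_distrib]
  exact sum_eq_sum_of_equiv h f _ hf (fun b hb => by rw [hg b hb, neg_zero])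
    fun a b ha hb => eq_neg_of_add_eq_zero_left (hfg a b ha hb)

theorem sum_add_sum_add_sum_of_equiv {ι M : Type*} [Fintype ι] [AddCommGroup M]
    {P Q S : ι → Prop} [DecidablePred P] (h : Nonempty ({a // P a} ≃ {b // Q b}))
    (h' : Nonempty ({a // P a} ≃ {b // S b})) (f g k : ι → M)
    (hf : ∀ a, ¬ P a → f a = 0) (hg : ∀ b, ¬ Q b → g b = 0) (hk : ∀ b, ¬ S b → k b = 0)
    (hfg : ∀ a b c, P a → Q b → S c → f a + g b + k c = 0) :
    ∑ a, f a + ∑ b, g b + ∑ c, k c = 0 := by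
  classical
  obtain ⟨e⟩ := h
  obtain ⟨e'⟩ := h'
  rw [sum_eq_sum_subtype P f hf, sum_eq_sum_subtype Q g hg, sum_eq_sum_subtype S k hk,
    ← e.sum_comp, ← e'.sum_comp, ← Finset.sum_add_distrib, ← Finset.sum_add_distrib]
  exact Finset.sum_eq_zero fun a _ => hfg _ _ _ a.2 (e a).2 (e' a).2

end Sums

/-! ### Matrices of edges; left and right bridges commute -/

noncomputable section Matrices

variable (R : Type*) [CommRing R] {n : ℕ}

open Classical in
/-- The class of the bridge edge `v ⟶ w` at `s`, or zero. -/
def bridgeHom (s : Side) (v w : DecLink n) : bObj R v ⟶ bObj R w :=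
  if h : ∃ γ, IsBridgeEdge s γ v w then bEdge R (.bridge s h.choose h.choose_spec) else 0

open Classical in
/-- The class of the decoration edge `v ⟶ w` at `s`, or zero. -/
def decHom (s : Side) (v w : DecLink n) : bObj R v ⟶ bObj R w :=
  if h : ∃ C, IsDecorationEdge C v w then bEdge R (.decoration s h.choose h.choose_spec) else 0

open Classical in
/-- The class of the right decoration edge `v ⟶ w` for the circle through `p`, or zero. -/
def rightHom (p : Fin (2 * n)) (v w : DecLink n) : bObj R v ⟶ bObj R w :=
  if DecStep p v w then decHom R .right v w else 0

variable {R} {s : Side} {v w a b : DecLink n} {γ : Finset (Finset (Fin (2 * n)))}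
  {C : Set (Fin (2 * n))} {p x z y u : Fin (2 * n)}

theorem bridgeHom_eq (h : IsBridgeEdge s γ v w) : bridgeHom R s v w = bEdge R (.bridge s γ h) := by
  have h' : ∃ γ, IsBridgeEdge s γ v w := ⟨γ, h⟩
  rw [bridgeHom, dif_pos h']
  obtain rfl := h.unique h'.choose_spec
  rfl

theorem bridgeHom_eq_zero (h : ¬ ∃ γ, IsBridgeEdge s γ v w) : bridgeHom R s v w = 0 := dif_neg h

theorem exists_of_bridgeHom_ne_zero (h : bridgeHom R s v w ≠ 0) : ∃ x z, BridgeStep s x z v w := by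
  obtain ⟨γ, h⟩ := not_imp_comm.1 bridgeHom_eq_zero h
  obtain ⟨x, z, h, -⟩ := h.exists_bridgeStep
  exact ⟨x, z, h⟩

theorem decHom_eq (h : IsDecorationEdge C v w) :
    decHom R s v w = bEdge R (.decoration s C h) := by
  have h' : ∃ C, IsDecorationEdge C v w := ⟨C, h⟩
  rw [decHom, dif_pos h']
  obtain rfl := h.unique h'.choose_spec
  rfl

theorem decHom_eq_zero (h : ¬ ∃ C, IsDecorationEdge C v w) : decHom R s v w = 0 := dif_neg h

theorem exists_of_decHom_ne_zero (h : decHom R s v w ≠ 0) : ∃ p, DecStep p v w := by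
  obtain ⟨γ, h⟩ := not_imp_comm.1 decHom_eq_zero h
  obtain ⟨p, h, -⟩ := h.exists_decStep
  exact ⟨p, h⟩

theorem rightHom_eq (h : DecStep p v w) : rightHom R p v w = decHom R .right v w := if_pos h

theorem rightHom_eq_zero (h : ¬ DecStep p v w) : rightHom R p v w = 0 := if_neg h

theorem map_relator {f : qObj R v ⟶ qObj R w} (h : Relator R f) :
    (Quotient.functor (relHom R n)).map f = 0 := by
  rw [← (Quotient.functor (relHom R n)).map_zero]
  rw [Quotient.functor_map_eq_iff]
  change f - 0 ∈ relIdeal R n _ _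
  rw [sub_zero]
  exact Submodule.subset_span ⟨v, w, f, 𝟙 _, 𝟙 _, h, by simp⟩

instance fintypeDecLink : Fintype (DecLink n) := Fintype.ofFinite _

/-- The sum of all paths of length two. -/
def homMul (X Y : ∀ v w : DecLink n, bObj R v ⟶ bObj R w) (v w : DecLink n) :
    bObj R v ⟶ bObj R w :=
  ∑ a, X v a ≫ Y a w

theorem homMul_assoc (X Y Z : ∀ v w : DecLink n, bObj R v ⟶ bObj R w) :
    homMul (homMul X Y) Z = homMul X (homMul Y Z) := by
  funext v w
  simp only [homMul, Preadditive.sum_comp, Preadditive.comp_sum, Category.assoc]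
  exact Finset.sum_comm

/-- The sum of all paths of length two of left bridges. -/
abbrev leftSquare (v w : DecLink n) : bObj R v ⟶ bObj R w :=
  homMul (bridgeHom R .left) (bridgeHom R .left) v w

/-- The vertex `a` lies between two bridge edges. -/
structure IsMidLink (s t : Side) (x z y u : Fin (2 * n)) (v w : DecLink n) (L : CleavedLink n)
    (a : DecLink n) : Prop where
  link_eq : a.link = L
  fst : BridgeStep s x z v a
  snd : BridgeStep t y u a w

open PlanarMatching

/-- The surgeries fix the link in the middle, so a middle vertex amounts to a choice of signs. -/
theorem nonempty_isMidLink_equiv_isMid {t : Side} {L : CleavedLink n}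
    (h₁ : Surgery (v.link.half s) (L.half s) x z) (h₁' : L.half s.other = v.link.half s.other)
    (h₂ : Surgery (L.half t) (w.link.half t) y u) (h₂' : w.link.half t.other = L.half t.other) :
    Nonempty ({a // IsMidLink s t x z y u v w L a} ≃
      {σ // IsMid v.link.setoid L.setoid x z y u v.sign w.sign σ}) := by
  refine ⟨⟨fun a => ⟨a.1.sign, ?_⟩, fun σ => ⟨DecLink.ofSign L σ.1, ?_⟩, ?_, ?_⟩⟩
  · obtain ⟨a, rfl, h, h'⟩ := a
    exact ⟨a.inv_sign, h.transition, h'.transition⟩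
  · obtain ⟨σ, h, h', h''⟩ := σ
    refine ⟨rfl, ⟨h₁, h₁', ?_⟩, ⟨h₂, h₂', ?_⟩⟩
    · rw [DecLink.sign_ofSign h]; exact h'
    · rw [DecLink.sign_ofSign h]; exact h''
  · rintro ⟨a, rfl, h, h'⟩
    exact Subtype.ext (DecLink.ext_sign rfl fun p =>
      congrFun (DecLink.sign_ofSign a.inv_sign) p)
  · rintro ⟨σ, h, h', h''⟩
    exact Subtype.ext (DecLink.sign_ofSign h)

theorem nonempty_isMidLink_equiv {s' t t' : Side} {L₁ L₂ : CleavedLink n} {x' z' y' u' : Fin (2 * n)}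
    (hf : SquareFeet x z y u x' z' y' u')
    (h₁ : Surgery (v.link.half s) (L₁.half s) x z) (h₁' : L₁.half s.other = v.link.half s.other)
    (h₂ : Surgery (L₁.half t) (w.link.half t) y u) (h₂' : w.link.half t.other = L₁.half t.other)
    (h₃ : Surgery (v.link.half s') (L₂.half s') x' z')
    (h₃' : L₂.half s'.other = v.link.half s'.other)
    (h₄ : Surgery (L₂.half t') (w.link.half t') y' u')
    (h₄' : w.link.half t'.other = L₂.half t'.other) :
    Nonempty ({a // IsMidLink s t x z y u v w L₁ a} ≃
      {b // IsMidLink s' t' x' z' y' u' v w L₂ b}) := by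
  obtain ⟨e₁⟩ := nonempty_isMidLink_equiv_isMid h₁ h₁' h₂ h₂'
  obtain ⟨e₂⟩ := nonempty_isMidLink_equiv_isMid h₃ h₃' h₄ h₄'
  obtain ⟨e⟩ := nonempty_isMid_equiv hf (saddle_of_surgery h₁ h₁') (saddle_of_surgery h₂ h₂')
    (saddle_of_surgery h₃ h₃') (saddle_of_surgery h₄ h₄') v.inv_sign w.inv_sign
  exact ⟨e₁.trans (e.trans e₂.symm)⟩

theorem BridgeStep.of_surgery {q r : Fin (2 * n)} (h : BridgeStep s q r v w)
    (hs : Surgery (v.link.half s) (w.link.half s) x z) : BridgeStep s x z v w :=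
  h.isBridgeEdge.bridgeStep hs

theorem CleavedLink.ext_half {L L' : CleavedLink n} (s : Side) (h : L.half s = L'.half s)
    (h' : L.half s.other = L'.half s.other) : L = L' := by
  ext1
  funext t
  rcases Side.eq_or_eq_other s t with rfl | rfl <;> assumption

theorem Side.other_other (s : Side) : s.other.other = s := by cases s <;> rfl

theorem isMidLink_of_ne_zero {t : Side} (h : bridgeHom R s v a ≫ bridgeHom R t a w ≠ 0) :
    ∃ x z y u, IsMidLink s t x z y u v w a.link a := by
  obtain ⟨x, z, h1⟩ := exists_of_bridgeHom_ne_zero (R := R) (s := s) (v := v) (w := a) fun h0 => h (by rw [h0, Limits.zero_comp])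
  obtain ⟨y, u, h2⟩ := exists_of_bridgeHom_ne_zero (R := R) (s := t) (v := a) (w := w) fun h0 => h (by rw [h0, Limits.comp_zero])
  exact ⟨x, z, y, u, rfl, h1, h2⟩

theorem IsMidLink.congr {t : Side} {L : CleavedLink n} {p q p' q' : Fin (2 * n)}
    (h : IsMidLink s t p q p' q' v w a.link a) (hL : a.link = L)
    (h₁ : Surgery (v.link.half s) (L.half s) x z) (h₂ : Surgery (L.half t) (w.link.half t) y u) :
    IsMidLink s t x z y u v w L a := by
  subst hL
  exact ⟨rfl, h.fst.of_surgery h₁, h.snd.of_surgery h₂⟩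

theorem homMul_bridgeHom_eq_of_ne_zero {t : Side} (hst : s ≠ t)
    (ha : bridgeHom R s v a ≫ bridgeHom R t a w ≠ 0) :
    homMul (bridgeHom R s) (bridgeHom R t) v w = homMul (bridgeHom R t) (bridgeHom R s) v w := by
  classical
  obtain ⟨x, z, y, u, -, h1, h2⟩ := isMidLink_of_ne_zero ha
  obtain rfl : t = s.other := (Side.eq_or_eq_other s t).resolve_left hst.symm
  have o1 := h1.other
  have o2 := h2.other
  have s1 := h1.surgery
  have s2 := h2.surgery
  rw [Side.other_other] at o2
  -- The middle link for the other order of the two surgeries: the source on side s and the target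
  -- on the other side.
  let L : CleavedLink n := ⟨fun r => if r = s then v.link.half s else w.link.half s.other⟩
  have l1 : L.half s = v.link.half s := if_pos rfl
  have l2 : L.half s.other = w.link.half s.other := if_neg s.other_ne
  refine sum_eq_sum_of_equiv (nonempty_isMidLink_equiv (squareFeet_disjoint x z y u) s1 o1 s2
    h2.other (s' := s.other) (t' := s) (L₂ := L) ?_ ?_ ?_ ?_) _ _ ?_ ?_ ?_
  · rwa [l2, ← o1]
  · rw [Side.other_other, l1]
  · rwa [l1, o2]
  · exact l2.symm
  · intro a' h
    by_contra h0
    obtain ⟨x', z', y', u', g⟩ := isMidLink_of_ne_zero h0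
    have g1 := g.fst.other
    have g2 := g.snd.other
    rw [Side.other_other] at g2
    exact h (g.congr (CleavedLink.ext_half s (g2.symm.trans o2) (g1.trans o1.symm)) s1 s2)
  · intro b h
    by_contra h0
    obtain ⟨x', z', y', u', g⟩ := isMidLink_of_ne_zero h0
    have g1 := g.fst.other
    have g2 := g.snd.other
    rw [Side.other_other] at g1
    refine h (g.congr (CleavedLink.ext_half s (g1.trans l1.symm) (g2.symm.trans l2.symm)) ?_ ?_)
    · rwa [l2, ← o1]
    · rwa [l1, o2]
  · rintro a' b ⟨k0, k1, k2⟩ ⟨m0, m1, m2⟩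
    have e2 := k2.isBridgeEdge
    rw [k0, o1] at e2
    have e4 := m2.isBridgeEdge
    rw [m0, l1] at e4
    have := map_relator (Relator.bridge_sides (R := R) hst k1.isBridgeEdge e2 m1.isBridgeEdge e4)
    rw [Functor.map_sub, Functor.map_comp, Functor.map_comp] at this
    rw [bridgeHom_eq k1.isBridgeEdge, bridgeHom_eq e2, bridgeHom_eq m1.isBridgeEdge,
      bridgeHom_eq e4, ← sub_eq_zero]
    exact this

theorem homMul_bridgeHom_comm {t : Side} (hst : s ≠ t) :
    homMul (bridgeHom R s) (bridgeHom R t) = homMul (bridgeHom R (n := n) t) (bridgeHom R s) := by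
  funext v w
  by_cases h : ∃ a, bridgeHom R s v a ≫ bridgeHom R t a w ≠ 0
  · obtain ⟨a, ha⟩ := h
    exact homMul_bridgeHom_eq_of_ne_zero hst ha
  by_cases h' : ∃ b, bridgeHom R t v b ≫ bridgeHom R s b w ≠ 0
  · obtain ⟨b, hb⟩ := h'
    exact (homMul_bridgeHom_eq_of_ne_zero hst.symm hb).symm
  push Not at h h'
  simp only [homMul, h, h', Finset.sum_const_zero]

end Matrices

/-! ### Vanishing of sums of left squares between different links -/

noncomputable section LeftSquares

variable {R : Type*} [CommRing R] {n : ℕ} {v w a b : DecLink n}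
  {x z y u p q r s : Fin (2 * n)}

open PlanarMatching

/-- The link with a given left half and with the right half of `L`. -/
def CleavedLink.withLeft (L : CleavedLink n) (M : PlanarMatching n) : CleavedLink n :=
  ⟨fun s => match s with
    | .left => M
    | .right => L.half .right⟩

/-- The part of the sum of all paths of two left bridges which has `M` in the middle. -/
def leftSummand (R : Type*) [CommRing R] (M : PlanarMatching n) (v w a : DecLink n) :
    bObj R v ⟶ bObj R w :=
  open Classical in
  if a.link.half .left = M then bridgeHom R .left v a ≫ bridgeHom R .left a w else 0

theorem leftSummand_eq_zero {M : PlanarMatching n}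
    (h₁ : Surgery (v.link.half .left) M x z) (h₂ : Surgery M (w.link.half .left) y u)
    (h : ¬ IsMidLink .left .left x z y u v w (v.link.withLeft M) a) :
    leftSummand R M v w a = 0 := by
  unfold leftSummand
  split_ifs with hM
  · by_contra h0
    obtain ⟨x', z', y', u', g⟩ := isMidLink_of_ne_zero h0
    exact h (g.congr (CleavedLink.ext_half .left hM g.fst.other) h₁ h₂)
  · rfl

theorem leftSummand_eq {L : CleavedLink n} (h : IsMidLink .left .left x z y u v w L a) :
    leftSummand R (L.half .left) v w a = bridgeHom R .left v a ≫ bridgeHom R .left a w := by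
  rw [leftSummand, if_pos (by rw [h.link_eq])]

theorem isMidMatching_of_ne_zero (h : bridgeHom R .left v a ≫ bridgeHom R .left a w ≠ 0) :
    IsMidMatching (v.link.half .left) (w.link.half .left) (a.link.half .left) := by
  obtain ⟨x, z, y, u, -, h1, h2⟩ := isMidLink_of_ne_zero h
  exact ⟨x, z, y, u, h1.surgery, h2.surgery⟩

theorem SurgerySquare.nonempty_equiv {M₁ M₂ : PlanarMatching n}
    (h : SurgerySquare (v.link.half .left) M₁ M₂ (w.link.half .left) x z y u p q r s)
    (ho : w.link.half .right = v.link.half .right) :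
    Nonempty ({a // IsMidLink .left .left x z y u v w (v.link.withLeft M₁) a} ≃
      {b // IsMidLink .left .left p q r s v w (v.link.withLeft M₂) b}) :=
  nonempty_isMidLink_equiv h.feet h.fst rfl h.snd ho h.fst' rfl h.snd' ho

theorem bridgeHom_square {M₁ M₂ : PlanarMatching n}
    (h : SurgerySquare (v.link.half .left) M₁ M₂ (w.link.half .left) x z y u p q r s)
    (par : ParallelDisjoint (arcPair (v.link.half .left) x z) (arcPair (v.link.half .left) p q) ∨
      ParallelOpposite (arcPair (v.link.half .left) x z) (arcPair (v.link.half .left) p q))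
    (ha : IsMidLink .left .left x z y u v w (v.link.withLeft M₁) a)
    (hb : IsMidLink .left .left p q r s v w (v.link.withLeft M₂) b) :
    bridgeHom R .left v a ≫ bridgeHom R .left a w +
      bridgeHom R .left v b ≫ bridgeHom R .left b w = 0 := by
  have e1 := ha.fst.isBridgeEdge
  have e2 := ha.snd.isBridgeEdge
  have e3 := hb.fst.isBridgeEdge
  have e4 := hb.snd.isBridgeEdge
  have i1 : IsImage (v.link.half .left) (a.link.half .left) (arcPair (v.link.half .left) x z)
      (arcPair (v.link.half .left) p q) (arcPair (a.link.half .left) y u) := by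
    rw [ha.link_eq]; exact h.image
  have i2 : IsImage (v.link.half .left) (b.link.half .left) (arcPair (v.link.half .left) p q)
      (arcPair (v.link.half .left) x z) (arcPair (b.link.half .left) r s) := by
    rw [hb.link_eq]; exact h.image'
  have := map_relator (Relator.bridge_left (R := R) e1 e2 e3 e4 par i1 i2)
  rw [Functor.map_add, Functor.map_comp, Functor.map_comp] at this
  rw [bridgeHom_eq e1, bridgeHom_eq e2, bridgeHom_eq e3, bridgeHom_eq e4]
  exact this

theorem bridgeHom_triple {M₁ M₂ M₃ : PlanarMatching n} {c : DecLink n}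
    {p' q' r' s' : Fin (2 * n)}
    (h : SurgerySquare (v.link.half .left) M₁ M₂ (w.link.half .left) x z y u p q r s)
    (h' : SurgerySquare (v.link.half .left) M₁ M₃ (w.link.half .left) x z y u p' q' r' s')
    (par : ParallelSame (arcPair (v.link.half .left) x z) (arcPair (v.link.half .left) p q))
    (slide : arcPair (v.link.half .left) p' q' =
      (arcPair (v.link.half .left) x z \ arcPair (v.link.half .left) p q) ∪
        (arcPair (v.link.half .left) p q \ arcPair (v.link.half .left) x z))
    (ha : IsMidLink .left .left x z y u v w (v.link.withLeft M₁) a)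
    (hb : IsMidLink .left .left p q r s v w (v.link.withLeft M₂) b)
    (hc : IsMidLink .left .left p' q' r' s' v w (v.link.withLeft M₃) c) :
    bridgeHom R .left v a ≫ bridgeHom R .left a w +
      bridgeHom R .left v b ≫ bridgeHom R .left b w +
      bridgeHom R .left v c ≫ bridgeHom R .left c w = 0 := by
  have e1 := ha.fst.isBridgeEdge
  have e2 := ha.snd.isBridgeEdge
  have e3 := hb.fst.isBridgeEdge
  have e4 := hb.snd.isBridgeEdge
  have e5 := hc.fst.isBridgeEdge
  have e6 := hc.snd.isBridgeEdge
  have i1 : IsImage (v.link.half .left) (a.link.half .left) (arcPair (v.link.half .left) x z)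
      (arcPair (v.link.half .left) p q) (arcPair (a.link.half .left) y u) := by
    rw [ha.link_eq]; exact h.image
  have i2 : IsImage (v.link.half .left) (b.link.half .left) (arcPair (v.link.half .left) p q)
      (arcPair (v.link.half .left) x z) (arcPair (b.link.half .left) r s) := by
    rw [hb.link_eq]; exact h.image'
  have i3 : IsImage (v.link.half .left) (c.link.half .left) (arcPair (v.link.half .left) p' q')
      (arcPair (v.link.half .left) x z) (arcPair (c.link.half .left) r' s') := by
    rw [hc.link_eq]; exact h'.image'
  have := map_relator (Relator.bridge_triple (R := R) e1 e2 e3 e4 e5 e6 par slide i1 i2 i3)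
  rw [Functor.map_add, Functor.map_add, Functor.map_comp, Functor.map_comp,
    Functor.map_comp] at this
  rw [bridgeHom_eq e1, bridgeHom_eq e2, bridgeHom_eq e3, bridgeHom_eq e4, bridgeHom_eq e5,
    bridgeHom_eq e6]
  exact this

/-- The sum of all paths of two left bridges between different links is zero. -/
theorem leftSquare_eq_zero (h : v.link ≠ w.link) : leftSquare (R := R) v w = 0 := by
  classical
  by_cases h0 : ∀ a, bridgeHom R .left v a ≫ bridgeHom R .left a w = 0
  · exact Finset.sum_eq_zero fun a _ => h0 a
  push Not at h0
  obtain ⟨a, ha⟩ := h0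
  obtain ⟨_, _, _, _, -, k1, k2⟩ := isMidLink_of_ne_zero ha
  have ho : w.link.half .right = v.link.half .right := k2.other.trans k1.other
  have hne : v.link.half .left ≠ w.link.half .left := fun h' =>
    h (CleavedLink.ext_half .left h' ho.symm)
  -- The three outcomes match the three kinds of relations. A single middle matching makes every
  -- path zero on its own. With two or three matchings the sum splits into one part for each, and
  -- these parts are cancelled against each other by bijections of the middle decorations.
  obtain ⟨x, z, y, u, s1, s2, ht⟩ := exists_twoSurgeries (isMidMatching_of_ne_zero ha) hne
  rcases ht with ⟨hc, hm⟩ | ⟨M₂, p, q, r, s, sq, par, hm⟩ |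
    ⟨M₂, M₃, p, q, r, s, p', q', r', s', sq, sq', hne', par, slide, hm⟩
  · refine Finset.sum_eq_zero fun b _ => by_contra fun hb => ?_
    have e := hm _ (isMidMatching_of_ne_zero hb)
    obtain ⟨_, _, _, _, -, m1, m2⟩ := isMidLink_of_ne_zero hb
    have m2 := (m2.of_surgery (by rwa [e])).isBridgeEdge
    have m1 := m1.isBridgeEdge
    have hc' : Crosses (v.dagger .left b) (arcPair (b.link.half .left) y u) := by
      rw [DecLink.dagger, e]; exact hc
    have := map_relator (Relator.bridge_crossing (R := R) m1 m2 hc')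
    rw [Functor.map_comp] at this
    rw [bridgeHom_eq m1, bridgeHom_eq m2] at hb
    exact hb this
  · have key : leftSquare (R := R) v w = ∑ b, leftSummand R (a.link.half .left) v w b +
        ∑ b, leftSummand R M₂ v w b := by
      rw [← Finset.sum_add_distrib]
      refine Finset.sum_congr rfl fun b _ => ?_
      by_cases hb : bridgeHom R .left v b ≫ bridgeHom R .left b w = 0
      · simp only [leftSummand, hb, ite_self, add_zero]
      · rcases hm _ (isMidMatching_of_ne_zero hb) with e | e
        · rw [leftSummand, leftSummand, if_pos e, if_neg (by rw [e]; exact sq.ne), add_zero]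
        · rw [leftSummand, leftSummand, if_neg (by rw [e]; exact sq.ne.symm), if_pos e, zero_add]
    rw [key]
    refine sum_add_sum_of_equiv (sq.nonempty_equiv ho) _ _
      (fun b => leftSummand_eq_zero s1 s2) (fun b => leftSummand_eq_zero sq.fst' sq.snd') ?_
    intro b c hb hc
    rw [← bridgeHom_square (R := R) sq par hb hc, ← leftSummand_eq hb, ← leftSummand_eq hc]
    rfl
  · have key : leftSquare (R := R) v w = ∑ b, leftSummand R (a.link.half .left) v w b +
        ∑ b, leftSummand R M₂ v w b + ∑ b, leftSummand R M₃ v w b := by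
      rw [← Finset.sum_add_distrib, ← Finset.sum_add_distrib]
      refine Finset.sum_congr rfl fun b _ => ?_
      by_cases hb : bridgeHom R .left v b ≫ bridgeHom R .left b w = 0
      · simp only [leftSummand, hb, ite_self, add_zero]
      · rcases hm _ (isMidMatching_of_ne_zero hb) with e | e | e
        · rw [leftSummand, leftSummand, leftSummand, if_pos e, if_neg (by rw [e]; exact sq.ne),
            if_neg (by rw [e]; exact sq'.ne), add_zero, add_zero]
        · rw [leftSummand, leftSummand, leftSummand, if_neg (by rw [e]; exact sq.ne.symm),
            if_pos e, if_neg (by rw [e]; exact hne'), zero_add, add_zero]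
        · rw [leftSummand, leftSummand, leftSummand, if_neg (by rw [e]; exact sq'.ne.symm),
            if_neg (by rw [e]; exact hne'.symm), if_pos e, zero_add, zero_add]
    rw [key]
    refine sum_add_sum_add_sum_of_equiv (sq.nonempty_equiv ho) (sq'.nonempty_equiv ho) _ _ _
      (fun b => leftSummand_eq_zero s1 s2) (fun b => leftSummand_eq_zero sq.fst' sq.snd')
      (fun b => leftSummand_eq_zero sq'.fst' sq'.snd') ?_
    intro b c d hb hc hd
    rw [← bridgeHom_triple (R := R) sq sq' par slide hb hc hd, ← leftSummand_eq hb,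
      ← leftSummand_eq hc, ← leftSummand_eq hd]
    rfl

end LeftSquares

/-! ### Signs: a change from + to - before or after a saddle -/

section DecBridge

variable {α : Type*} {r r' r₁ : Setoid α} {x z p : α} {σ τ a b : α → Sign}

/-- The signs change from `+` to `-` on the class of `p`. -/
structure Decrease (r : Setoid α) (p : α) (σ τ : α → Sign) : Prop where
  source : σ p = .plus
  target : τ p = .minus
  off : ∀ q, ¬ r p q → τ q = σ q

theorem Decrease.dual (h : Decrease r p σ τ) :
    Decrease r p (fun q => (τ q).neg) fun q => (σ q).neg :=
  ⟨by simp [h.target], by simp [h.source], fun q hq => by rw [h.off q hq]⟩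

/-- Signs between a decrease and a saddle. -/
structure IsDecBridge (r : Setoid α) (x z : α) (σ τ b : α → Sign) : Prop where
  inv : Inv r b
  dec : ∃ p, Decrease r p σ b
  bridge : Transition r x z b τ

/-- Signs between a saddle and a decrease. -/
structure IsBridgeDec (r r' : Setoid α) (x z : α) (σ τ a : α → Sign) : Prop where
  inv : Inv r' a
  bridge : Transition r x z σ a
  dec : ∃ p, Decrease r' p a τ

/-- The squares formed by decreases and saddles. -/
inductive DecBridgeCases (r r' : Setoid α) (x z : α) (σ τ : α → Sign) : Prop
  | off (p : α) (b a : α → Sign) (hx : ¬ r x p) (hz : ¬ r z p) (hb : Decrease r p σ b)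
      (ha : Decrease r' p a τ) (hB : ∀ c, IsDecBridge r x z σ τ c ↔ c = b)
      (hA : ∀ c, IsBridgeDec r r' x z σ τ c ↔ c = a)
  | merge (b₁ b₂ a : α → Sign) (h : ¬ r x z) (hb₁ : Decrease r x σ b₁) (hb₂ : Decrease r z σ b₂)
      (ha : Decrease r' x a τ) (hB : ∀ c, IsDecBridge r x z σ τ c ↔ c = b₁ ∨ c = b₂)
      (hA : ∀ c, IsBridgeDec r r' x z σ τ c ↔ c = a)
  | fission (b a₁ a₂ : α → Sign) (h : r x z) (hb : Decrease r x σ b) (ha₁ : Decrease r' x a₁ τ)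
      (ha₂ : Decrease r' z a₂ τ) (hB : ∀ c, IsDecBridge r x z σ τ c ↔ c = b)
      (hA : ∀ c, IsBridgeDec r r' x z σ τ c ↔ c = a₁ ∨ c = a₂)

theorem isDecBridge_dual (h : Saddle r r' x z) : IsDecBridge r x z σ τ b ↔
    IsBridgeDec r' r x z (fun p => (τ p).neg) (fun p => (σ p).neg) fun p => (b p).neg := by
  constructor
  · rintro ⟨h1, ⟨p, h2⟩, h3⟩
    exact ⟨h1.neg, h3.dual h, p, h2.dual⟩
  · rintro ⟨h1, h2, p, h3⟩
    exact ⟨by simpa using h1.neg, ⟨p, by simpa using h3.dual⟩, (transition_dual_iff h).2 h2⟩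

theorem isBridgeDec_dual (h : Saddle r r' x z) : IsBridgeDec r r' x z σ τ a ↔
    IsDecBridge r' x z (fun p => (τ p).neg) (fun p => (σ p).neg) fun p => (a p).neg := by
  rw [isDecBridge_dual h.symm]
  simp

/-- Whether a path exists in either order depends only on the signs at the two ends, and so one
order is possible exactly when the other is; the middle signs can then be listed. -/
theorem decBridgeCases_of_merge (h : Saddle r r' x z) (h0 : ¬ r x z) (hσ : Inv r σ)
    (hτ : Inv r' τ) (hex : (∃ b, IsDecBridge r x z σ τ b) ∨ ∃ a, IsBridgeDec r r' x z σ τ a) :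
    (∃ p b a, ¬ r x p ∧ ¬ r z p ∧ Decrease r p σ b ∧ Decrease r' p a τ ∧
      (∀ c, IsDecBridge r x z σ τ c ↔ c = b) ∧ (∀ c, IsBridgeDec r r' x z σ τ c ↔ c = a)) ∨
    ∃ b₁ b₂ a, Decrease r x σ b₁ ∧ Decrease r z σ b₂ ∧ Decrease r' x a τ ∧
      (∀ c, IsDecBridge r x z σ τ c ↔ c = b₁ ∨ c = b₂) ∧
      (∀ c, IsBridgeDec r r' x z σ τ c ↔ c = a) := by
  classical
  obtain ⟨k, hk, hfac⟩ := exists_map_rel r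
  have hr := h.merge h0
  have hle : ∀ p q, r p q → r' p q := fun p q => h.le h0
  obtain ⟨s, hs⟩ := hfac r σ hσ fun p q => id
  obtain ⟨t, ht⟩ := hfac r' τ hτ hle
  have htx : t (k x) = t (k z) := by rw [← ht, ← ht]; exact hτ _ _ (h.rel_merge h0)
  have hB : ∀ c, IsDecBridge r x z σ τ c ↔ Inv r c ∧ (∃ p, Decrease r p σ c) ∧
      (∀ q, ¬ r q x → ¬ r q z → τ q = c q) ∧ MergeRule (c x) (c z) (τ x) := fun c =>
    ⟨fun ⟨h1, h2, h3⟩ => ⟨h1, h2, h3.off, h3.merge h0⟩,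
      fun ⟨h1, h2, h3, h4⟩ => ⟨h1, h2, h3, fun _ => h4, fun h5 => absurd h5 h0⟩⟩
  have hA : ∀ c, IsBridgeDec r r' x z σ τ c ↔ Inv r' c ∧ (∃ p, Decrease r' p c τ) ∧
      (∀ q, ¬ r q x → ¬ r q z → c q = σ q) ∧ MergeRule (σ x) (σ z) (c x) := fun c =>
    ⟨fun ⟨h1, h3, h2⟩ => ⟨h1, h2, h3.off, h3.merge h0⟩,
      fun ⟨h1, h2, h3, h4⟩ => ⟨h1, ⟨h3, fun _ => h4, fun h5 => absurd h5 h0⟩, h2⟩⟩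
  -- Common criterion for both orders. Either the sign drops on a circle away from the feet and the
  -- merge rule holds at the feet, or both feet are + and the merged circle ends as -.
  have key : (∃ p, k p ≠ k x ∧ k p ≠ k z ∧ s (k p) = .plus ∧ t (k p) = .minus ∧
      (∀ q, k q ≠ k x → k q ≠ k z → k q ≠ k p → t (k q) = s (k q)) ∧
      MergeRule (s (k x)) (s (k z)) (t (k x))) ∨
      (s (k x) = .plus ∧ s (k z) = .plus ∧ t (k x) = .minus ∧
        ∀ q, k q ≠ k x → k q ≠ k z → t (k q) = s (k q)) := by
    have h0' := h0
    rw [hk] at h0'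
    rcases hex with ⟨c, hc⟩ | ⟨c, hc⟩
    · rw [hB] at hc
      obtain ⟨h1, ⟨p, h2, h3, h4⟩, h5, h6⟩ := hc
      obtain ⟨c, hc⟩ := hfac r _ h1 fun p q => id
      simp only [hk, hs, hc] at h4
      simp only [hk, ht, hc] at h5
      rw [hs] at h2
      rw [hc] at h3
      simp only [ht, hc, mergeRule_iff] at h6
      clear hB hA h h1 hr hle hσ hτ hfac hk h0 hs ht hc
      have a1 := h4 x
      have a2 := h4 z
      have a3 := h5 p
      by_cases p1 : k p = k x
      · right
        refine ⟨by grind, by grind, by grind, fun q q1 q2 => ?_⟩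
        rw [h5 q q1 q2, h4 q (by grind)]
      by_cases p2 : k p = k z
      · right
        refine ⟨by grind, by grind, by grind, fun q q1 q2 => ?_⟩
        rw [h5 q q1 q2, h4 q (by grind)]
      · left
        refine ⟨p, p1, p2, h2, by grind, fun q q1 q2 q3 => ?_, ?_⟩
        · rw [h5 q q1 q2, h4 q (Ne.symm q3)]
        · rw [mergeRule_iff, ← a1 p1, ← a2 p2]; exact h6
    · rw [hA] at hc
      obtain ⟨h1, ⟨p, h2, h3, h4⟩, h5, h6⟩ := hc
      obtain ⟨c, hc⟩ := hfac r' _ h1 hle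
      have hcx : c (k x) = c (k z) := by rw [← hc, ← hc]; exact h1 _ _ (h.rel_merge h0)
      simp only [hr, Joined, hk, ht, hc] at h4
      simp only [hk, hs, hc] at h5
      rw [hc] at h2
      rw [ht] at h3
      simp only [hs, hc, mergeRule_iff] at h6
      clear hB hA h h1 hr hle hσ hτ hfac hk h0 hs ht hc
      have a1 := h4 x
      have a2 := h4 z
      have a3 := h5 p
      by_cases p1 : k p = k x
      · right
        refine ⟨by grind, by grind, by grind, fun q q1 q2 => ?_⟩
        rw [h4 q (by grind), h5 q q1 q2]
      by_cases p2 : k p = k z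
      · right
        refine ⟨by grind, by grind, by grind, fun q q1 q2 => ?_⟩
        rw [h4 q (by grind), h5 q q1 q2]
      · left
        refine ⟨p, p1, p2, by grind, h3, fun q q1 q2 q3 => ?_, ?_⟩
        · rw [h4 q (by grind), h5 q q1 q2]
        · rw [mergeRule_iff, a1 (by grind)]; exact h6
  have h0' := h0
  rw [hk] at h0'
  rcases key with ⟨p, p1, p2, k1, k2, k3, k4⟩ | ⟨k1, k2, k3, k4⟩
  · left
    rw [mergeRule_iff] at k4
    refine ⟨p, fun q => if k q = k p then .minus else s (k q),
      fun q => if k q = k p then .plus else t (k q), ?_, ?_, ?_, ?_, ?_, ?_⟩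
    · rw [hk]; exact Ne.symm p1
    · rw [hk]; exact Ne.symm p2
    · exact ⟨by rw [hs, k1], if_pos rfl, fun q hq => by
        rw [hk] at hq; rw [hs]; exact if_neg (Ne.symm hq)⟩
    · refine ⟨if_pos rfl, by rw [ht, k2], fun q hq => ?_⟩
      have : k q ≠ k p := fun h' => hq (hle _ _ (by rw [hk, h']))
      rw [ht]; exact (if_neg this).symm
    · intro c
      rw [hB]
      constructor
      · rintro ⟨h1, ⟨p', h2, h3, h4⟩, h5, h6⟩
        obtain ⟨c, hc⟩ := hfac r _ h1 fun p q => id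
        simp only [hk, hs, hc] at h4
        simp only [hk, ht, hc] at h5
        rw [hs] at h2
        rw [hc] at h3
        simp only [ht, hc, mergeRule_iff] at h6
        funext q
        rw [hc]
        clear hB hA h h1 hr hle hσ hτ hfac hk h0 hs ht hc
        have a1 := h5 p p1 p2
        have a2 := h4 p
        have a3 := h4 q
        grind
      · rintro rfl
        refine ⟨fun q q' hq => ?_, ⟨p, by rw [hs, k1], if_pos rfl, fun q hq => ?_⟩,
          fun q q1 q2 => ?_, ?_⟩
        · rw [hk] at hq; simp only [hq]
        · rw [hk] at hq; rw [hs]; exact if_neg (Ne.symm hq)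
        · rw [hk] at q1 q2
          rw [ht]
          by_cases q3 : k q = k p
          · simp only [q3, k2, if_true]
          · simp only [q3, if_false, k3 q q1 q2 q3]
        · beta_reduce
          rw [mergeRule_iff, if_neg (Ne.symm p1), if_neg (Ne.symm p2), ht]
          exact k4
    · intro c
      rw [hA]
      constructor
      · rintro ⟨h1, ⟨p', h2, h3, h4⟩, h5, h6⟩
        obtain ⟨c, hc⟩ := hfac r' _ h1 hle
        have hcx : c (k x) = c (k z) := by rw [← hc, ← hc]; exact h1 _ _ (h.rel_merge h0)
        simp only [hr, Joined, hk, ht, hc] at h4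
        simp only [hk, hs, hc] at h5
        rw [hc] at h2
        rw [ht] at h3
        simp only [hs, hc, mergeRule_iff] at h6
        funext q
        rw [hc]
        clear hB hA h h1 hr hle hσ hτ hfac hk h0 hs ht hc
        have a1 := h5 p p1 p2
        have a2 := h4 p
        have a3 := h4 q
        grind
      · rintro rfl
        refine ⟨fun q q' hq => ?_, ⟨p, if_pos rfl, by rw [ht, k2], fun q hq => ?_⟩,
          fun q q1 q2 => ?_, ?_⟩
        · have := hτ _ _ hq
          rw [ht, ht] at this
          simp only [hr, Joined, hk] at hq
          grind
        · have : k q ≠ k p := fun h' => hq (hle _ _ (by rw [hk, h']))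
          rw [ht]; exact (if_neg this).symm
        · rw [hk] at q1 q2
          rw [hs]
          by_cases q3 : k q = k p
          · simp only [q3, k1, if_true]
          · simp only [q3, if_false, k3 q q1 q2 q3]
        · beta_reduce
          rw [mergeRule_iff, if_neg (Ne.symm p1), hs, hs]
          exact k4
  · right
    refine ⟨fun q => if k q = k x then .minus else s (k q),
      fun q => if k q = k z then .minus else s (k q),
      fun q => if k q = k x ∨ k q = k z then .plus else t (k q), ?_, ?_, ?_, ?_, ?_⟩
    · exact ⟨by rw [hs, k1], if_pos rfl, fun q hq => by
        rw [hk] at hq; rw [hs]; exact if_neg (Ne.symm hq)⟩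
    · exact ⟨by rw [hs, k2], if_pos rfl, fun q hq => by
        rw [hk] at hq; rw [hs]; exact if_neg (Ne.symm hq)⟩
    · refine ⟨if_pos (Or.inl rfl), by rw [ht, k3], fun q hq => ?_⟩
      simp only [hr, Joined, hk] at hq
      rw [ht]
      exact (if_neg (by grind)).symm
    · intro c
      rw [hB]
      constructor
      · rintro ⟨h1, ⟨p', h2, h3, h4⟩, h5, h6⟩
        obtain ⟨c, hc⟩ := hfac r _ h1 fun p q => id
        simp only [hk, hs, hc] at h4
        simp only [hk, ht, hc] at h5
        rw [hs] at h2
        rw [hc] at h3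
        have hp : k p' = k x ∨ k p' = k z := by
          by_contra hp
          rw [not_or] at hp
          have := h5 p' hp.1 hp.2
          rw [k4 p' hp.1 hp.2, h2, h3] at this
          cases this
        refine hp.imp (fun hp => ?_) fun hp => ?_ <;> funext q <;> rw [hc] <;>
          by_cases q1 : k q = k p'
        · rw [if_pos (q1.trans hp), q1, h3]
        · rw [if_neg (fun h' => q1 (h'.trans hp.symm)), h4 q (Ne.symm q1)]
        · rw [if_pos (q1.trans hp), q1, h3]
        · rw [if_neg (fun h' => q1 (h'.trans hp.symm)), h4 q (Ne.symm q1)]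
      · rintro (rfl | rfl)
        · refine ⟨fun q q' hq => ?_, ⟨x, by rw [hs, k1], if_pos rfl, fun q hq => ?_⟩,
            fun q q1 q2 => ?_, ?_⟩
          · rw [hk] at hq; simp only [hq]
          · rw [hk] at hq; rw [hs]; exact if_neg (Ne.symm hq)
          · rw [hk] at q1 q2
            beta_reduce
            rw [ht, if_neg q1, k4 q q1 q2]
          · beta_reduce
            rw [mergeRule_iff, if_pos rfl, if_neg (Ne.symm h0'), ht, k2, k3]
            simp
        · refine ⟨fun q q' hq => ?_, ⟨z, by rw [hs, k2], if_pos rfl, fun q hq => ?_⟩,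
            fun q q1 q2 => ?_, ?_⟩
          · rw [hk] at hq; simp only [hq]
          · rw [hk] at hq; rw [hs]; exact if_neg (Ne.symm hq)
          · rw [hk] at q1 q2
            beta_reduce
            rw [ht, if_neg q2, k4 q q1 q2]
          · beta_reduce
            rw [mergeRule_iff, if_pos rfl, if_neg h0', ht, k1, k3]
            simp
    · intro c
      rw [hA]
      constructor
      · rintro ⟨h1, ⟨p', h2, h3, h4⟩, h5, h6⟩
        obtain ⟨c, hc⟩ := hfac r' _ h1 hle
        have hcx : c (k x) = c (k z) := by rw [← hc, ← hc]; exact h1 _ _ (h.rel_merge h0)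
        simp only [hr, Joined, hk, ht, hc] at h4
        simp only [hk, hs, hc] at h5
        rw [hc] at h2
        rw [ht] at h3
        have hp : k p' = k x ∨ k p' = k z := by
          by_contra hp
          rw [not_or] at hp
          have := h5 p' hp.1 hp.2
          rw [← k4 p' hp.1 hp.2, h2, h3] at this
          cases this
        funext q
        rw [hc]
        split_ifs with q1
        · grind
        · rw [h4 q (by grind)]
      · rintro rfl
        refine ⟨fun q q' hq => ?_, ⟨x, if_pos (Or.inl rfl), by rw [ht, k3], fun q hq => ?_⟩,
          fun q q1 q2 => ?_, ?_⟩
        · have := hτ _ _ hq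
          rw [ht, ht] at this
          simp only [hr, Joined, hk] at hq
          grind
        · simp only [hr, Joined, hk] at hq
          rw [ht]
          exact (if_neg (by grind)).symm
        · rw [hk] at q1 q2
          beta_reduce
          rw [hs, if_neg (by grind), k4 q q1 q2]
        · beta_reduce
          rw [mergeRule_iff, if_pos (Or.inl rfl), hs, hs, k1, k2]
          simp

/-- A division is handled by duality: reversing paths and signs turns it into a merge and exchanges
the two orders. -/
theorem decBridgeCases (h : Saddle r r' x z) (hσ : Inv r σ) (hτ : Inv r' τ)
    (hex : (∃ b, IsDecBridge r x z σ τ b) ∨ ∃ a, IsBridgeDec r r' x z σ τ a) :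
    DecBridgeCases r r' x z σ τ := by
  by_cases h0 : r x z
  · have hB : ∀ c b : α → Sign, (c = fun p => (b p).neg) ↔ (fun p => (c p).neg) = b := by
      intro c b
      constructor
      · rintro rfl; simp
      · rintro rfl; simp
    have hA : ∀ c b : α → Sign, (fun p => (c p).neg) = b ↔ c = fun p => (b p).neg :=
      fun c b => (hB c b).symm
    have hex' : (∃ b, IsDecBridge r' x z (fun p => (τ p).neg) (fun p => (σ p).neg) b) ∨
        ∃ a, IsBridgeDec r' r x z (fun p => (τ p).neg) (fun p => (σ p).neg) a := by
      rcases hex with ⟨b, hb⟩ | ⟨a, ha⟩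
      · exact Or.inr ⟨_, (isDecBridge_dual h).1 hb⟩
      · exact Or.inl ⟨_, (isBridgeDec_dual h).1 ha⟩
    rcases decBridgeCases_of_merge h.symm (h.fission h0).1 hτ.neg hσ.neg hex' with
      ⟨p, b, a, hx, hz, h1, h2, h3, h4⟩ | ⟨b₁, b₂, a, h1, h2, h3, h4, h5⟩
    · have hr := (h.fission h0).2
      refine .off p (fun p => (a p).neg) (fun p => (b p).neg) ?_ ?_ (by simpa using h2.dual)
        (by simpa using h1.dual) ?_ ?_
      · rw [hr]
        rintro (k | ⟨k, k'⟩ | ⟨k, k'⟩)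
        exacts [hx k, hz k', hx k']
      · rw [hr]
        rintro (k | ⟨k, k'⟩ | ⟨k, k'⟩)
        exacts [hz k, hz k', hx k']
      · intro c; rw [isDecBridge_dual h, h4, hA]
      · intro c; rw [isBridgeDec_dual h, h3, hA]
    · refine .fission (fun p => (a p).neg) (fun p => (b₁ p).neg) (fun p => (b₂ p).neg) h0
        (by simpa using h3.dual) (by simpa using h1.dual) (by simpa using h2.dual) ?_ ?_
      · intro c; rw [isDecBridge_dual h, h5, hA]
      · intro c; rw [isBridgeDec_dual h, h4, hA, hA]
  · rcases decBridgeCases_of_merge h h0 hσ hτ hex with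
      ⟨p, b, a, hx, hz, h1, h2, h3, h4⟩ | ⟨b₁, b₂, a, h1, h2, h3, h4, h5⟩
    · exact .off p b a hx hz h1 h2 h3 h4
    · exact .merge b₁ b₂ a h0 h1 h2 h3 h4 h5

/-- A saddle there and back changes one sign. -/
theorem IsMid.exists_decrease (h : Saddle r r₁ x z) (hσ : Inv r σ) (hτ : Inv r τ)
    (hm : IsMid r r₁ x z x z σ τ a) : ∃ p, Decrease r p σ τ := by
  by_cases h0 : r x z
  · obtain ⟨e⟩ := nonempty_isMid_equiv_of_genus h h0 hσ hτ
    obtain ⟨-, h1, h2, h3⟩ := e ⟨a, hm⟩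
    exact ⟨x, h1, h2, fun q hq => h3 q fun hq' => hq (r.symm hq')⟩
  · obtain ⟨hi, ⟨a1, a2, -⟩, ⟨b1, -, b2⟩⟩ := hm
    have a2 := mergeRule_iff.1 (a2 h0)
    have b2 := fissionRule_iff.1 (b2 (h.rel_merge h0))
    have hoff : ∀ q, ¬ r x q → ¬ r z q → τ q = σ q := by
      intro q hx hz
      have e1 : ¬ r q x := fun k => hx (r.symm k)
      have e2 : ¬ r q z := fun k => hz (r.symm k)
      rw [b1 q, a1 q e1 e2] <;> rw [h.merge h0]
      · rintro (k | ⟨k, k'⟩ | ⟨k, k'⟩)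
        exacts [e1 k, e1 k, e2 k]
      · rintro (k | ⟨k, k'⟩ | ⟨k, k'⟩)
        exacts [e2 k, e1 k, e2 k]
    have key : (σ x = .plus ∧ τ x = .minus ∧ τ z = σ z) ∨
        (σ z = .plus ∧ τ z = .minus ∧ τ x = σ x) := by grind
    rcases key with ⟨k1, k2, k3⟩ | ⟨k1, k2, k3⟩
    · refine ⟨x, k1, k2, fun q hq => ?_⟩
      by_cases hz : r z q
      · rw [← hσ _ _ hz, ← hτ _ _ hz, k3]
      · exact hoff q hq hz
    · refine ⟨z, k1, k2, fun q hq => ?_⟩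
      by_cases hx : r x q
      · rw [← hσ _ _ hx, ← hτ _ _ hx, k3]
      · exact hoff q hx hq

end DecBridge

/-! ### Squares of decoration edges and bridge edges -/

noncomputable section DecSquares

variable {R : Type*} [CommRing R] {n : ℕ} {s : Side} {v w a b c : DecLink n}
  {x z p q : Fin (2 * n)}

open PlanarMatching

theorem DecStep.decrease (h : DecStep p v w) : Decrease v.link.setoid p v.sign w.sign :=
  ⟨h.source, h.target, h.off⟩

theorem decStep_iff : DecStep p v w ↔
    w.link = v.link ∧ Decrease v.link.setoid p v.sign w.sign :=
  ⟨fun h => ⟨h.link_eq, h.decrease⟩, fun h => ⟨h.1, h.2.1, h.2.2, h.2.3⟩⟩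

theorem DecStep.eq_of_source (h : DecStep p v b) (h' : DecStep p v c) : b = c := by
  refine DecLink.ext_sign (h.link_eq.trans h'.link_eq.symm) fun q => ?_
  by_cases hq : v.link.setoid p q
  · have h1 : b.link.setoid p q := by rw [h.link_eq]; exact hq
    have h2 : c.link.setoid p q := by rw [h'.link_eq]; exact hq
    rw [← b.inv_sign _ _ h1, ← c.inv_sign _ _ h2, h.target, h'.target]
  · rw [h.off q hq, h'.off q hq]

theorem DecStep.eq_of_target (h : DecStep p b w) (h' : DecStep p c w) : b = c := by
  have hl := h.link_eq.symm.trans h'.link_eq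
  refine DecLink.ext_sign hl fun q => ?_
  by_cases hq : b.link.setoid p q
  · have h2 : c.link.setoid p q := by rw [← hl]; exact hq
    rw [← b.inv_sign _ _ hq, ← c.inv_sign _ _ h2, h.source, h'.source]
  · rw [← h.off q hq, ← h'.off q (by rwa [← hl])]

/-- The squares formed by decoration edges and bridge edges. -/
inductive DecSquare (s : Side) (v w : DecLink n) : Prop
  | off (x z p : Fin (2 * n)) (b a : DecLink n) (hx : ¬ v.link.setoid x p)
      (hz : ¬ v.link.setoid z p) (hb : DecStep p v b) (hb' : BridgeStep s x z b w)
      (ha : BridgeStep s x z v a) (ha' : DecStep p a w)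
      (hB : ∀ c, (∃ p, DecStep p v c) → (∃ x z, BridgeStep s x z c w) → c = b)
      (hA : ∀ c, (∃ x z, BridgeStep s x z v c) → (∃ p, DecStep p c w) → c = a)
  | merge (x z : Fin (2 * n)) (b₁ b₂ a : DecLink n) (h : ¬ v.link.setoid x z)
      (hb₁ : DecStep x v b₁) (hb₁' : BridgeStep s x z b₁ w) (hb₂ : DecStep z v b₂)
      (hb₂' : BridgeStep s x z b₂ w) (ha : BridgeStep s x z v a) (ha' : DecStep x a w)
      (hB : ∀ c, (∃ p, DecStep p v c) → (∃ x z, BridgeStep s x z c w) → c = b₁ ∨ c = b₂)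
      (hA : ∀ c, (∃ x z, BridgeStep s x z v c) → (∃ p, DecStep p c w) → c = a)
  | fission (x z : Fin (2 * n)) (b a₁ a₂ : DecLink n) (h : v.link.setoid x z)
      (hb : DecStep x v b) (hb' : BridgeStep s x z b w) (ha₁ : BridgeStep s x z v a₁)
      (ha₁' : DecStep x a₁ w) (ha₂ : BridgeStep s x z v a₂) (ha₂' : DecStep z a₂ w)
      (hB : ∀ c, (∃ p, DecStep p v c) → (∃ x z, BridgeStep s x z c w) → c = b)
      (hA : ∀ c, (∃ x z, BridgeStep s x z v c) → (∃ p, DecStep p c w) → c = a₁ ∨ c = a₂)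

/-- Decoration edges keep the link, so the ends v and w already determine the surgery, and only the
classification of signs by `decBridgeCases` is left. -/
theorem decSquare (h : (∃ b, (∃ p, DecStep p v b) ∧ ∃ x z, BridgeStep s x z b w) ∨
    ∃ a, (∃ x z, BridgeStep s x z v a) ∧ ∃ p, DecStep p a w) : DecSquare s v w := by
  obtain ⟨x, z, hs, ho, hex⟩ : ∃ x z, Surgery (v.link.half s) (w.link.half s) x z ∧
      w.link.half s.other = v.link.half s.other ∧
      ((∃ b, IsDecBridge v.link.setoid x z v.sign w.sign b) ∨
        ∃ a, IsBridgeDec v.link.setoid w.link.setoid x z v.sign w.sign a) := by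
    rcases h with ⟨b, ⟨p, h1⟩, x, z, h2⟩ | ⟨a, ⟨x, z, h2⟩, p, h1⟩
    · have h3 := h2.surgery
      have h4 := h2.other
      have h5 := b.inv_sign
      have h6 := h2.transition
      rw [h1.link_eq] at h3 h4 h5 h6
      exact ⟨x, z, h3, h4, Or.inl ⟨_, h5, ⟨p, h1.decrease⟩, h6⟩⟩
    · have h3 := h2.surgery
      have h4 := h2.other
      have h5 := a.inv_sign
      have h6 := h1.decrease
      rw [← h1.link_eq] at h3 h4 h5 h6
      exact ⟨x, z, h3, h4, Or.inr ⟨_, h5, h2.transition, p, h6⟩⟩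
  have toB : ∀ {σ}, IsDecBridge v.link.setoid x z v.sign w.sign σ →
      BridgeStep s x z (DecLink.ofSign v.link σ) w := fun {σ} h =>
    ⟨hs, ho, by rw [DecLink.sign_ofSign h.inv]; exact h.bridge⟩
  have toA : ∀ {σ}, IsBridgeDec v.link.setoid w.link.setoid x z v.sign w.sign σ →
      BridgeStep s x z v (DecLink.ofSign w.link σ) := fun {σ} h =>
    ⟨hs, ho, by rw [DecLink.sign_ofSign h.inv]; exact h.bridge⟩
  have decB : ∀ {σ p}, Inv v.link.setoid σ → Decrease v.link.setoid p v.sign σ →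
      DecStep p v (DecLink.ofSign v.link σ) := fun {σ p} hi h =>
    decStep_iff.2 ⟨rfl, by rw [DecLink.sign_ofSign hi]; exact h⟩
  have decA : ∀ {σ p}, Inv w.link.setoid σ → Decrease w.link.setoid p σ w.sign →
      DecStep p (DecLink.ofSign w.link σ) w := fun {σ p} hi h =>
    decStep_iff.2 ⟨rfl, by rw [DecLink.sign_ofSign hi]; exact h⟩
  have fromB : ∀ c, (∃ p, DecStep p v c) → (∃ x z, BridgeStep s x z c w) →
      IsDecBridge v.link.setoid x z v.sign w.sign c.sign ∧
        c = DecLink.ofSign v.link c.sign := by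
    rintro c ⟨p, h1⟩ ⟨x', z', h2⟩
    have h2 := (h2.of_surgery (x := x) (z := z) (by rwa [h1.link_eq])).transition
    have h3 := c.inv_sign
    rw [h1.link_eq] at h2 h3
    refine ⟨⟨h3, ⟨p, h1.decrease⟩, h2⟩, DecLink.ext_sign h1.link_eq fun q => ?_⟩
    rw [DecLink.sign_ofSign h3]
  have fromA : ∀ c, (∃ x z, BridgeStep s x z v c) → (∃ p, DecStep p c w) →
      IsBridgeDec v.link.setoid w.link.setoid x z v.sign w.sign c.sign ∧
        c = DecLink.ofSign w.link c.sign := by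
    rintro c ⟨x', z', h2⟩ ⟨p, h1⟩
    have h2 := (h2.of_surgery (x := x) (z := z) (by rwa [← h1.link_eq])).transition
    have h3 := c.inv_sign
    have h4 := h1.decrease
    rw [← h1.link_eq] at h3 h4
    refine ⟨⟨h3, h2, p, h4⟩, DecLink.ext_sign h1.link_eq.symm fun q => ?_⟩
    rw [DecLink.sign_ofSign h3]
  rcases decBridgeCases (saddle_of_surgery hs ho) v.inv_sign w.inv_sign hex with
    ⟨p, b, a, hx, hz, hb, ha, hB, hA⟩ | ⟨b₁, b₂, a, h0, hb₁, hb₂, ha, hB, hA⟩ |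
    ⟨b, a₁, a₂, h0, hb, ha₁, ha₂, hB, hA⟩
  · have h1 := (hB b).2 rfl
    have h2 := (hA a).2 rfl
    refine .off x z p _ _ hx hz (decB h1.inv hb) (toB h1) (toA h2) (decA h2.inv ha)
      (fun c hc hc' => ?_) fun c hc hc' => ?_
    · obtain ⟨k1, k2⟩ := fromB c hc hc'
      rw [k2, (hB _).1 k1]
    · obtain ⟨k1, k2⟩ := fromA c hc hc'
      rw [k2, (hA _).1 k1]
  · have h1 := (hB b₁).2 (Or.inl rfl)
    have h1' := (hB b₂).2 (Or.inr rfl)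
    have h2 := (hA a).2 rfl
    refine .merge x z _ _ _ h0 (decB h1.inv hb₁) (toB h1) (decB h1'.inv hb₂) (toB h1') (toA h2)
      (decA h2.inv ha) (fun c hc hc' => ?_) fun c hc hc' => ?_
    · obtain ⟨k1, k2⟩ := fromB c hc hc'
      rw [k2]
      exact ((hB _).1 k1).imp (fun k => by rw [k]) fun k => by rw [k]
    · obtain ⟨k1, k2⟩ := fromA c hc hc'
      rw [k2, (hA _).1 k1]
  · have h1 := (hB b).2 rfl
    have h2 := (hA a₁).2 (Or.inl rfl)
    have h2' := (hA a₂).2 (Or.inr rfl)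
    refine .fission x z _ _ _ h0 (decB h1.inv hb) (toB h1) (toA h2) (decA h2.inv ha₁) (toA h2')
      (decA h2'.inv ha₂) (fun c hc hc' => ?_) fun c hc hc' => ?_
    · obtain ⟨k1, k2⟩ := fromB c hc hc'
      rw [k2, (hB _).1 k1]
    · obtain ⟨k1, k2⟩ := fromA c hc hc'
      rw [k2]
      exact ((hA _).1 k1).imp (fun k => by rw [k]) fun k => by rw [k]

/-- Morphisms between vertices which are zero off the decoration edges. -/
def DecSupported (F : ∀ v w : DecLink n, bObj R v ⟶ bObj R w) : Prop :=
  ∀ v w, F v w ≠ 0 → ∃ p, DecStep p v w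

variable {F : ∀ v w : DecLink n, bObj R v ⟶ bObj R w}

theorem homMul_eq_single {X Y : ∀ v w : DecLink n, bObj R v ⟶ bObj R w} (b : DecLink n)
    (h : ∀ c, X v c ≠ 0 → Y c w ≠ 0 → c = b) : homMul X Y v w = X v b ≫ Y b w := by
  refine Finset.sum_eq_single b (fun c _ hc => ?_) fun hb => absurd (Finset.mem_univ b) hb
  by_cases h1 : X v c = 0
  · rw [h1, Limits.zero_comp]
  by_cases h2 : Y c w = 0
  · rw [h2, Limits.comp_zero]
  exact absurd (h c h1 h2) hc

theorem homMul_eq_pair {X Y : ∀ v w : DecLink n, bObj R v ⟶ bObj R w} (b₁ b₂ : DecLink n)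
    (hb : b₁ ≠ b₂) (h : ∀ c, X v c ≠ 0 → Y c w ≠ 0 → c = b₁ ∨ c = b₂) :
    homMul X Y v w = X v b₁ ≫ Y b₁ w + X v b₂ ≫ Y b₂ w := by
  classical
  rw [← Finset.sum_pair (f := fun c => X v c ≫ Y c w) hb]
  refine (Finset.sum_subset (Finset.subset_univ _) fun c _ hc => ?_).symm
  by_cases h1 : X v c = 0
  · rw [h1, Limits.zero_comp]
  by_cases h2 : Y c w = 0
  · rw [h2, Limits.comp_zero]
  exact absurd (h c h1 h2) (by simpa using hc)

theorem homMul_eq_zero {X Y : ∀ v w : DecLink n, bObj R v ⟶ bObj R w}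
    (h : ∀ c, X v c ≠ 0 → Y c w ≠ 0 → False) : homMul X Y v w = 0 := by
  refine Finset.sum_eq_zero fun c _ => ?_
  by_cases h1 : X v c = 0
  · rw [h1, Limits.zero_comp]
  by_cases h2 : Y c w = 0
  · rw [h2, Limits.comp_zero]
  exact (h c h1 h2).elim

theorem decStep_of_rightHom_ne_zero (h : rightHom R p v w ≠ 0) : DecStep p v w :=
  not_imp_comm.1 rightHom_eq_zero h

theorem disjoint_support {t : Side} (hx : ¬ v.link.setoid x p) (hz : ¬ v.link.setoid z p) :
    Disjoint (v.link.circleAt p) (v.link.support (arcPair (v.link.half t) x z)) := by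
  rw [Set.disjoint_left]
  intro q h1 h2
  rcases mem_support.1 h2 with h2 | h2
  · exact hx (v.link.setoid.trans h2 (v.link.setoid.symm h1))
  · exact hz (v.link.setoid.trans h2 (v.link.setoid.symm h1))

/-- A circle which does not meet the support of a bridge is not changed by the surgery. -/
theorem Saddle.rel_iff_of_not {α : Type*} {r r' : Setoid α} {x z p q : α} (h : Saddle r r' x z)
    (hx : ¬ r x p) (hz : ¬ r z p) : r' p q ↔ r p q := by
  by_cases h0 : r x z
  · rw [(h.fission h0).2]
    refine ⟨Or.inl, ?_⟩
    have : ∀ {p q}, r' p q → r p q := h.symm.le (h.fission h0).1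
    rintro (k | ⟨k, -⟩ | ⟨k, -⟩)
    · exact k
    · exact absurd (r.symm (this k)) hx
    · exact absurd (r.symm (this k)) hz
  · rw [h.merge h0]
    refine ⟨?_, Or.inl⟩
    rintro (k | ⟨k, -⟩ | ⟨k, -⟩)
    · exact k
    · exact absurd (r.symm k) hx
    · exact absurd (r.symm k) hz

theorem BridgeStep.circleAt_eq (h : BridgeStep s x z v a) (hx : ¬ v.link.setoid x p)
    (hz : ¬ v.link.setoid z p) : a.link.circleAt p = v.link.circleAt p := by
  ext q
  exact h.saddle.rel_iff_of_not hx hz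

/-- The relation for a decoration edge and a bridge edge with disjoint supports. -/
theorem decHom_comp_bridgeHom_of_off {t : Side} (hx : ¬ v.link.setoid x p)
    (hz : ¬ v.link.setoid z p) (hb : DecStep p v b) (hb' : BridgeStep s x z b w)
    (ha : BridgeStep s x z v a) (ha' : DecStep p a w) :
    decHom R t v b ≫ bridgeHom R s b w =
      koszul t s • (bridgeHom R s v a ≫ decHom R t a w) := by
  have e1 := isDecorationEdge_circleAt.2 hb
  have e2 := hb'.isBridgeEdge
  rw [hb.link_eq] at e2
  have e3 := ha.isBridgeEdge
  have e4 := isDecorationEdge_circleAt.2 ha'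
  rw [ha.circleAt_eq hx hz] at e4
  have := map_relator (Relator.disjoint (R := R) (.decoration t _ e1) (.bridge s _ e2)
    (.bridge s _ e3) (.decoration t _ e4) (disjoint_support hx hz) ⟨rfl, rfl⟩ ⟨rfl, rfl⟩)
  rw [Functor.map_sub, Units.smul_def, Functor.map_zsmul, Functor.map_comp, Functor.map_comp,
    sub_eq_zero] at this
  rw [decHom_eq e1, bridgeHom_eq e2, bridgeHom_eq e3, decHom_eq e4, this]
  rfl

theorem mem_footCircles_dagger (h : BridgeStep s x z v a) {C : Set (Fin (2 * n))} :
    C ∈ a.link.footCircles (v.dagger s a) ↔ C = a.link.circleAt x ∨ C = a.link.circleAt z := by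
  rw [DecLink.dagger, h.surgery.dagger_eq, mem_footCircles]

/-- The relation for right decoration edges at a foot of a merge. -/
theorem rightDec_comp_merge (h0 : ¬ v.link.setoid x z) (hb : DecStep x v b)
    (hb' : BridgeStep s x z b w) (ha : BridgeStep s x z v a) (ha' : DecStep x a w) :
    decHom R .right v b ≫ bridgeHom R s b w = bridgeHom R s v a ≫ decHom R .right a w := by
  have e1 := isDecorationEdge_circleAt.2 hb
  have e2 := hb'.isBridgeEdge
  rw [hb.link_eq] at e2
  have e3 := ha.isBridgeEdge
  have e4 := isDecorationEdge_circleAt.2 ha'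
  have := map_relator (Relator.right_merge (R := R) e1 e2 e3 e4 (isMerge_iff.2 h0)
    (mem_footCircles.2 (Or.inl rfl)) ((mem_footCircles_dagger ha).2 (Or.inl rfl)))
  rw [Functor.map_sub, Functor.map_comp, Functor.map_comp, sub_eq_zero] at this
  rw [decHom_eq e1, bridgeHom_eq e2, bridgeHom_eq e3, decHom_eq e4]
  exact this

/-- The relation for right decoration edges at a foot of a division. -/
theorem rightDec_comp_fission (h0 : v.link.setoid x z) (hb : DecStep x v b)
    (hb' : BridgeStep s x z b w) (ha : BridgeStep s x z v a) (ha' : DecStep x a w) :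
    decHom R .right v b ≫ bridgeHom R s b w = bridgeHom R s v a ≫ decHom R .right a w := by
  have e1 := isDecorationEdge_circleAt.2 hb
  have e2 := hb'.isBridgeEdge
  rw [hb.link_eq] at e2
  have e3 := ha.isBridgeEdge
  have e4 := isDecorationEdge_circleAt.2 ha'
  have := map_relator (Relator.right_fission (R := R) e1 e2 e3 e4 (isFission_iff.2 h0)
    (mem_footCircles.2 (Or.inl rfl)) ((mem_footCircles_dagger ha).2 (Or.inl rfl)))
  rw [Functor.map_sub, Functor.map_comp, Functor.map_comp, sub_eq_zero] at this
  rw [decHom_eq e1, bridgeHom_eq e2, bridgeHom_eq e3, decHom_eq e4]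
  exact this

theorem leftDec_comp_merge {b₁ b₂ : DecLink n} (h0 : ¬ v.link.setoid x z) (hb₁ : DecStep x v b₁)
    (hb₁' : BridgeStep s x z b₁ w) (hb₂ : DecStep z v b₂) (hb₂' : BridgeStep s x z b₂ w)
    (ha : BridgeStep s x z v a) (ha' : DecStep x a w) :
    decHom R .left v b₁ ≫ bridgeHom R s b₁ w + decHom R .left v b₂ ≫ bridgeHom R s b₂ w =
      s.parity.negOnePow • (bridgeHom R s v a ≫ decHom R .left a w) := by
  have e1 := isDecorationEdge_circleAt.2 hb₁
  have e2 := hb₁'.isBridgeEdge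
  rw [hb₁.link_eq] at e2
  have e1' := isDecorationEdge_circleAt.2 hb₂
  have e2' := hb₂'.isBridgeEdge
  rw [hb₂.link_eq] at e2'
  have e3 := ha.isBridgeEdge
  have e4 := isDecorationEdge_circleAt.2 ha'
  have := map_relator (Relator.left_merge (R := R) e1 e2 e1' e2' e3 e4
    (mem_footCircles.2 (Or.inl rfl)) (mem_footCircles.2 (Or.inr rfl))
    (fun h => h0 (CleavedLink.circleAt_eq_iff.1 h)) ((mem_footCircles_dagger ha).2 (Or.inl rfl)))
  rw [Functor.map_sub, Functor.map_add, Units.smul_def, Functor.map_zsmul, Functor.map_comp,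
    Functor.map_comp, Functor.map_comp, sub_eq_zero] at this
  rw [decHom_eq e1, bridgeHom_eq e2, decHom_eq e1', bridgeHom_eq e2', bridgeHom_eq e3,
    decHom_eq e4, this]
  rfl

theorem leftDec_comp_fission {a₁ a₂ : DecLink n} (h0 : v.link.setoid x z) (hb : DecStep x v b)
    (hb' : BridgeStep s x z b w) (ha₁ : BridgeStep s x z v a₁) (ha₁' : DecStep x a₁ w)
    (ha₂ : BridgeStep s x z v a₂) (ha₂' : DecStep z a₂ w) :
    decHom R .left v b ≫ bridgeHom R s b w = s.parity.negOnePow •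
      (bridgeHom R s v a₁ ≫ decHom R .left a₁ w + bridgeHom R s v a₂ ≫ decHom R .left a₂ w) := by
  have e1 := isDecorationEdge_circleAt.2 hb
  have e2 := hb'.isBridgeEdge
  rw [hb.link_eq] at e2
  have e3 := ha₁.isBridgeEdge
  have e4 := isDecorationEdge_circleAt.2 ha₁'
  have e3' := ha₂.isBridgeEdge
  have e4' := isDecorationEdge_circleAt.2 ha₂'
  have hne : a₁.link.circleAt x ≠ a₂.link.circleAt z := by
    rw [← ha₁'.link_eq, ← ha₂'.link_eq, ne_eq, CleavedLink.circleAt_eq_iff, ha₁'.link_eq]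
    exact (ha₁.saddle.fission h0).1
  have := map_relator (Relator.left_fission (R := R) e1 e2 e3 e4 e3' e4' (isFission_iff.2 h0)
    (mem_footCircles.2 (Or.inl rfl)) ((mem_footCircles_dagger ha₁).2 (Or.inl rfl))
    ((mem_footCircles_dagger ha₂).2 (Or.inr rfl)) hne)
  rw [Functor.map_sub, Units.smul_def, Functor.map_zsmul, Functor.map_add, Functor.map_comp,
    Functor.map_comp, Functor.map_comp, sub_eq_zero] at this
  rw [decHom_eq e1, bridgeHom_eq e2, decHom_eq e4, bridgeHom_eq e3, bridgeHom_eq e3',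
    decHom_eq e4', this]
  rfl

theorem DecStep.ne_of_not_rel (hb : DecStep x v b) (hc : DecStep z v c)
    (h : ¬ v.link.setoid x z) : b ≠ c := by
  rintro rfl; exact h (hb.rel hc)

theorem DecStep.rel_target (h : DecStep x b w) (h' : DecStep z b w) : w.link.setoid x z := by
  rw [h.link_eq]; exact h.rel h'

/-- Left decorations anticommute with left bridges. -/
theorem homMul_leftDec_bridgeHom (v w : DecLink n) :
    homMul (decHom R .left) (bridgeHom R .left) v w =
      -homMul (bridgeHom R .left) (decHom R .left) v w := by
  have hB : ∀ c, decHom R .left v c ≠ 0 → bridgeHom R .left c w ≠ 0 →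
      (∃ p, DecStep p v c) ∧ ∃ x z, BridgeStep .left x z c w := fun c h h' =>
    ⟨exists_of_decHom_ne_zero h, exists_of_bridgeHom_ne_zero h'⟩
  have hA : ∀ c, bridgeHom R .left v c ≠ 0 → decHom R .left c w ≠ 0 →
      (∃ x z, BridgeStep .left x z v c) ∧ ∃ p, DecStep p c w := fun c h h' =>
    ⟨exists_of_bridgeHom_ne_zero h, exists_of_decHom_ne_zero h'⟩
  by_cases h : (∃ b, (∃ p, DecStep p v b) ∧ ∃ x z, BridgeStep .left x z b w) ∨
    ∃ a, (∃ x z, BridgeStep .left x z v a) ∧ ∃ p, DecStep p a w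
  -- Each type of square is the content of one relation: disjoint supports, a merge or a division.
  -- With a left bridge the sign is -1 in all three.
  · rcases decSquare h with ⟨x, z, p, b, a, hx, hz, k1, k2, k3, k4, kB, kA⟩ |
      ⟨x, z, b₁, b₂, a, h0, k1, k2, k1', k2', k3, k4, kB, kA⟩ |
      ⟨x, z, b, a₁, a₂, h0, k1, k2, k3, k4, k3', k4', kB, kA⟩
    · rw [homMul_eq_single b fun c h h' => kB c (hB c h h').1 (hB c h h').2,
        homMul_eq_single a fun c h h' => kA c (hA c h h').1 (hA c h h').2,
        decHom_comp_bridgeHom_of_off hx hz k1 k2 k3 k4]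
      simp [koszul, Side.parity]
    · rw [homMul_eq_pair b₁ b₂ (k1.ne_of_not_rel k1' h0)
          fun c h h' => kB c (hB c h h').1 (hB c h h').2,
        homMul_eq_single a fun c h h' => kA c (hA c h h').1 (hA c h h').2,
        leftDec_comp_merge h0 k1 k2 k1' k2' k3 k4]
      simp [Side.parity]
    · have hne : a₁ ≠ a₂ := by
        rintro rfl
        refine (k3.saddle.fission h0).1 ?_
        rw [← k4.link_eq]
        exact k4.rel_target k4'
      rw [homMul_eq_single b fun c h h' => kB c (hB c h h').1 (hB c h h').2,
        homMul_eq_pair a₁ a₂ hne fun c h h' => kA c (hA c h h').1 (hA c h h').2,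
        leftDec_comp_fission h0 k1 k2 k3 k4 k3' k4']
      simp [Side.parity, add_comm]
  · rw [not_or] at h
    rw [homMul_eq_zero fun c h1 h2 => h.1 ⟨c, hB c h1 h2⟩,
      homMul_eq_zero fun c h1 h2 => h.2 ⟨c, hA c h1 h2⟩, neg_zero]

end DecSquares

/-! ### Commutation of left squares with all edges -/

noncomputable section Commutation

variable {R : Type*} [CommRing R] {n : ℕ} {s : Side} {v w a b c : DecLink n}
  {x z p q : Fin (2 * n)}

open PlanarMatching

theorem BridgeStep.rel_target_iff_of_merge (h : BridgeStep s x z v a) (h0 : ¬ v.link.setoid x z) :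
    a.link.setoid x p ↔ v.link.setoid x p ∨ v.link.setoid z p := by
  rw [h.saddle.merge h0]
  constructor
  · rintro (k | ⟨-, k⟩ | ⟨-, k⟩)
    exacts [Or.inl k, Or.inr k, Or.inl k]
  · rintro (k | k)
    exacts [Or.inl k, Or.inr (Or.inl ⟨v.link.setoid.refl x, k⟩)]

theorem BridgeStep.symm_rel_iff (h : BridgeStep s x z v a) (h0 : v.link.setoid x z) :
    v.link.setoid x p ↔ a.link.setoid x p ∨ a.link.setoid z p := by
  rw [(h.saddle.fission h0).2]
  constructor
  · rintro (k | ⟨-, k⟩ | ⟨-, k⟩)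
    exacts [Or.inl k, Or.inr k, Or.inl k]
  · rintro (k | k)
    exacts [Or.inl k, Or.inr (Or.inl ⟨a.link.setoid.refl x, k⟩)]

/-- Right decorations commute with left bridges. -/
theorem homMul_rightHom_bridgeHom (p : Fin (2 * n)) (v w : DecLink n) :
    homMul (rightHom R p) (bridgeHom R .left) v w =
      homMul (bridgeHom R .left) (rightHom R p) v w := by
  -- For right decorations each term of the relation is separately equal to the other side, with no
  -- sum, so the full decoration matrix would give a factor 2. Fixing the marked point p selects at
  -- most one term on each side.
  have hB : ∀ c, rightHom R p v c ≠ 0 → bridgeHom R .left c w ≠ 0 →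
      DecStep p v c ∧ ∃ x z, BridgeStep .left x z c w := fun c h h' =>
    ⟨decStep_of_rightHom_ne_zero h, exists_of_bridgeHom_ne_zero h'⟩
  have hA : ∀ c, bridgeHom R .left v c ≠ 0 → rightHom R p c w ≠ 0 →
      (∃ x z, BridgeStep .left x z v c) ∧ DecStep p c w := fun c h h' =>
    ⟨exists_of_bridgeHom_ne_zero h, decStep_of_rightHom_ne_zero h'⟩
  have key : ∀ b a, DecStep p v b → DecStep p a w →
      decHom R .right v b ≫ bridgeHom R .left b w =
        bridgeHom R .left v a ≫ decHom R .right a w →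
      homMul (rightHom R p) (bridgeHom R .left) v w =
        homMul (bridgeHom R .left) (rightHom R p) v w := by
    intro b a hb ha he
    rw [homMul_eq_single b fun c h h' => (hB c h h').1.eq_of_source hb,
      homMul_eq_single a fun c h h' => (hA c h h').2.eq_of_target ha,
      rightHom_eq hb, rightHom_eq ha, he]
  have zero : (∀ b, DecStep p v b → (∃ x z, BridgeStep .left x z b w) → False) →
      (∀ a, (∃ x z, BridgeStep .left x z v a) → DecStep p a w → False) →
      homMul (rightHom R p) (bridgeHom R .left) v w =
        homMul (bridgeHom R .left) (rightHom R p) v w := by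
    intro h1 h2
    rw [homMul_eq_zero fun c h h' => h1 c (hB c h h').1 (hB c h h').2,
      homMul_eq_zero fun c h h' => h2 c (hA c h h').1 (hA c h h').2]
  by_cases h : (∃ b, (∃ p, DecStep p v b) ∧ ∃ x z, BridgeStep .left x z b w) ∨
    ∃ a, (∃ x z, BridgeStep .left x z v a) ∧ ∃ p, DecStep p a w
  · rcases decSquare h with ⟨x, z, q, b, a, hx, hz, k1, k2, k3, k4, kB, kA⟩ |
      ⟨x, z, b₁, b₂, a, h0, k1, k2, k1', k2', k3, k4, kB, kA⟩ |
      ⟨x, z, b, a₁, a₂, h0, k1, k2, k3, k4, k3', k4', kB, kA⟩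
    · have e : a.link.setoid q p ↔ v.link.setoid q p := k3.saddle.rel_iff_of_not hx hz
      by_cases hp : v.link.setoid q p
      · refine key b a (k1.congr hp) (k4.congr (e.2 hp)) ?_
        rw [decHom_comp_bridgeHom_of_off hx hz k1 k2 k3 k4]
        simp [koszul, Side.parity]
      · refine zero (fun c hc hc' => hp ?_) fun c hc hc' => hp (e.1 ?_)
        · obtain rfl := kB c ⟨p, hc⟩ hc'
          exact k1.rel hc
        · obtain rfl := kA c hc ⟨p, hc'⟩
          exact k4.rel hc'
    · have e : a.link.setoid x p ↔ v.link.setoid x p ∨ v.link.setoid z p :=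
        k3.rel_target_iff_of_merge h0
      by_cases hp : v.link.setoid x p
      · exact key b₁ a (k1.congr hp) (k4.congr (e.2 (Or.inl hp)))
          (rightDec_comp_merge h0 k1 k2 k3 k4)
      by_cases hp' : v.link.setoid z p
      · have k4' : DecStep z a w := k4.congr
          ((k3.rel_target_iff_of_merge h0).2 (Or.inr (v.link.setoid.refl z)))
        exact key b₂ a (k1'.congr hp') (k4.congr (e.2 (Or.inr hp')))
          (rightDec_comp_merge (fun h => h0 (v.link.setoid.symm h)) k1' k2'.comm k3.comm k4')
      · refine zero (fun c hc hc' => ?_) fun c hc hc' => ?_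
        · rcases kB c ⟨p, hc⟩ hc' with rfl | rfl
          · exact hp (k1.rel hc)
          · exact hp' (k1'.rel hc)
        · obtain rfl := kA c hc ⟨p, hc'⟩
          exact (e.1 (k4.rel hc')).elim hp hp'
    · have e : v.link.setoid x p ↔ a₁.link.setoid x p ∨ a₁.link.setoid z p := k3.symm_rel_iff h0
      have hl : a₁.link = a₂.link := k4.link_eq.symm.trans k4'.link_eq
      by_cases hp : a₁.link.setoid x p
      · exact key b a₁ (k1.congr (e.2 (Or.inl hp))) (k4.congr hp)
          (rightDec_comp_fission h0 k1 k2 k3 k4)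
      by_cases hp' : a₁.link.setoid z p
      · exact key b a₂ (k1.congr (e.2 (Or.inr hp'))) (k4'.congr (by rwa [← hl]))
          (rightDec_comp_fission (v.link.setoid.symm h0) (k1.congr h0) k2.comm k3'.comm k4')
      · refine zero (fun c hc hc' => ?_) fun c hc hc' => ?_
        · obtain rfl := kB c ⟨p, hc⟩ hc'
          exact (e.1 (k1.rel hc)).elim hp hp'
        · rcases kA c hc ⟨p, hc'⟩ with rfl | rfl
          · exact hp (k4.rel hc')
          · exact hp' (by rw [hl]; exact k4'.rel hc')
  · rw [not_or] at h
    exact zero (fun b hb hb' => h.1 ⟨b, ⟨p, hb⟩, hb'⟩) fun a ha ha' => h.2 ⟨a, ha, p, ha'⟩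

/-- The links agree by `leftSquare_eq_zero`, so the second surgery undoes the first, and a saddle
there and back lowers the sign of one circle. -/
theorem exists_decStep_of_leftSquare_ne_zero (h : leftSquare (R := R) v w ≠ 0) :
    ∃ p, DecStep p v w := by
  have hl : v.link = w.link := not_imp_comm.1 leftSquare_eq_zero h
  obtain ⟨a, -, ha⟩ := Finset.exists_ne_zero_of_sum_ne_zero h
  obtain ⟨x, z, y, u, -, h1, h2⟩ := isMidLink_of_ne_zero ha
  have h3 : BridgeStep .left x z a w := h2.of_surgery (by rw [← hl]; exact h1.surgery.symm)
  have hw := w.inv_sign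
  rw [← hl] at hw
  obtain ⟨p, hp⟩ := IsMid.exists_decrease (a := a.sign) h1.saddle v.inv_sign hw
    ⟨a.inv_sign, h1.transition, h3.transition⟩
  exact ⟨p, decStep_iff.2 ⟨hl.symm, hp⟩⟩

variable (R) in
/-- The matrix of sums of paths of two left bridges. -/
abbrev leftSquares : ∀ v w : DecLink n, bObj R v ⟶ bObj R w :=
  homMul (bridgeHom R .left) (bridgeHom R .left)

theorem decSupported_leftSquares : DecSupported (leftSquares R (n := n)) :=
  fun _ _ h => exists_decStep_of_leftSquare_ne_zero h

/-- A matrix that commutes with the left bridges commutes with their square, by associativity alone.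
-/
theorem leftSquares_comm_of_comm {X : ∀ v w : DecLink n, bObj R v ⟶ bObj R w}
    (h : homMul X (bridgeHom R .left) = homMul (bridgeHom R .left) X) :
    homMul (leftSquares R) X = homMul X (leftSquares R) := by
  rw [homMul_assoc, ← h, ← homMul_assoc, ← h, homMul_assoc]

theorem leftSquares_comm_bridgeHom (s : Side) :
    homMul (leftSquares R (n := n)) (bridgeHom R s) = homMul (bridgeHom R s) (leftSquares R) := by
  refine leftSquares_comm_of_comm ?_
  cases s
  · rfl
  · exact homMul_bridgeHom_comm (by simp)

theorem leftSquares_comm_rightHom (p : Fin (2 * n)) :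
    homMul (leftSquares R) (rightHom R p) = homMul (rightHom R p) (leftSquares R) :=
  leftSquares_comm_of_comm (funext fun v => funext fun w => homMul_rightHom_bridgeHom p v w)

theorem homMul_neg (X Y : ∀ v w : DecLink n, bObj R v ⟶ bObj R w) :
    homMul X (-Y) = -homMul X Y := by
  funext v w
  simp [homMul]

theorem neg_homMul (X Y : ∀ v w : DecLink n, bObj R v ⟶ bObj R w) :
    homMul (-X) Y = -homMul X Y := by
  funext v w
  simp [homMul]

/-- Two sign changes from anticommuting with each of the two left bridges cancel. -/
theorem leftSquares_comm_decHom :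
    homMul (leftSquares R (n := n)) (decHom R .left) =
      homMul (decHom R .left) (leftSquares R) := by
  have h : homMul (bridgeHom R .left) (decHom R .left) =
      -homMul (decHom R (n := n) .left) (bridgeHom R .left) := by
    funext v w
    exact (neg_eq_iff_eq_neg.2 (homMul_leftDec_bridgeHom v w)).symm
  rw [homMul_assoc, h, homMul_neg, ← homMul_assoc, h, neg_homMul, neg_neg, homMul_assoc]

end Commutation

/-! ### Entries of the commutation identities -/

noncomputable section Localization

variable {R : Type*} [CommRing R] {n : ℕ} {s : Side} {v w a b c : DecLink n}
  {γ : Finset (Finset (Fin (2 * n)))} {C C' : Set (Fin (2 * n))}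

open PlanarMatching

theorem DecSupported.exists_dec_bridge {F : ∀ v w : DecLink n, bObj R v ⟶ bObj R w}
    (hF : DecSupported F) (h : F v c ≠ 0) (h' : bridgeHom R s c w ≠ 0) :
    (∃ p, DecStep p v c) ∧ ∃ x z, BridgeStep s x z c w :=
  ⟨hF _ _ h, exists_of_bridgeHom_ne_zero h'⟩

theorem DecSupported.exists_bridge_dec {F : ∀ v w : DecLink n, bObj R v ⟶ bObj R w}
    (hF : DecSupported F) (h' : bridgeHom R s v c ≠ 0) (h : F c w ≠ 0) :
    (∃ x z, BridgeStep s x z v c) ∧ ∃ p, DecStep p c w :=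
  ⟨exists_of_bridgeHom_ne_zero h', hF _ _ h⟩

theorem decSquare_of_edges (h : IsDecorationEdge C v b) (h' : IsBridgeEdge s γ b w) :
    DecSquare s v w := by
  obtain ⟨p, hp, -⟩ := h.exists_decStep
  obtain ⟨x, z, hx, -⟩ := h'.exists_bridgeStep
  exact decSquare (Or.inl ⟨b, ⟨p, hp⟩, x, z, hx⟩)

/-- This is an entry of the commutation of `leftSquares` with bridges. Since `leftSquares` is
supported on decoration pairs, the type of the square tells which middle vertices contribute, here
one on each side. -/
theorem leftSquares_comp_bridgeHom_of_disjoint (h : IsDecorationEdge C v b)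
    (h' : IsBridgeEdge s γ b w) (k : IsBridgeEdge s γ v a) (k' : IsDecorationEdge C a w)
    (hd : Disjoint C (v.link.support γ)) :
    leftSquares R v b ≫ bridgeHom R s b w = bridgeHom R s v a ≫ leftSquares R a w := by
  have hF := decSupported_leftSquares (R := R) (n := n)
  obtain ⟨p, hp, rfl⟩ := h.exists_decStep
  obtain ⟨q, hq, -⟩ := k'.exists_decStep
  obtain ⟨y, u, hy, -⟩ := h'.exists_bridgeStep
  obtain ⟨y', u', hy', rfl⟩ := k.exists_bridgeStep
  -- In a square of merge or division type the changed circle passes through a foot of the bridge,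
  -- against the disjointness of supports.
  have hoff : ∀ {x z}, BridgeStep s x z v a → v.link.setoid p x → False := by
    intro x z hx hpx
    rw [k.eq_arcPair hx.surgery] at hd
    exact Set.disjoint_left.1 hd hpx (mem_support.2 (Or.inl (v.link.setoid.refl x)))
  have hka : ∀ {x z c}, BridgeStep s x z v c → c.link = w.link → BridgeStep s x z v a := by
    intro x z c hc hl
    refine hy'.of_surgery ?_
    have := hc.surgery
    rwa [hl, k'.link_eq] at this
  have key := congrFun (congrFun (leftSquares_comm_bridgeHom (R := R) s) v) w
  rcases decSquare (Or.inl ⟨b, ⟨p, hp⟩, y, u, hy⟩) with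
    ⟨x, z, r, b', a', hx, hz, k1, k2, k3, k4, kB, kA⟩ |
    ⟨x, z, b₁, b₂, a', h0, k1, k2, k1', k2', k3, k4, kB, kA⟩ |
    ⟨x, z, b', a₁, a₂, h0, k1, k2, k3, k4, k3', k4', kB, kA⟩
  · obtain rfl := kB b ⟨p, hp⟩ ⟨y, u, hy⟩
    obtain rfl := kA a ⟨y', u', hy'⟩ ⟨q, hq⟩
    rwa [homMul_eq_single b fun c h1 h2 => kB c (hF.exists_dec_bridge h1 h2).1
        (hF.exists_dec_bridge h1 h2).2,
      homMul_eq_single a fun c h1 h2 => kA c (hF.exists_bridge_dec h1 h2).1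
        (hF.exists_bridge_dec h1 h2).2] at key
  · exfalso
    have := hka k3 k4.link_eq.symm
    rcases kB b ⟨p, hp⟩ ⟨y, u, hy⟩ with rfl | rfl
    · exact hoff this (hp.rel k1)
    · exact hoff this.comm (hp.rel k1')
  · exfalso
    have := hka k3 k4.link_eq.symm
    obtain rfl := kB b ⟨p, hp⟩ ⟨y, u, hy⟩
    exact hoff this (hp.rel k1)

/-- Two different vertices after the decoration edge occur only in a square of merge type, where the
entry of the commutation identity has just these three terms. -/
theorem leftSquares_comp_bridgeHom_of_merge {C₁ C₂ : Set (Fin (2 * n))} {b₁ b₂ : DecLink n}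
    (h₁ : IsDecorationEdge C₁ v b₁) (h₁' : IsBridgeEdge s γ b₁ w)
    (h₂ : IsDecorationEdge C₂ v b₂) (h₂' : IsBridgeEdge s γ b₂ w) (hne : C₁ ≠ C₂)
    (k : IsBridgeEdge s γ v a) (k' : IsDecorationEdge C a w) :
    leftSquares R v b₁ ≫ bridgeHom R s b₁ w + leftSquares R v b₂ ≫ bridgeHom R s b₂ w =
      bridgeHom R s v a ≫ leftSquares R a w := by
  have hF := decSupported_leftSquares (R := R) (n := n)
  have hb : b₁ ≠ b₂ := by rintro rfl; exact hne (h₁.unique h₂)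
  obtain ⟨p₁, hp₁, -⟩ := h₁.exists_decStep
  obtain ⟨p₂, hp₂, -⟩ := h₂.exists_decStep
  obtain ⟨q, hq, -⟩ := k'.exists_decStep
  obtain ⟨y₁, u₁, hy₁, -⟩ := h₁'.exists_bridgeStep
  obtain ⟨y₂, u₂, hy₂, -⟩ := h₂'.exists_bridgeStep
  obtain ⟨y', u', hy', -⟩ := k.exists_bridgeStep
  have key := congrFun (congrFun (leftSquares_comm_bridgeHom (R := R) s) v) w
  rcases decSquare_of_edges h₁ h₁' with
    ⟨x, z, r, b', a', hx, hz, k1, k2, k3, k4, kB, kA⟩ |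
    ⟨x, z, c₁, c₂, a', h0, k1, k2, k1', k2', k3, k4, kB, kA⟩ |
    ⟨x, z, b', a₁, a₂, h0, k1, k2, k3, k4, k3', k4', kB, kA⟩
  · exact absurd ((kB b₁ ⟨_, hp₁⟩ ⟨_, _, hy₁⟩).trans (kB b₂ ⟨_, hp₂⟩ ⟨_, _, hy₂⟩).symm) hb
  · have e₁ := kB b₁ ⟨_, hp₁⟩ ⟨_, _, hy₁⟩
    have e₂ := kB b₂ ⟨_, hp₂⟩ ⟨_, _, hy₂⟩
    obtain rfl := kA a ⟨_, _, hy'⟩ ⟨_, hq⟩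
    rwa [homMul_eq_pair b₁ b₂ hb fun c h1 h2 => by
        have := kB c (hF.exists_dec_bridge h1 h2).1 (hF.exists_dec_bridge h1 h2).2
        grind,
      homMul_eq_single a fun c h1 h2 => kA c (hF.exists_bridge_dec h1 h2).1
        (hF.exists_bridge_dec h1 h2).2] at key
  · exact absurd ((kB b₁ ⟨_, hp₁⟩ ⟨_, _, hy₁⟩).trans (kB b₂ ⟨_, hp₂⟩ ⟨_, _, hy₂⟩).symm) hb

/-- Two different vertices after the bridge occur only in a square of division type. -/
theorem leftSquares_comp_bridgeHom_of_fission {C₁ C₂ : Set (Fin (2 * n))} {a₁ a₂ : DecLink n}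
    (h : IsDecorationEdge C v b) (h' : IsBridgeEdge s γ b w)
    (k₁ : IsBridgeEdge s γ v a₁) (k₁' : IsDecorationEdge C₁ a₁ w)
    (k₂ : IsBridgeEdge s γ v a₂) (k₂' : IsDecorationEdge C₂ a₂ w) (hne : C₁ ≠ C₂) :
    leftSquares R v b ≫ bridgeHom R s b w =
      bridgeHom R s v a₁ ≫ leftSquares R a₁ w + bridgeHom R s v a₂ ≫ leftSquares R a₂ w := by
  have hF := decSupported_leftSquares (R := R) (n := n)
  have ha : a₁ ≠ a₂ := by rintro rfl; exact hne (k₁'.unique k₂')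
  obtain ⟨p, hp, -⟩ := h.exists_decStep
  obtain ⟨q₁, hq₁, -⟩ := k₁'.exists_decStep
  obtain ⟨q₂, hq₂, -⟩ := k₂'.exists_decStep
  obtain ⟨y, u, hy, -⟩ := h'.exists_bridgeStep
  obtain ⟨y₁, u₁, hy₁, -⟩ := k₁.exists_bridgeStep
  obtain ⟨y₂, u₂, hy₂, -⟩ := k₂.exists_bridgeStep
  have key := congrFun (congrFun (leftSquares_comm_bridgeHom (R := R) s) v) w
  rcases decSquare_of_edges h h' with
    ⟨x, z, r, b', a', hx, hz, k1, k2, k3, k4, kB, kA⟩ |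
    ⟨x, z, c₁, c₂, a', h0, k1, k2, k1', k2', k3, k4, kB, kA⟩ |
    ⟨x, z, b', c₁, c₂, h0, k1, k2, k3, k4, k3', k4', kB, kA⟩
  · exact absurd ((kA a₁ ⟨_, _, hy₁⟩ ⟨_, hq₁⟩).trans (kA a₂ ⟨_, _, hy₂⟩ ⟨_, hq₂⟩).symm) ha
  · exact absurd ((kA a₁ ⟨_, _, hy₁⟩ ⟨_, hq₁⟩).trans (kA a₂ ⟨_, _, hy₂⟩ ⟨_, hq₂⟩).symm) ha
  · have e₁ := kA a₁ ⟨_, _, hy₁⟩ ⟨_, hq₁⟩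
    have e₂ := kA a₂ ⟨_, _, hy₂⟩ ⟨_, hq₂⟩
    obtain rfl := kB b ⟨_, hp⟩ ⟨_, _, hy⟩
    rwa [homMul_eq_single b fun c h1 h2 => kB c (hF.exists_dec_bridge h1 h2).1
        (hF.exists_dec_bridge h1 h2).2,
      homMul_eq_pair a₁ a₂ ha fun c h1 h2 => by
        have := kA c (hF.exists_bridge_dec h1 h2).1 (hF.exists_bridge_dec h1 h2).2
        grind] at key

/-- The matrix of right decorations at one marked point has at most one nonzero entry in each row
and column, so the identity of matrices is already the claim. If v and b have different links, both
sides vanish. -/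
theorem leftSquares_comp_rightDec (h' : IsDecorationEdge C' b w) (k : IsDecorationEdge C' v a) :
    leftSquares R v b ≫ decHom R .right b w = decHom R .right v a ≫ leftSquares R a w := by
  obtain ⟨p, hp, rfl⟩ := k.exists_decStep
  by_cases hl : b.link = v.link
  · have hb : DecStep p b w := by
      rw [← isDecorationEdge_circleAt, hl]; exact h'
    have key := congrFun (congrFun (leftSquares_comm_rightHom (R := R) p) v) w
    rwa [homMul_eq_single b fun c _ h => (decStep_of_rightHom_ne_zero h).eq_of_target hb,
      homMul_eq_single a fun c h _ => (decStep_of_rightHom_ne_zero h).eq_of_source hp,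
      rightHom_eq hb, rightHom_eq hp] at key
  · have hl' : a.link ≠ w.link := by rw [k.link_eq, h'.link_eq]; exact Ne.symm hl
    have e1 : leftSquares R v b = 0 := leftSquare_eq_zero (Ne.symm hl)
    have e2 : leftSquares R a w = 0 := leftSquare_eq_zero hl'
    rw [e1, e2, Limits.zero_comp, Limits.comp_zero]

theorem leftSquares_comp_leftDec (h : IsDecorationEdge C v a) (h' : IsDecorationEdge C' a w)
    (k : IsDecorationEdge C' v b) (k' : IsDecorationEdge C b w) :
    leftSquares R v a ≫ decHom R .left a w + leftSquares R v b ≫ decHom R .left b w =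
      decHom R .left v a ≫ leftSquares R a w + decHom R .left v b ≫ leftSquares R b w := by
  have hF := decSupported_leftSquares (R := R) (n := n)
  obtain ⟨p, hp, rfl⟩ := h.exists_decStep
  obtain ⟨q, hq, rfl⟩ := k.exists_decStep
  have hq' : DecStep q a w := by
    rw [← isDecorationEdge_circleAt, h.link_eq]; exact h'
  have hpq : ¬ v.link.setoid p q := by
    intro hpq
    have h1 := hq'.source
    rw [← a.inv_sign p q (by rw [h.link_eq]; exact hpq), hp.target] at h1
    cases h1
  have hab : a ≠ b := hp.ne_of_not_rel hq hpq
  -- From v to w exactly the two signs at p and q drop, so a vertex in the middle has dropped one of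
  -- them.
  have mid : ∀ c, (∃ r, DecStep r v c) → (∃ r, DecStep r c w) → c = a ∨ c = b := by
    rintro c ⟨r, hr⟩ ⟨t, ht⟩
    by_cases h1 : v.link.setoid r p
    · exact Or.inl ((hr.congr h1).eq_of_source hp)
    by_cases h2 : v.link.setoid r q
    · exact Or.inr ((hr.congr h2).eq_of_source hq)
    exfalso
    have wp : w.sign p = .minus := by
      rw [hq'.off p fun h => hpq (by
        rw [hp.link_eq] at h; exact v.link.setoid.symm h), hp.target]
    have wq := hq'.target
    have cp : c.sign p = .plus := by rw [hr.off p h1, hp.source]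
    have cq : c.sign q = .plus := by rw [hr.off q h2, hq.source]
    have tp : c.link.setoid t p := by
      by_contra h0
      have := ht.off p h0
      rw [wp, cp] at this
      cases this
    have tq : c.link.setoid t q := by
      by_contra h0
      have := ht.off q h0
      rw [wq, cq] at this
      cases this
    rw [hr.link_eq] at tp tq
    exact hpq (v.link.setoid.trans (v.link.setoid.symm tp) tq)
  have key := congrFun (congrFun (leftSquares_comm_decHom (R := R) (n := n)) v) w
  rwa [homMul_eq_pair a b hab fun c h1 h2 => mid c (hF _ _ h1) (exists_of_decHom_ne_zero h2),
    homMul_eq_pair a b hab fun c h1 h2 => mid c (exists_of_decHom_ne_zero h1) (hF _ _ h2)] at key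

end Localization

/-! ### The differential on edges and paths -/

noncomputable section Differential

variable (R : Type*) [CommRing R] {n : ℕ} {u v w : DecLink n}

/-- The differential of an edge. -/
def edgeDiff {v w : DecLink n} : Edge v w → (bObj R v ⟶ bObj R w)
  | .decoration .left _ _ => -leftSquares R v w
  | _ => 0

/-- The sign of the first component of the bigrading. -/
def pathSign {v w : DecLink n} (p : Quiver.Path v w) : ℤˣ := (pathBidegree p).1.negOnePow

/-- The extension of the differential to paths by the Leibniz rule. -/
def pathDiff {v : DecLink n} : ∀ {w : DecLink n}, Quiver.Path v w → (bObj R v ⟶ bObj R w)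
  | _, .nil => 0
  | _, .cons p e => Int.negOnePow (Edge.side e).parity • (pathDiff p ≫ bEdge R e) +
      bPath R p ≫ edgeDiff R e

theorem bPath_nil (v : DecLink n) : bPath R (.nil : Quiver.Path v v) = 𝟙 (bObj R v) := by
  change (Quotient.functor (relHom R n)).map ((Free.embedding R (Paths (DecLink n))).map
    (𝟙 ((Paths.of (DecLink n)).obj v))) = _
  rw [CategoryTheory.Functor.map_id, CategoryTheory.Functor.map_id]

theorem bPath_comp (p : Quiver.Path u v) (q : Quiver.Path v w) :
    bPath R (p.comp q) = bPath R p ≫ bPath R q := by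
  exact (congrArg (Quotient.functor (relHom R n)).map
    ((Free.embedding R (Paths (DecLink n))).map_comp (X := (Paths.of (DecLink n)).obj u)
      (Y := (Paths.of (DecLink n)).obj v) (Z := (Paths.of (DecLink n)).obj w) p q)).trans
    (Functor.map_comp _ _ _)

theorem bPath_cons (p : Quiver.Path u v) (e : Edge v w) :
    bPath R (Quiver.Path.cons p e) = bPath R p ≫ bEdge R e :=
  bPath_comp R p (Quiver.Hom.toPath (V := DecLink n) (a := v) (b := w) e)

theorem Edge.bidegree_fst (e : Edge v w) : e.bidegree.1 = e.side.parity := by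
  rcases e with ⟨_ | _, _⟩ | ⟨_ | _, _⟩ <;> rfl

theorem pathBidegree_cons (p : Quiver.Path u v) (e : Edge v w) :
    pathBidegree (Quiver.Path.cons p e) = pathBidegree p + e.bidegree := by
  simp [pathBidegree]

theorem pathBidegree_comp (p : Quiver.Path u v) (q : Quiver.Path v w) :
    pathBidegree (p.comp q) = pathBidegree p + pathBidegree q := by
  simp [pathBidegree]

theorem pathSign_cons (p : Quiver.Path u v) (e : Edge v w) :
    pathSign (Quiver.Path.cons p e) = pathSign p * e.side.parity.negOnePow := by
  rw [pathSign, pathBidegree_cons, Prod.fst_add, Int.negOnePow_add, e.bidegree_fst, pathSign]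

theorem pathSign_comp (p : Quiver.Path u v) (q : Quiver.Path v w) :
    pathSign (p.comp q) = pathSign p * pathSign q := by
  rw [pathSign, pathBidegree_comp, Prod.fst_add, Int.negOnePow_add, pathSign, pathSign]

theorem pathDiff_comp (p : Quiver.Path u v) (q : Quiver.Path v w) :
    pathDiff R (p.comp q) = pathSign q • (pathDiff R p ≫ bPath R q) + bPath R p ≫ pathDiff R q := by
  induction q with
  | nil =>
    have : pathSign (.nil : Quiver.Path v v) = 1 := by simp [pathSign, pathBidegree]
    rw [this, bPath_nil, Category.comp_id, one_smul]
    simp [pathDiff]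
  | cons q e ih =>
    rw [Quiver.Path.comp_cons, pathDiff, pathDiff, ih, pathSign_cons, bPath_cons, bPath_comp]
    simp only [Preadditive.add_comp, Preadditive.comp_add, Units.smul_def, Preadditive.zsmul_comp,
      Preadditive.comp_zsmul, Category.assoc, smul_add, smul_smul, Units.val_mul]
    rw [mul_comm (pathSign q : ℤ), add_assoc]

end Differential

/-! ### The differential on the quiver category and the defining relations -/

noncomputable section QuiverDifferential

variable {R : Type*} [CommRing R] {n : ℕ} {u v w a b : DecLink n}

theorem qPath_comp (p : Quiver.Path u v) (q : Quiver.Path v w) :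
    qPath R (p.comp q) = qPath R p ≫ qPath R q :=
  (Free.embedding R (Paths (DecLink n))).map_comp (X := (Paths.of (DecLink n)).obj u)
    (Y := (Paths.of (DecLink n)).obj v) (Z := (Paths.of (DecLink n)).obj w) p q

theorem span_range_qPath (v w : DecLink n) :
    Submodule.span R (Set.range (qPath R (v := v) (w := w))) = ⊤ := by
  rw [eq_top_iff]
  intro f _
  refine Finsupp.induction_linear (motive := fun f : (Quiver.Path v w →₀ R) =>
    (show qObj R v ⟶ qObj R w from f) ∈ Submodule.span R (Set.range (qPath R))) f
    (Submodule.zero_mem _) (fun f g hf hg => Submodule.add_mem _ hf hg) fun p r => ?_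
  have h := Submodule.smul_mem (Submodule.span R (Set.range (qPath R (v := v) (w := w)))) r
    (Submodule.subset_span ⟨p, rfl⟩)
  convert h using 1
  exact (Finsupp.smul_single_one p r).symm

/-- The linear extension of a function on paths. -/
def linearExt {v w : DecLink n} (F : Quiver.Path v w → (bObj R v ⟶ bObj R w)) :
    (qObj R v ⟶ qObj R w) →ₗ[R] (bObj R v ⟶ bObj R w) :=
  show (Quiver.Path v w →₀ R) →ₗ[R] (bObj R v ⟶ bObj R w) from Finsupp.linearCombination R F

theorem linearExt_qPath (F : Quiver.Path v w → (bObj R v ⟶ bObj R w)) (p : Quiver.Path v w) :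
    linearExt F (qPath R p) = F p :=
  (Finsupp.linearCombination_single R (v := F) 1 p).trans (one_smul R _)

/-- The differential on `𝒬Γ_n`, with values in `ℬΓ_n`. -/
def quiverDiff (v w : DecLink n) : (qObj R v ⟶ qObj R w) →ₗ[R] (bObj R v ⟶ bObj R w) :=
  linearExt (pathDiff R)

/-- The projection of `𝒬Γ_n` onto `ℬΓ_n`, twisted by the sign of the first component of the
bigrading. -/
def quiverSigned (v w : DecLink n) : (qObj R v ⟶ qObj R w) →ₗ[R] (bObj R v ⟶ bObj R w) :=
  linearExt fun p => pathSign p • bPath R p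

theorem quiverSigned_comp (f : qObj R u ⟶ qObj R v) (g : qObj R v ⟶ qObj R w) :
    quiverSigned u w (f ≫ g) = quiverSigned u v f ≫ quiverSigned v w g := by
  have hf : f ∈ Submodule.span R (Set.range (qPath R)) := by rw [span_range_qPath]; trivial
  have hg : g ∈ Submodule.span R (Set.range (qPath R)) := by rw [span_range_qPath]; trivial
  induction hf using Submodule.span_induction with
  | zero => simp
  | add f f' _ _ hf hf' => simp [Preadditive.add_comp, hf, hf']
  | smul r f _ hf => simp [hf]
  | mem f hf =>
    obtain ⟨p, rfl⟩ := hf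
    induction hg using Submodule.span_induction with
    | zero => simp
    | add f f' _ _ hf hf' => simp [Preadditive.comp_add, hf, hf']
    | smul r f _ hf => simp [hf]
    | mem g hg =>
      obtain ⟨q, rfl⟩ := hg
      rw [← qPath_comp, quiverSigned, quiverSigned, quiverSigned, linearExt_qPath, linearExt_qPath,
        linearExt_qPath, pathSign_comp, bPath_comp, mul_comm]
      simp only [Units.smul_def, Preadditive.zsmul_comp, Preadditive.comp_zsmul, smul_smul,
        Units.val_mul]

/-- The sign of the Leibniz rule is put into the twisted projection `quiverSigned`, so the rule
holds without any homogeneity of g. -/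
theorem quiverDiff_comp (f : qObj R u ⟶ qObj R v) (g : qObj R v ⟶ qObj R w) :
    quiverDiff u w (f ≫ g) = quiverDiff u v f ≫ quiverSigned v w g +
      (Quotient.functor (relHom R n)).map f ≫ quiverDiff v w g := by
  have hf : f ∈ Submodule.span R (Set.range (qPath R)) := by rw [span_range_qPath]; trivial
  have hg : g ∈ Submodule.span R (Set.range (qPath R)) := by rw [span_range_qPath]; trivial
  induction hf using Submodule.span_induction with
  | zero => simp
  | add f f' _ _ hf hf' => simp only [Preadditive.add_comp, map_add, Functor.map_add, hf, hf']; abel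
  | smul r f _ hf =>
    simp only [Linear.smul_comp, map_smul, Functor.map_smul, hf, smul_add]
  | mem f hf =>
    obtain ⟨p, rfl⟩ := hf
    induction hg using Submodule.span_induction with
    | zero => simp
    | add f f' _ _ hf hf' => simp only [Preadditive.comp_add, map_add, hf, hf']; abel
    | smul r f _ hf => simp only [Linear.comp_smul, map_smul, hf, smul_add]
    | mem g hg =>
      obtain ⟨q, rfl⟩ := hg
      rw [← qPath_comp, quiverDiff, quiverDiff, quiverDiff, quiverSigned, linearExt_qPath,
        linearExt_qPath, linearExt_qPath, linearExt_qPath, pathDiff_comp]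
      simp only [Units.smul_def, Preadditive.comp_zsmul]

theorem quiverDiff_qEdge (e : Edge v w) : quiverDiff v w (qEdge R e) = edgeDiff R e := by
  refine (linearExt_qPath _ _).trans ?_
  change _ • ((0 : bObj R v ⟶ bObj R v) ≫ bEdge R e) + bPath R .nil ≫ edgeDiff R e = _
  rw [bPath_nil, Category.id_comp, Limits.zero_comp, smul_zero, zero_add]

theorem quiverSigned_qEdge (e : Edge v w) :
    quiverSigned v w (qEdge R e) = e.side.parity.negOnePow • bEdge R e := by
  refine (linearExt_qPath _ _).trans ?_
  change pathSign (Quiver.Path.cons .nil e) • _ = _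
  rw [pathSign_cons]
  have : pathSign (.nil : Quiver.Path v v) = 1 := by simp [pathSign, pathBidegree]
  rw [this, one_mul]

theorem quiverDiff_qEdge_comp (e : Edge u v) (f : Edge v w) :
    quiverDiff u w (qEdge R e ≫ qEdge R f) =
      f.side.parity.negOnePow • (edgeDiff R e ≫ bEdge R f) + bEdge R e ≫ edgeDiff R f := by
  rw [quiverDiff_comp, quiverDiff_qEdge, quiverDiff_qEdge, quiverSigned_qEdge]
  simp only [Units.smul_def, Preadditive.comp_zsmul]

theorem quiverSigned_qEdge_comp (e : Edge u v) (f : Edge v w) :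
    quiverSigned u w (qEdge R e ≫ qEdge R f) =
      (e.side.parity.negOnePow * f.side.parity.negOnePow) • (Quotient.functor (relHom R n)).map
        (qEdge R e ≫ qEdge R f) := by
  rw [quiverSigned_comp, quiverSigned_qEdge, quiverSigned_qEdge, Functor.map_comp, mul_comm]
  simp only [Units.smul_def, Preadditive.zsmul_comp, Preadditive.comp_zsmul, smul_smul,
    Units.val_mul]

theorem Edge.SameLabel.side_eq {e : Edge v w} {f : Edge a b} (h : e.SameLabel f) :
    f.side = e.side := by
  cases e <;> cases f <;> simp_all [Edge.SameLabel, Edge.side]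

theorem edgeDiff_eq_zero_of_sameLabel {e : Edge v w} {f : Edge a b} (h : e.SameLabel f)
    (he : ∀ C h, e ≠ .decoration .left C h) : edgeDiff R e = 0 ∧ edgeDiff R f = 0 := by
  rcases e with ⟨_ | _, _, _⟩ | ⟨_ | _, _, _⟩ <;> rcases f with ⟨_ | _, _, _⟩ | ⟨_ | _, _, _⟩ <;>
    first
    | exact ⟨rfl, rfl⟩
    | exact absurd rfl (he _ _)
    | exact absurd h.1 (by decide)
    | exact absurd h id

/-- The defining relations are homogeneous in the first component of the bigrading. -/
theorem quiverSigned_relator {r : qObj R v ⟶ qObj R w} (h : Relator R r) :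
    quiverSigned v w r = 0 := by
  obtain ⟨k, hk⟩ : ∃ k : ℤˣ, quiverSigned v w r = k • (Quotient.functor (relHom R n)).map r := by
    cases h with
    | disjoint α β' β α' disj hα hβ =>
      refine ⟨α.side.parity.negOnePow * β.side.parity.negOnePow, ?_⟩
      simp only [map_sub, Units.smul_def (koszul _ _), map_zsmul, Functor.map_sub,
        Functor.map_zsmul, quiverSigned_qEdge_comp, hα.side_eq, hβ.side_eq, smul_sub]
      rw [mul_comm β.side.parity.negOnePow, smul_comm]
    | right_merge h₁ m₁ m h hγ hC₁ hC =>
      rename_i s _ _ _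
      refine ⟨(Side.right.parity).negOnePow * s.parity.negOnePow, ?_⟩
      simp only [map_sub, Functor.map_sub, quiverSigned_qEdge_comp,
        Edge.side, smul_sub]
      rw [mul_comm s.parity.negOnePow]
    | right_fission h f f₁ h₁ hγ hC hC₁ =>
      rename_i s _ _ _
      refine ⟨(Side.right.parity).negOnePow * s.parity.negOnePow, ?_⟩
      simp only [map_sub, Functor.map_sub, quiverSigned_qEdge_comp,
        Edge.side, smul_sub]
      rw [mul_comm s.parity.negOnePow]
    | left_merge h₁ m₁ h₂ m₂ m h hC₁ hC₂ hne hC =>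
      rename_i s _ _ _ _
      refine ⟨(Side.left.parity).negOnePow * s.parity.negOnePow, ?_⟩
      simp only [map_add, map_sub, Units.smul_def s.parity.negOnePow, map_zsmul, Functor.map_add,
        Functor.map_sub, Functor.map_zsmul, quiverSigned_qEdge_comp, Edge.side, smul_add, smul_sub]
      rw [mul_comm s.parity.negOnePow, ← Units.smul_def, ← Units.smul_def, smul_comm]
    | left_fission h f f₁ h₁ f₂ h₂ hγ hC hC₁ hC₂ hne =>
      rename_i s _ _ _ _
      refine ⟨(Side.left.parity).negOnePow * s.parity.negOnePow, ?_⟩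
      simp only [map_add, map_sub, Units.smul_def s.parity.negOnePow, map_zsmul, Functor.map_add,
        Functor.map_sub, Functor.map_zsmul, quiverSigned_qEdge_comp, Edge.side, smul_add, smul_sub]
      rw [mul_comm s.parity.negOnePow]
      simp only [← Units.smul_def, smul_comm s.parity.negOnePow]
    | bridge_sides hst e₁ e₂ e₃ e₄ =>
      rename_i s t _ _
      refine ⟨s.parity.negOnePow * t.parity.negOnePow, ?_⟩
      simp only [map_sub, Functor.map_sub, quiverSigned_qEdge_comp, Edge.side, smul_sub]
      rw [mul_comm t.parity.negOnePow]
    | bridge_right e₁ e₂ e₃ e₄ par hμ hν =>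
      refine ⟨(Side.right.parity).negOnePow * (Side.right.parity).negOnePow, ?_⟩
      simp only [map_sub, Functor.map_sub, quiverSigned_qEdge_comp,
        Edge.side, smul_sub]
    | bridge_left e₁ e₂ e₃ e₄ par hμ hν =>
      refine ⟨(Side.left.parity).negOnePow * (Side.left.parity).negOnePow, ?_⟩
      simp only [map_add, Functor.map_add, quiverSigned_qEdge_comp,
        Edge.side, smul_add]
    | bridge_triple e₁ e₁' e₂ e₂' e₃ e₃' par slide hδ hζ hη =>
      refine ⟨(Side.left.parity).negOnePow * (Side.left.parity).negOnePow, ?_⟩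
      simp only [map_add, Functor.map_add, quiverSigned_qEdge_comp,
        Edge.side, smul_add]
    | bridge_crossing e₁ e₂ cross => exact ⟨_, quiverSigned_qEdge_comp _ _⟩
    | there_and_back e₁ e₂ h =>
      refine ⟨1, ?_⟩
      simp only [map_sub, Functor.map_sub, quiverSigned_qEdge_comp, quiverSigned_qEdge, Edge.side,
        Side.parity, Int.negOnePow_zero, one_mul, one_smul]
  rw [hk, map_relator h, smul_zero]

/-- Here one edge of the square is a left decoration. By the type and side of the other edge, the
claim is the commutation of `leftSquares` with bridges, with left decorations or with right
decorations. -/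
theorem quiverDiff_disjoint {α : Edge v a} {β' : Edge a w} {β : Edge v b} {α' : Edge b w}
    (disj : Disjoint α.support β.support) (hα : α.SameLabel α') (hβ : β.SameLabel β') {C}
    {h : IsDecorationEdge C v a} (hC : α = .decoration .left C h) :
    quiverDiff v w (qEdge R α ≫ qEdge R β') =
      koszul α.side β.side • quiverDiff v w (qEdge R β ≫ qEdge R α') := by
  subst hC
  rw [quiverDiff_qEdge_comp, quiverDiff_qEdge_comp]
  obtain ⟨_, _, _⟩ | ⟨t, C', h'⟩ := α'
  · exact absurd hα id
  obtain ⟨rfl, rfl⟩ := hα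
  obtain ⟨s, γ, k⟩ | ⟨s, C', k⟩ := β <;> obtain ⟨s', γ', k'⟩ | ⟨s', C'', k'⟩ := β'
  · obtain ⟨rfl, rfl⟩ := hβ
    have := leftSquares_comp_bridgeHom_of_disjoint (R := R) h k' k h' disj
    rw [bridgeHom_eq k, bridgeHom_eq k'] at this
    simp only [edgeDiff, Edge.side, Preadditive.neg_comp, Preadditive.comp_neg,
      Limits.comp_zero, Limits.zero_comp, this]
    cases s <;> simp [koszul, Side.parity]
  · exact absurd hβ id
  · exact absurd hβ id
  · obtain ⟨rfl, rfl⟩ := hβ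
    cases s
    -- Both edges are left decorations, so both factors of both paths are differentiated; the four
    -- terms form one entry of the commutation identity.
    · have := leftSquares_comp_leftDec (R := R) h k' k h'
      rw [decHom_eq h, decHom_eq h', decHom_eq k, decHom_eq k'] at this
      simp only [edgeDiff, Edge.side, Preadditive.neg_comp, Preadditive.comp_neg, koszul,
        Side.parity, mul_one, Int.negOnePow_one, Units.neg_smul, one_smul, neg_neg]
      grind
    · have := leftSquares_comp_rightDec (R := R) k' k
      rw [decHom_eq k, decHom_eq k'] at this
      simp only [edgeDiff, Edge.side, Preadditive.neg_comp, Preadditive.comp_neg, koszul,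
        Side.parity, mul_zero, Int.negOnePow_zero, one_smul, Limits.comp_zero, Limits.zero_comp,
        this]
      simp

/-- The differential is compatible with the defining relations. -/
theorem quiverDiff_relator {r : qObj R v ⟶ qObj R w} (h : Relator R r) :
    quiverDiff v w r = 0 := by
  cases h with
  | disjoint α β' β α' disj hα hβ =>
    rw [map_sub, sub_eq_zero, Units.smul_def, map_zsmul, ← Units.smul_def]
    by_cases h : ∃ C h, α = .decoration .left C h
    · obtain ⟨C, h, rfl⟩ := h
      exact quiverDiff_disjoint disj hα hβ rfl
    by_cases h' : ∃ C h, β = .decoration .left C h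
    · obtain ⟨C, h', rfl⟩ := h'
      rw [quiverDiff_disjoint disj.symm hβ hα rfl, smul_smul, koszul, koszul, mul_comm α.side.parity,
        Int.units_mul_self, one_smul]
    push Not at h h'
    obtain ⟨h₁, h₂⟩ := edgeDiff_eq_zero_of_sameLabel (R := R) hα h
    obtain ⟨h₃, h₄⟩ := edgeDiff_eq_zero_of_sameLabel (R := R) hβ h'
    simp only [quiverDiff_qEdge_comp, h₁, h₂, h₃, h₄, Limits.comp_zero, Limits.zero_comp, smul_zero,
      add_zero]
  | left_merge h₁ m₁ h₂ m₂ m h hC₁ hC₂ hne hC =>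
    rename_i s _ _ _ _
    have key := leftSquares_comp_bridgeHom_of_merge (R := R) h₁ m₁ h₂ m₂ hne m h
    rw [bridgeHom_eq m₁, bridgeHom_eq m₂, bridgeHom_eq m] at key
    simp only [map_sub, map_add, Units.smul_def, map_zsmul, quiverDiff_qEdge_comp,
      Limits.comp_zero, Limits.zero_comp, smul_zero, add_zero, zero_add, edgeDiff, Edge.side,
      Preadditive.neg_comp, Preadditive.comp_neg, ← smul_add, ← neg_add, key, sub_self]
  | left_fission h f f₁ h₁ f₂ h₂ hγ hC hC₁ hC₂ hne =>
    rename_i s _ _ _ _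
    have key := leftSquares_comp_bridgeHom_of_fission (R := R) h f f₁ h₁ f₂ h₂ hne
    rw [bridgeHom_eq f₁, bridgeHom_eq f₂, bridgeHom_eq f] at key
    simp only [map_sub, map_add, Units.smul_def, map_zsmul, quiverDiff_qEdge_comp,
      Limits.comp_zero, Limits.zero_comp, smul_zero, add_zero, zero_add, edgeDiff, Edge.side,
      Preadditive.neg_comp, Preadditive.comp_neg, ← neg_add, key, sub_self]
  -- No left decoration edge occurs in the remaining relations, so every term is zero.
  | _ =>
    simp only [map_sub, map_add, quiverDiff_qEdge_comp, quiverDiff_qEdge,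
      Limits.comp_zero, Limits.zero_comp, smul_zero, add_zero, edgeDiff, sub_self]

end QuiverDifferential

/-! ### Descent to the cleaver category; the axioms and uniqueness -/

noncomputable section Descent

variable {R : Type*} [CommRing R] {n : ℕ} {u v w : DecLink n}

/-- For a generator p r q of the ideal, each term of the Leibniz rule has as a factor the
differential of r, its signed class or its class, and all three vanish. -/
theorem quiverDiff_eq_zero_of_mem {f : qObj R v ⟶ qObj R w} (hf : f ∈ relIdeal R n _ _) :
    quiverDiff v w f = 0 := by
  induction hf using Submodule.span_induction with
  | zero => exact map_zero _
  | add f g _ _ hf hg => rw [map_add, hf, hg, add_zero]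
  | smul a f _ hf => rw [map_smul, hf, smul_zero]
  | mem f hf =>
    obtain ⟨v', w', r, p, q, hr, rfl⟩ := hf
    rw [quiverDiff_comp, quiverDiff_comp, quiverSigned_comp, quiverDiff_relator hr,
      quiverSigned_relator hr, map_relator hr]
    simp

variable (v w) in
/-- The projection of `𝒬Γ_n` onto `ℬΓ_n`. -/
def projection : (qObj R v ⟶ qObj R w) →ₗ[R] (bObj R v ⟶ bObj R w) :=
  (Quotient.functor (relHom R n)).mapLinearMap R

theorem projection_apply (f : qObj R v ⟶ qObj R w) :
    projection v w f = (Quotient.functor (relHom R n)).map f := rfl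

theorem projection_surjective : Function.Surjective (projection (R := R) v w) :=
  (Quotient.functor (relHom R n)).map_surjective

theorem ker_projection_le :
    LinearMap.ker (projection (R := R) v w) ≤ LinearMap.ker (quiverDiff v w) := by
  intro f hf
  rw [LinearMap.mem_ker, projection_apply, ← (Quotient.functor (relHom R n)).map_zero,
    Quotient.functor_map_eq_iff] at hf
  have h : f - 0 ∈ relIdeal R n _ _ := hf
  rw [sub_zero] at h
  exact quiverDiff_eq_zero_of_mem h

variable (R v w) in
/-- The differential of the cleaver category. -/
def differential : (bObj R v ⟶ bObj R w) →ₗ[R] (bObj R v ⟶ bObj R w) :=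
  ((LinearMap.ker (projection v w)).liftQ (quiverDiff v w) ker_projection_le).comp
    ((projection v w).quotKerEquivOfSurjective projection_surjective).symm.toLinearMap

theorem differential_map (f : qObj R v ⟶ qObj R w) :
    differential R v w ((Quotient.functor (relHom R n)).map f) = quiverDiff v w f := by
  rw [differential, LinearMap.comp_apply, ← projection_apply]
  have : ((projection v w).quotKerEquivOfSurjective projection_surjective).symm
      (projection (R := R) v w f) = Submodule.Quotient.mk f := by
    rw [LinearEquiv.symm_apply_eq]; rfl
  erw [this]
  rfl

theorem differential_bPath (p : Quiver.Path v w) :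
    differential R v w (bPath R p) = pathDiff R p :=
  (differential_map _).trans (linearExt_qPath _ _)

theorem differential_bEdge (e : Edge v w) : differential R v w (bEdge R e) = edgeDiff R e :=
  (differential_map _).trans (quiverDiff_qEdge e)

theorem span_range_bPath (v w : DecLink n) :
    Submodule.span R (Set.range (bPath R (v := v) (w := w))) = ⊤ := by
  have h := congrArg (Submodule.map (projection v w)) (span_range_qPath (R := R) v w)
  rw [Submodule.map_span, Submodule.map_top, LinearMap.range_eq_top.2 projection_surjective,
    ← Set.range_comp] at h
  exact h

theorem differential_leibniz (α : bObj R u ⟶ bObj R v) {β : bObj R v ⟶ bObj R w} {g : ℤ × ℚ}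
    (hβ : β ∈ homogeneous R v w g) :
    differential R u w (α ≫ β) =
      g.1.negOnePow • (differential R u v α ≫ β) + α ≫ differential R v w β := by
  have hα : α ∈ Submodule.span R (Set.range (bPath R)) := by rw [span_range_bPath]; trivial
  induction hα using Submodule.span_induction with
  | zero => simp
  | add f f' _ _ hf hf' => simp only [Preadditive.add_comp, map_add, hf, hf', smul_add]; abel
  | smul r f _ hf =>
    simp only [Linear.smul_comp, map_smul, hf, smul_add, Units.smul_def, smul_comm r]
  | mem f hf =>
    obtain ⟨p, rfl⟩ := hf
    induction hβ using Submodule.span_induction with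
    | zero => simp
    | add f f' _ _ hf hf' => simp only [Preadditive.comp_add, map_add, hf, hf', smul_add]; abel
    | smul r f _ hf => simp only [Linear.comp_smul, map_smul, hf, smul_add, Units.smul_def, smul_comm r]
    | mem g hg =>
      obtain ⟨q, rfl, rfl⟩ := hg
      rw [← bPath_comp, differential_bPath, differential_bPath, differential_bPath, pathDiff_comp]
      rfl

theorem bPath_mem_homogeneous (p : Quiver.Path v w) :
    bPath R p ∈ homogeneous R v w (pathBidegree p) := Submodule.subset_span ⟨p, rfl, rfl⟩

theorem comp_mem_homogeneous {f : bObj R u ⟶ bObj R v} {g : bObj R v ⟶ bObj R w} {i j : ℤ × ℚ}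
    (hf : f ∈ homogeneous R u v i) (hg : g ∈ homogeneous R v w j) :
    f ≫ g ∈ homogeneous R u w (i + j) := by
  induction hf using Submodule.span_induction with
  | zero => simp
  | add f f' _ _ hf hf' => rw [Preadditive.add_comp]; exact Submodule.add_mem _ hf hf'
  | smul r f _ hf => rw [Linear.smul_comp]; exact Submodule.smul_mem _ _ hf
  | mem f hf =>
    obtain ⟨p, rfl, rfl⟩ := hf
    induction hg using Submodule.span_induction with
    | zero => simp
    | add f f' _ _ hf hf' => rw [Preadditive.comp_add]; exact Submodule.add_mem _ hf hf'
    | smul r f _ hf => rw [Linear.comp_smul]; exact Submodule.smul_mem _ _ hf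
    | mem g hg =>
      obtain ⟨q, rfl, rfl⟩ := hg
      rw [← bPath_comp, ← pathBidegree_comp]
      exact bPath_mem_homogeneous _

theorem bEdge_mem_homogeneous (e : Edge v w) : bEdge R e ∈ homogeneous R v w e.bidegree := by
  have h := bPath_mem_homogeneous (R := R) (Quiver.Path.cons (Quiver.Path.nil : Quiver.Path v v) e)
  rw [pathBidegree_cons] at h
  have : pathBidegree (.nil : Quiver.Path v v) = 0 := by simp [pathBidegree]
  rw [this, zero_add] at h
  exact h

theorem bridgeHom_left_mem_homogeneous (v w : DecLink n) :
    bridgeHom R .left v w ∈ homogeneous R v w (1, 1 / 2) := by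
  by_cases h : ∃ γ, IsBridgeEdge .left γ v w
  · obtain ⟨γ, h⟩ := h
    rw [bridgeHom_eq h]
    exact bEdge_mem_homogeneous (.bridge .left γ h)
  · rw [bridgeHom_eq_zero h]; exact Submodule.zero_mem _

theorem leftSquares_mem_homogeneous (v w : DecLink n) :
    leftSquares R v w ∈ homogeneous R v w (2, 1) := by
  refine Submodule.sum_mem _ fun a _ => ?_
  have h := comp_mem_homogeneous (bridgeHom_left_mem_homogeneous (R := R) v a)
    (bridgeHom_left_mem_homogeneous a w)
  norm_num at h
  exact h

theorem edgeDiff_mem_homogeneous (e : Edge v w) :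
    edgeDiff R e ∈ homogeneous R v w (e.bidegree + (1, 0)) := by
  rcases e with ⟨_ | _, _, _⟩ | ⟨_ | _, _, _⟩
  · exact Submodule.zero_mem _
  · exact Submodule.zero_mem _
  · have h := leftSquares_mem_homogeneous (R := R) v w
    have e : ((1, 1) + (1, 0) : ℤ × ℚ) = (2, 1) := by norm_num
    exact Submodule.neg_mem _ (e ▸ h)
  · exact Submodule.zero_mem _

theorem pathDiff_mem_homogeneous (p : Quiver.Path v w) :
    pathDiff R p ∈ homogeneous R v w (pathBidegree p + (1, 0)) := by
  induction p with
  | nil => exact Submodule.zero_mem _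
  | cons p e ih =>
    rw [pathDiff, pathBidegree_cons]
    refine Submodule.add_mem _ ?_ ?_
    · have h := comp_mem_homogeneous ih (bEdge_mem_homogeneous (R := R) e)
      rw [add_right_comm] at h
      rcases Int.units_eq_one_or (Edge.side e).parity.negOnePow with h' | h' <;> rw [h']
      · rwa [one_smul]
      · rw [Units.neg_smul, one_smul]
        exact Submodule.neg_mem _ h
    · rw [add_assoc]
      exact comp_mem_homogeneous (bPath_mem_homogeneous p) (edgeDiff_mem_homogeneous e)

theorem differential_bridgeHom (s : Side) (v w : DecLink n) :
    differential R v w (bridgeHom R s v w) = 0 := by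
  by_cases h : ∃ γ, IsBridgeEdge s γ v w
  · obtain ⟨γ, h⟩ := h
    rw [bridgeHom_eq h, differential_bEdge]
    cases s <;> rfl
  · rw [bridgeHom_eq_zero h, map_zero]

/-- The entry is a sum of products of bridge edges, and these are closed; this is the reason for d ∘
d = 0. -/
theorem differential_leftSquares (v w : DecLink n) :
    differential R v w (leftSquares R v w) = 0 := by
  rw [leftSquares, homMul, map_sum]
  refine Finset.sum_eq_zero fun a _ => ?_
  rw [differential_leibniz _ (bridgeHom_left_mem_homogeneous a w), differential_bridgeHom,
    differential_bridgeHom]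
  simp

theorem differential_edgeDiff (e : Edge v w) : differential R v w (edgeDiff R e) = 0 := by
  rcases e with ⟨_ | _, _, _⟩ | ⟨_ | _, _, _⟩
  · exact map_zero _
  · exact map_zero _
  · exact (map_neg _ _).trans (by rw [differential_leftSquares, neg_zero])
  · exact map_zero _

/-- Applying the Leibniz rule twice to a path p followed by an edge e leaves two cross terms dp ·
de. Their signs are opposite because de has first degree one more than e. -/
theorem differential_pathDiff (p : Quiver.Path v w) :
    differential R v w (pathDiff R p) = 0 := by
  induction p with
  | nil => exact map_zero _
  | cons p e ih =>
    rw [pathDiff, map_add, Units.smul_def, map_zsmul,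
      differential_leibniz _ (bEdge_mem_homogeneous e), ih, differential_bEdge,
      differential_leibniz _ (edgeDiff_mem_homogeneous e), differential_edgeDiff,
      differential_bPath, Edge.bidegree_fst, Prod.fst_add, Edge.bidegree_fst, Int.negOnePow_succ,
      Limits.zero_comp, Limits.comp_zero, smul_zero, zero_add, add_zero, Units.neg_smul,
      Units.smul_def]
    exact add_neg_cancel _

theorem isRightDifferential_differential :
    IsRightDifferential R fun v w : DecLink n => differential R v w where
  map_id v := by rw [← bPath_nil, differential_bPath]; rfl
  leibniz _ _ _ α _ _ hβ := differential_leibniz α hβ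
  bidegree v w g α hα := by
    induction hα using Submodule.span_induction with
    | zero => simp
    | add f f' _ _ hf hf' => rw [map_add]; exact Submodule.add_mem _ hf hf'
    | smul r f _ hf => rw [map_smul]; exact Submodule.smul_mem _ _ hf
    | mem f hf =>
      obtain ⟨p, rfl, rfl⟩ := hf
      rw [differential_bPath]
      exact pathDiff_mem_homogeneous p
  sq_zero v w α := by
    have hα : α ∈ Submodule.span R (Set.range (bPath R)) := by rw [span_range_bPath]; trivial
    induction hα using Submodule.span_induction with
    | zero => simp
    | add f f' _ _ hf hf' => rw [map_add, map_add, hf, hf', add_zero]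
    | smul r f _ hf => rw [map_smul, map_smul, hf, smul_zero]
    | mem f hf =>
      obtain ⟨p, rfl⟩ := hf
      rw [differential_bPath, differential_pathDiff]

/-- Paths span, and the Leibniz rule with a single, hence homogeneous, last edge reduces a path to
its edges. -/
theorem IsRightDifferential.ext {d d' : ∀ v w : DecLink n, (bObj R v ⟶ bObj R w) →ₗ[R]
    (bObj R v ⟶ bObj R w)} (hd : IsRightDifferential R d) (hd' : IsRightDifferential R d')
    (h : ∀ (v w : DecLink n) (e : Edge v w), d v w (bEdge R e) = d' v w (bEdge R e)) : d = d' := by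
  funext v w
  refine LinearMap.ext_on (span_range_bPath v w) ?_
  rintro _ ⟨p, rfl⟩
  induction p with
  | nil => rw [bPath_nil, hd.map_id, hd'.map_id]
  | cons p e ih =>
    rw [bPath_cons, hd.leibniz _ _ _ _ _ _ (bEdge_mem_homogeneous e),
      hd'.leibniz _ _ _ _ _ _ (bEdge_mem_homogeneous e), ih, h]

end Descent

/-! ### The prescribed sum over round trips -/

noncomputable section RoundTripSum

variable {R : Type*} [CommRing R] {n : ℕ} {v w : DecLink n}

theorem LeftRoundTrip.mid_injective : Function.Injective (LeftRoundTrip.mid (v := v) (w := w)) := by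
  rintro ⟨a, γ, h, k⟩ ⟨b, γ', h', k'⟩ rfl
  obtain rfl := h.unique h'
  rfl

/-- When the links of `v` and `w` agree, the second of two left bridges from `v` to `w` is the
co-core of the first. -/
theorem IsBridgeEdge.back_of_link_eq {a : DecLink n} {γ γ' : Finset (Finset (Fin (2 * n)))}
    (hl : w.link = v.link) (h : IsBridgeEdge .left γ v a) (h' : IsBridgeEdge .left γ' a w) :
    IsBridgeEdge .left (v.dagger .left a) a w := by
  obtain ⟨x, z, hx, -⟩ := h.exists_bridgeStep
  have hs : PlanarMatching.Surgery (a.link.half .left) (w.link.half .left) x z := hl ▸ hx.surgery.symm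
  rw [DecLink.dagger, hx.surgery.dagger_eq, ← h'.eq_arcPair hs]
  exact h'

/-- Between vertices with the same link every path of two left bridges is a round trip and is
determined by its middle vertex, so the prescribed sum is a matrix entry; vertices that are not on
such a path contribute zero. -/
theorem finsum_leftRoundTrip (hl : w.link = v.link) :
    ∑ᶠ p : LeftRoundTrip v w, bEdge R (.bridge .left p.γ p.there) ≫
      bEdge R (.bridge .left (v.dagger .left p.mid) p.back) = leftSquares R v w := by
  have := Fintype.ofFinite (LeftRoundTrip v w)
  rw [finsum_eq_sum_of_fintype]
  refine Fintype.sum_of_injective LeftRoundTrip.mid LeftRoundTrip.mid_injective _ _ ?_ ?_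
  · intro a ha
    by_contra hne
    obtain ⟨γ, h⟩ := not_imp_comm.1 (bridgeHom_eq_zero (R := R) (v := v) (w := a) (s := .left))
      fun h => hne (by rw [h, Limits.zero_comp])
    obtain ⟨γ', h'⟩ := not_imp_comm.1 (bridgeHom_eq_zero (R := R) (v := a) (w := w) (s := .left))
      fun h => hne (by rw [h, Limits.comp_zero])
    exact ha ⟨⟨a, γ, h, h.back_of_link_eq hl h'⟩, rfl⟩
  · intro p
    rw [bridgeHom_eq p.there, bridgeHom_eq p.back]

end RoundTripSum
end CleavedLinks

theorem mainTheorem3 (R : Type*) [CommRing R] (n : ℕ) :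
    ∃! d : ∀ v w : CleavedLinks.DecLink n,
        (CleavedLinks.bObj R v ⟶ CleavedLinks.bObj R w) →ₗ[R]
          (CleavedLinks.bObj R v ⟶ CleavedLinks.bObj R w),
      CleavedLinks.IsRightDifferential R d ∧
      (∀ (v w : CleavedLinks.DecLink n) (C : Set (Fin (2 * n)))
        (h : CleavedLinks.IsDecorationEdge C v w),
        d v w (CleavedLinks.bEdge R (.decoration .left C h)) =
          -∑ᶠ p : CleavedLinks.LeftRoundTrip v w,
            CleavedLinks.bEdge R (.bridge .left p.γ p.there) ≫
              CleavedLinks.bEdge R (.bridge .left (v.dagger .left p.mid) p.back)) ∧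
      (∀ (v w : CleavedLinks.DecLink n) (C : Set (Fin (2 * n)))
        (h : CleavedLinks.IsDecorationEdge C v w),
        d v w (CleavedLinks.bEdge R (.decoration .right C h)) = 0) ∧
      (∀ (v w : CleavedLinks.DecLink n) (s : CleavedLinks.Side)
        (γ : Finset (Finset (Fin (2 * n)))) (h : CleavedLinks.IsBridgeEdge s γ v w),
        d v w (CleavedLinks.bEdge R (.bridge s γ h)) = 0) := by
  refine ⟨fun v w => CleavedLinks.differential R v w,
    ⟨CleavedLinks.isRightDifferential_differential, ?_, ?_, ?_⟩, ?_⟩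
  · intro v w C h
    rw [CleavedLinks.finsum_leftRoundTrip h.link_eq]
    exact CleavedLinks.differential_bEdge _
  · intro v w C h
    exact CleavedLinks.differential_bEdge _
  · intro v w s γ h
    refine (CleavedLinks.differential_bEdge _).trans ?_
    cases s <;> rfl
  · rintro d ⟨hd, hl, hr, hb⟩
    refine hd.ext CleavedLinks.isRightDifferential_differential ?_
    rintro v w (⟨s, γ, h⟩ | ⟨_ | _, C, h⟩)
    · rw [hb, CleavedLinks.differential_bEdge]
      cases s <;> rfl
    · rw [hl, CleavedLinks.finsum_leftRoundTrip h.link_eq, CleavedLinks.differential_bEdge]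
      rfl
    · rw [hr, CleavedLinks.differential_bEdge]
      rfl
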